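/- Notation. All function spaces are complex valued. For $x\ge 0$ let $\mathfrak D_x$ be the self-adjoint operator in $L^2(\mathbb R)$ associated with the closed semi-bounded form $\mathfrak q_x(\psi)=\int_{\mathbb R}|\psi'(y)|^2\,dy-|\psi(-x)|^2-|\psi(x)|^2$, $\psi\in H^1(\mathbb R)$. Let $\mu_1(x)$ be its lowest eigenvalue, $u_x$ the corresponding positive $L^2$-normalized eigenfunction, $R(x)=\|\partial_x u_x\|_{L^2(\mathbb R_y)}^2$ for $x>0$, and $M=\sup_{x>0}R(x)$. Put $\hat\mu_1(x)=\tilde\mu_1(x)=\mu_1(x)$ for $x\ge 0$, and $\hat\mu_1(x)=1$, $\tilde\mu_1(x)=0$ for $x<0$. For $h>0$ let $\mathfrak H_h$, $\mathfrak H_h^{\mathrm{mod1}}$, $\mathfrak H_h^{\mathrm{mod2}}$ be the self-adjoint operators (Friedrichs extensions) associated with the closed semi-bounded forms $$\mathfrak Q_h(\psi)=\int_{\mathbb R^2}h^2|\partial_x\psi|^2+|\partial_y\psi|^2\,dx\,dy-\int_{\mathbb R}|\psi(|s|,s)|^2\,ds,\quad \psi\in H^1(\mathbb R^2),$$ $$\mathfrak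 Q_h^{\mathrm{mod1}}(f)=\int_{\mathbb R}h^2|f'|^2+\hat\mu_1|f|^2\,dx,\qquad \mathfrak Q_h^{\mathrm{mod2}}(f)=\int_{\mathbb R}h^2|f'|^2+\tilde\mu_1|f|^2\,dx,\quad f\in H^1(\mathbb R).$$ For a semi-bounded self-adjoint operator $\mathfrak H$, let $\mathcal N(\mathfrak H,a)$ be the number of points of $\sigma(\mathfrak H)\cap(-\infty,a]$ counted with multiplicity ($+\infty$ if the essential spectrum meets $(-\infty,a]$), and for $n\ge 1$ let the $n$-th eigenvalue be $\inf\{a:\mathcal N(\mathfrak H,a)\ge n\}$; this is the $n$-th eigenvalue counted with multiplicity if there are at least $n$ eigenvalues below the essential spectrum, and the bottom of the essential spectrum otherwise (the usual min-max convention). Write $\lambda_n(h)$, $\lambda_n^{\mathrm{mod1}}(h)$, $\lambda_n^{\mathrm{mod2}}(h)$ for the $n$-th eigenvalues of $\mathfrak H_h$, $\mathfrak H_h^{\mathrm{mod1}}$, $\mathfrak H_h^{\mathrm{mod2}}$. Proposition. $M<\infty$, and for every $M'>M$ there exist $M_0>0$ and $h_0>0$ such that for all $h\in(0,h_0)$: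 (i) for all $C_h\ge M_0h$, $$\mathcal N\Big(\mathfrak H_h^{\mathrm{mod1}},-\tfrac14-C_h-h^2M\Big)\le\mathcal N\Big(\mathfrak H_h,-\tfrac14-C_h\Big)\le\mathcal N\Big(\mathfrak H_h^{\mathrm{mod2}},\frac{-\frac14-C_h}{1-h}+(4M'+1)h\Big)<\infty;$$ (ii) for all $n\ge 1$, $$(1-h)\big\{\lambda_n^{\mathrm{mod2}}(h)-(4M'+1)h\big\}\le\lambda_n(h)\le\lambda_n^{\mathrm{mod1}}(h)+h^2M.$$ -/

import Mathlib

open MeasureTheory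

noncomputable section

namespace BrokenDelta

/-! ### Operators, spectra and counting functions

An (unbounded) operator `T` in a complex Hilbert space `E` is represented by its graph:
`(ψ, g) ∈ T` means that `ψ` is in the domain of `T` and `T ψ = g`. -/

section Spectral

variable {E F : Type*} [NormedAddCommGroup E] [InnerProductSpace ℂ E]

/-- The operator associated with a closed semi-bounded sesquilinear form (the Friedrichs extension
of the form). An element `v = (v.1, v.2)` of `V` consists of an element `v.1` of the form domain
and of additional data `v.2` determined by `v.1` (its derivatives, its traces), and `B w v` is the
value of the form, antilinear in `w` and linear in `v`. Then `ψ` is in the operator domain, with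
image `g`, iff `ψ` is in the form domain and `B φ ψ = ⟨φ, g⟩` for all `φ` in the form domain. -/
def formOperator (V : Set (E × F)) (B : E × F → E × F → ℂ) : Set (E × E) :=
  {p | ∃ v ∈ V, v.1 = p.1 ∧ ∀ w ∈ V, B w v = inner ℂ w.1 p.2}

/-- The eigenspace `ker (T - t)`. -/
def eigenspace (T : Set (E × E)) (t : ℝ) : Submodule ℂ E :=
  Submodule.span ℂ {ψ | (ψ, (t : ℂ) • ψ) ∈ T}

/-- The (real) spectrum of `T`: the `t` for which `T - t` has no bounded everywhere defined
inverse `R`, that is, no `R` such that `(T - t) ψ = k` is equivalent to `ψ = R k`. -/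
def spec (T : Set (E × E)) : Set ℝ :=
  {t | ¬ ∃ R : E →L[ℂ] E, ∀ ψ k : E, (ψ, k + (t : ℂ) • ψ) ∈ T ↔ ψ = R k}

/-- The discrete spectrum: isolated points of the spectrum that are eigenvalues of finite
multiplicity. -/
def discreteSpec (T : Set (E × E)) : Set ℝ :=
  {t | t ∈ spec T ∧ (∃ ε > 0, ∀ s ∈ spec T, |s - t| < ε → s = t) ∧
    eigenspace T t ≠ ⊥ ∧ FiniteDimensional ℂ (eigenspace T t)}

/-- The essential spectrum of a self-adjoint operator. -/
def essSpec (T : Set (E × E)) : Set ℝ :=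
  spec T \ discreteSpec T

open Classical in
/-- The counting function `N(T, a)`: the number of points of the spectrum in `(-∞, a]`, counted
with multiplicity. If there is no essential spectrum in `(-∞, a]`, it is the dimension of the
(direct) sum of the eigenspaces with eigenvalue `≤ a`; otherwise it is infinite. -/
def counting (T : Set (E × E)) (a : ℝ) : ℕ∞ :=
  if (essSpec T ∩ Set.Iic a).Nonempty then ⊤
  else Cardinal.toENat (Module.rank ℂ (⨆ t : Set.Iic a, eigenspace T (t : ℝ) : Submodule ℂ E))

/-- The `n`-th eigenvalue below the essential spectrum (`n ≥ 1`), in increasing order and counted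
with multiplicity, of a semi-bounded self-adjoint operator. As in the min-max formula, its value is
the bottom of the essential spectrum if there are fewer than `n` eigenvalues below it. -/
def nthEigenvalue (T : Set (E × E)) (n : ℕ) : ℝ :=
  sInf {a : ℝ | (n : ℕ∞) ≤ counting T a}

end Spectral

/-! ### Sobolev spaces -/

/-- The Hilbert space `L²(ℝ)`. -/
abbrev L2R : Type := Lp ℂ 2 (volume : Measure ℝ)

/-- The Hilbert space `L²(ℝ²)`. -/
abbrev L2R2 : Type := Lp ℂ 2 (volume : Measure (ℝ × ℝ))

/-- Test functions: smooth with compact support. -/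
def IsTest {X : Type*} [NormedAddCommGroup X] [NormedSpace ℝ X] (φ : X → ℂ) : Prop :=
  ContDiff ℝ (⊤ : ℕ∞) φ ∧ HasCompactSupport φ

/-- `H¹(ℝ)`, as the set of all pairs `(f, f')`: the closure of the test functions with respect to
the norm of `H¹`. -/
def H1R : Set (L2R × L2R) :=
  closure {p | ∃ φ : ℝ → ℂ, IsTest φ ∧ p.1 =ᵐ[volume] φ ∧ p.2 =ᵐ[volume] deriv φ}

/-- `H¹(ℝ)`, as the set of all `(f, f', f(-x), f(x))`, where the point evaluations on `H¹(ℝ)` are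
extended by continuity from the test functions. -/
def H1RWithValues (x : ℝ) : Set (L2R × (L2R × ℂ × ℂ)) :=
  closure {p | ∃ φ : ℝ → ℂ, IsTest φ ∧ p.1 =ᵐ[volume] φ ∧ p.2.1 =ᵐ[volume] deriv φ ∧
    p.2.2.1 = φ (-x) ∧ p.2.2.2 = φ x}

/-- `H¹(ℝ²)`, as the set of all `(ψ, ∂ₓψ, ∂ᵧψ, s ↦ ψ(|s|, s))`, where the trace on the broken line
is extended by continuity from the test functions to a bounded map `H¹(ℝ²) → L²(ℝ)`. -/
def H1R2WithTrace : Set (L2R2 × (L2R2 × L2R2 × L2R)) :=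
  closure {p | ∃ φ : ℝ × ℝ → ℂ, IsTest φ ∧ p.1 =ᵐ[volume] φ ∧
    p.2.1 =ᵐ[volume] (fun z => fderiv ℝ φ z (1, 0)) ∧
    p.2.2.1 =ᵐ[volume] (fun z => fderiv ℝ φ z (0, 1)) ∧
    p.2.2.2 =ᵐ[volume] (fun s : ℝ => φ (|s|, s))}

/-! ### The broken `δ`-interaction -/

/-- The sesquilinear form of
`𝔔_h(ψ) = ∫ h²|∂ₓψ|² + |∂ᵧψ|² dx dy - ∫ |ψ(|s|, s)|² ds`. -/
def brokenForm (h : ℝ) (w v : L2R2 × (L2R2 × L2R2 × L2R)) : ℂ :=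
  (h : ℂ) ^ 2 * inner ℂ w.2.1 v.2.1 + inner ℂ w.2.2.1 v.2.2.1 - inner ℂ w.2.2.2 v.2.2.2

/-- The operator `ℌ_h = -h²∂ₓ² - ∂ᵧ² - δ` with the `δ`-interaction on `{(|s|, s)}`. -/
def brokenOperator (h : ℝ) : Set (L2R2 × L2R2) :=
  formOperator H1R2WithTrace (brokenForm h)

/-! ### The double `δ`-well -/

/-- The sesquilinear form of `q_x(ψ) = ∫ |ψ'|² - |ψ(-x)|² - |ψ(x)|²`. -/
def wellForm (w v : L2R × (L2R × ℂ × ℂ)) : ℂ :=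
  inner ℂ w.2.1 v.2.1 - inner ℂ w.2.2.1 v.2.2.1 - inner ℂ w.2.2.2 v.2.2.2

/-- The operator `𝔇_x = -∂ᵧ² - δ_{-x} - δ_x`. -/
def wellOperator (x : ℝ) : Set (L2R × L2R) :=
  formOperator (H1RWithValues x) wellForm

/-- `μ₁(x)`, the lowest eigenvalue of the double `δ`-well (for `x ≥ 0`). -/
def mu1 (x : ℝ) : ℝ :=
  sInf {t : ℝ | eigenspace (wellOperator x) t ≠ ⊥}

/-- `u` is the (continuous representative of the) positive `L²`-normalized eigenfunction of the
double `δ`-well for its lowest eigenvalue. -/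
def IsGroundState (x : ℝ) (u : ℝ → ℝ) : Prop :=
  Continuous u ∧ (∀ y, 0 < u y) ∧
    ∃ ψ : L2R, ψ =ᵐ[volume] (fun y => (u y : ℂ)) ∧ ‖ψ‖ = 1 ∧
      (ψ, (mu1 x : ℂ) • ψ) ∈ wellOperator x

/-- The ground state `y ↦ u_x(y)` of the double `δ`-well (for `x ≥ 0`). -/
def groundState (x : ℝ) : ℝ → ℝ :=
  Classical.epsilon (IsGroundState x)

/-- `R(x) = ‖∂ₓ u_x‖²`, the norm being that of `L²(ℝ)` in the variable `y`. -/
def R (x : ℝ) : ENNReal :=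
  ∫⁻ y : ℝ, ‖deriv (fun t => groundState t y) x‖ₑ ^ 2

/-- `M = sup_{x > 0} R(x)`. -/
def M : ENNReal :=
  ⨆ x ∈ Set.Ioi (0 : ℝ), R x

/-! ### The one-dimensional models -/

/-- `μ̂₁(x)` is `μ₁(x)` for `x ≥ 0` and `1` for `x < 0`. -/
def mu1hat (x : ℝ) : ℝ :=
  if 0 ≤ x then mu1 x else 1

/-- `μ̃₁(x)` is `μ₁(x)` for `x ≥ 0` and `0` for `x < 0`. -/
def mu1tilde (x : ℝ) : ℝ :=
  if 0 ≤ x then mu1 x else 0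

/-- The sesquilinear form of `∫ h²|f'|² + W |f|² dx`. -/
def schrodingerForm (h : ℝ) (W : ℝ → ℝ) (w v : L2R × L2R) : ℂ :=
  (h : ℂ) ^ 2 * inner ℂ w.2 v.2 + ∫ x : ℝ, (W x : ℂ) * inner ℂ (w.1 x) (v.1 x)

/-- The operator `-h²∂ₓ² + W` in `L²(ℝ)`, with form domain `H¹(ℝ)`. -/
def schrodingerOperator (h : ℝ) (W : ℝ → ℝ) : Set (L2R × L2R) :=
  formOperator H1R (schrodingerForm h W)

/-- The first model `-h²∂ₓ² + μ̂₁`. -/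
def mod1 (h : ℝ) : Set (L2R × L2R) :=
  schrodingerOperator h mu1hat

/-- The second model `-h²∂ₓ² + μ̃₁`. -/
def mod2 (h : ℝ) : Set (L2R × L2R) :=
  schrodingerOperator h mu1tilde

end BrokenDelta

end

/-! This is an adiabatic (Born–Oppenheimer) reduction. A vertical line at x > 0 meets the broken
line at y = ±x and a line at x < 0 misses it, so by Fubini the form is h²‖∂ₓψ‖² plus, slice by
slice, q_x(ψ(x,·)) for x > 0 and ∫|∂ᵧψ|² dy for x < 0. Both inequalities pass between functions of x
and functions in the plane by means of u_x, continued to x < 0 by u₀.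

Upper bound on the energy: insert f(x)u_x(y). The vertical energy is μ₁(x)|f|² for x > 0, and |f|²
for x < 0 because u₀ = e^{-|y|}; this is the potential of the first model. Normalization gives ⟨u_x,
∂ₓu_x⟩ = 0, so the horizontal energy is |f'|² + ‖∂ₓu_x‖²|f|², and the excess is at most h²M
(`brokenForm_trial_le`).

Lower bound: put f(x) = ⟨u_x, φ(x,·)⟩. On the orthogonal complement of u_x the slice energy is at
least -1/4 (`exists_ground`). In f' = ⟨u_x, ∂ₓφ⟩ + ⟨∂ₓu_x, φ⟩ the second term sees only the part of
φ orthogonal to u_x. Splitting |f'|² with weights 1 - h and h yields `le_brokenForm`. For energies a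
< -1/4 - hM the orthogonal part can be discarded, and f has energy at most (a + h)/(1 - h) in the
second model, up to ε.

The double well is solved explicitly: e^{-κ|y-a|} reproduces point evaluation for ‖ψ'‖² + κ²‖ψ‖², so
u_x is proportional to e^{-κ|y-x|} + e^{-κ|y+x|} with 2κ = 1 + e^{-2κx}, and μ₁ = -κ². An
exponentially decaying Lipschitz bound in x (`abs_state_sub_le`) gives M < ∞.

The counting function is defined through the spectrum. It is linked to forms by writing the operator
as (JJ*)⁻¹ - c, with J the inclusion of the form domain; this gives both halves of the min-max
principle, and `counting_le_counting` turns form inequalities on test functions into inequalities of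
counts. Finiteness for the second model is a Poincaré estimate with finitely many nodes
(`counting_mod2_lt_top`). The eigenvalue inequalities follow by taking infima over thresholds. -/

namespace BrokenDelta

/-! ### Functional calculus of bounded self-adjoint operators and shifted inverses -/

section SelfAdjoint
variable {E : Type*} [NormedAddCommGroup E] [InnerProductSpace ℂ E] [CompleteSpace E]

theorem cfc_sub_id {A : E →L[ℂ] E} (hA : IsSelfAdjoint A) (r : ℝ) :
    cfc (fun x => x - r) A = A - (r : ℂ) • 1 := by
  rw [cfc_sub (fun x : ℝ => x) (fun _ => r) A (by fun_prop) (by fun_prop), cfc_id' ℝ A,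
    cfc_const r A]
  congr 1

/-- An isolated point of the spectrum of a self-adjoint operator is an eigenvalue. -/
theorem exists_eigenvector_of_isolated {A : E →L[ℂ] E} (hA : IsSelfAdjoint A) {r δ : ℝ}
    (hδ : 0 < δ) (hr : r ∈ spectrum ℝ A) (hiso : ∀ s ∈ spectrum ℝ A, |s - r| < δ → s = r) :
    ∃ x : E, x ≠ 0 ∧ A x = (r : ℂ) • x := by
  -- A tent supported in the gap around r: (x - r) f(x) vanishes on the spectrum while f(r) = 1.
  -- Hence f(A) is nonzero and maps into the eigenspace.
  set f : ℝ → ℝ := fun x => max 0 (1 - |x - r| / δ) with hf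
  have hfc : Continuous f := by fun_prop
  have h0 : cfc (fun x => (x - r) * f x) A = 0 := by
    rw [← cfc_const_zero ℝ A]
    refine cfc_congr fun x hx => ?_
    by_cases h : |x - r| < δ
    · simp [hiso x hx h]
    · have : f x = 0 := by
        simp only [hf]
        rw [max_eq_left]
        have : 1 ≤ |x - r| / δ := by rw [le_div_iff₀ hδ]; linarith [not_lt.1 h]
        linarith
      simp [this]
  have h1 : cfc f A ≠ 0 := by
    intro h
    have h2 := cfc_map_spectrum f A hA hfc.continuousOn
    have h3 : (1 : ℝ) ∈ f '' spectrum ℝ A := ⟨r, hr, by simp [hf]⟩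
    rw [← h2, h] at h3
    exact absurd (h3) (by
      rw [spectrum.mem_iff, not_not]
      simp)
  rw [cfc_mul (fun x => x - r) f A (by fun_prop) hfc.continuousOn, cfc_sub_id hA] at h0
  obtain ⟨x, hx⟩ : ∃ x, cfc f A x ≠ 0 := by
    by_contra! h; exact h1 (ContinuousLinearMap.ext h)
  refine ⟨_, hx, ?_⟩
  have := congrArg (fun T : E →L[ℂ] E => T x) h0
  simpa [sub_eq_zero] using this

/-- `1 - f` vanishes on [b, ∞), a neighbourhood of s, so it is divisible by y - s with a continuous
quotient, and A - s kills x. -/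
theorem cfc_apply_eigenvector {A : E →L[ℂ] E} (hA : IsSelfAdjoint A) {f : ℝ → ℝ}
    (hf : Continuous f) {s b : ℝ} (hsb : b < s) (hfb : ∀ x, b ≤ x → f x = 1) {x : E}
    (hx : A x = (s : ℂ) • x) : cfc f A x = x := by
  -- Truncating y at b keeps the denominator away from zero and changes it only where the numerator
  -- vanishes.
  set k : ℝ → ℝ := fun y => (1 - f y) / (min y b - s) with hk
  have hne : ∀ y, min y b - s ≠ 0 := fun y => by have := min_le_right y b; linarith
  have hkc : Continuous k := by
    refine (by fun_prop : Continuous fun y => 1 - f y).div₀ (by fun_prop) hne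
  have h1 : cfc (fun y => k y * (y - s)) A = cfc (fun y => 1 - f y) A := by
    congr 1; ext y
    by_cases h : b ≤ y
    · simp [hk, hfb y h]
    · have := hne y
      rw [min_eq_left (not_le.1 h).le] at this
      simp only [hk]
      rw [min_eq_left (not_le.1 h).le]; field_simp
  rw [cfc_mul k (fun y => y - s) A hkc.continuousOn (by fun_prop), cfc_sub_id hA,
    cfc_sub (fun _ => 1) f A (by fun_prop) hf.continuousOn, cfc_const_one ℝ A] at h1
  have := congrArg (fun T : E →L[ℂ] E => T x) h1
  simp [hx] at this
  rw [eq_comm, sub_eq_zero] at this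
  exact this.symm

/-- Disjointly supported bump functions at `n` spectral points above `b` yield `n` linearly
independent vectors in the fixed space of `f(A)`. -/
theorem exists_linearIndependent_of_spectrum {A : E →L[ℂ] E} (hA : IsSelfAdjoint A) {f : ℝ → ℝ}
    (hf : Continuous f) {b : ℝ} (hfb : ∀ x, b ≤ x → f x = 1) {n : ℕ} {s : Fin n → ℝ}
    (hs : Function.Injective s) (hsp : ∀ i, s i ∈ spectrum ℝ A) (hsb : ∀ i, b < s i) :
    ∃ v : Fin n → E, LinearIndependent ℂ v ∧ ∀ i, cfc f A (v i) = v i := by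
  -- Tents of half-width δ at the points s i are then disjoint and supported where f = 1.
  obtain ⟨δ, hδ, hδs, hδb⟩ : ∃ δ > 0, (∀ i j, i ≠ j → 2 * δ ≤ |s i - s j|) ∧
      ∀ i, δ ≤ s i - b := by
    have h1 : ∀ᶠ δ in nhdsWithin (0 : ℝ) (Set.Ioi 0), ∀ i j, i ≠ j → 2 * δ ≤ |s i - s j| := by
      refine Filter.eventually_all.2 fun i => Filter.eventually_all.2 fun j => ?_
      by_cases h : i = j
      · simp [h]
      · have : 0 < |s i - s j| := abs_pos.2 (sub_ne_zero.2 (hs.ne h))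
        filter_upwards [Ioo_mem_nhdsGT (show (0 : ℝ) < |s i - s j| / 2 by positivity)] with δ hδ _
        linarith [hδ.2]
    have h2 : ∀ᶠ δ in nhdsWithin (0 : ℝ) (Set.Ioi 0), ∀ i, δ ≤ s i - b := by
      refine Filter.eventually_all.2 fun i => ?_
      filter_upwards [Ioo_mem_nhdsGT (sub_pos.2 (hsb i))] with δ hδ using hδ.2.le
    obtain ⟨δ, hδ⟩ := (h1.and (h2.and self_mem_nhdsWithin)).exists
    exact ⟨δ, hδ.2.2, hδ.1, hδ.2.1⟩
  set g : Fin n → ℝ → ℝ := fun i x => max 0 (1 - |x - s i| / δ) with hg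
  have hgc : ∀ i, Continuous (g i) := fun i => by fun_prop
  have hg0 : ∀ i x, δ ≤ |x - s i| → g i x = 0 := fun i x h => by
    simp only [hg]
    rw [max_eq_left]
    have : 1 ≤ |x - s i| / δ := by rwa [le_div_iff₀ hδ, one_mul]
    linarith
  have hne : ∀ i, ∃ x, cfc (g i) A x ≠ 0 := by
    intro i
    by_contra! h
    have h' : cfc (g i) A = 0 := ContinuousLinearMap.ext h
    have h2 := cfc_map_spectrum (g i) A hA (hgc i).continuousOn
    have h3 : (1 : ℝ) ∈ g i '' spectrum ℝ A := ⟨s i, hsp i, by simp [hg]⟩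
    rw [← h2, h'] at h3
    exact absurd (h3) (by
      rw [spectrum.mem_iff, not_not]
      simp)
  choose x hx using hne
  refine ⟨fun i => cfc (g i) A (x i), ?_, fun i => ?_⟩
  · refine linearIndependent_of_ne_zero_of_inner_eq_zero (𝕜 := ℂ) hx fun i j hij => ?_
    have hsa : IsSelfAdjoint (cfc (g i) A) := cfc_predicate _ _
    have h0 : cfc (g i) A * cfc (g j) A = 0 := by
      rw [← cfc_mul (g i) (g j) A (hgc i).continuousOn (hgc j).continuousOn, ← cfc_const_zero ℝ A]
      congr 1; ext y
      by_cases h : δ ≤ |y - s i|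
      · simp [hg0 i y h]
      · have : δ ≤ |y - s j| := by
          have h1 := hδs i j hij
          have h2 := abs_sub_le (s i) y (s j)
          rw [abs_sub_comm (s i) y] at h2
          push Not at h
          linarith
        simp [hg0 j y this]
    have h1 := (ContinuousLinearMap.isSelfAdjoint_iff_isSymmetric.1 hsa) (x i) (cfc (g j) A (x j))
    have h2 : (cfc (g i) A) ((cfc (g j) A) (x j)) = 0 :=
      congrArg (fun T : E →L[ℂ] E => T (x j)) h0
    simp only [ContinuousLinearMap.coe_coe] at h1
    change inner ℂ (cfc (g i) A (x i)) (cfc (g j) A (x j)) = 0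
    rw [h1, h2, inner_zero_right]
  · have h0 : cfc f A * cfc (g i) A = cfc (g i) A := by
      rw [← cfc_mul f (g i) A hf.continuousOn (hgc i).continuousOn]
      congr 1; ext y
      by_cases h : δ ≤ |y - s i|
      · simp [hg0 i y h]
      · push Not at h
        have := abs_lt.1 h
        have := hδb i
        rw [hfb y (by linarith), one_mul]
    exact congrArg (fun T : E →L[ℂ] E => T (x i)) h0

/-- The graph of `R⁻¹ - c`. -/
def shiftedInverse (R : E →L[ℂ] E) (c : ℝ) : Set (E × E) :=
  {p | p.1 = R (p.2 + (c : ℂ) • p.1)}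

omit [CompleteSpace E] in
-- With τ = t + c, the equation (R⁻¹ - c - t)ψ = k reads (1 - τR)ψ = Rk, which makes sense even if R
-- is not injective. A solution operator S makes 1 + τS the inverse of 1 - τR, and conversely S = (1
-- - τR)⁻¹R.
theorem mem_spec_shiftedInverse {R : E →L[ℂ] E} {c t : ℝ} :
    t ∈ spec (shiftedInverse R c) ↔ ¬ IsUnit (1 - ((t + c : ℝ) : ℂ) • R) := by
  set τ : ℂ := ((t + c : ℝ) : ℂ) with hτ
  have key : ∀ ψ k : E, (ψ, k + (t : ℂ) • ψ) ∈ shiftedInverse R c ↔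
      (1 - τ • R) ψ = R k := fun ψ k => by
    simp only [shiftedInverse, Set.mem_ofPred_eq, hτ]
    have : k + (t : ℂ) • ψ + (c : ℂ) • ψ = k + ((t + c : ℝ) : ℂ) • ψ := by
      push_cast; rw [add_smul, add_assoc]
    rw [this, map_add, map_smul]
    simp [sub_eq_iff_eq_add]
  simp only [spec, Set.mem_ofPred_eq, key, not_iff_not]
  constructor
  · rintro ⟨S, hS⟩
    have h1 : (1 - τ • R) * S = R := ContinuousLinearMap.ext fun k => (hS (S k) k).2 rfl
    have h2 : S * (1 - τ • R) = R := ContinuousLinearMap.ext fun k => by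
      have := (hS (R k) ((1 - τ • R) k)).1 (by simp)
      exact this.symm
    refine isUnit_iff_exists.2 ⟨1 + τ • S, ?_, ?_⟩
    · rw [mul_add, mul_smul_comm, h1]; simp
    · rw [add_mul, smul_mul_assoc, h2]; simp
  · rintro ⟨u, hu⟩
    refine ⟨(↑u⁻¹ : E →L[ℂ] E) * R, fun ψ k => ?_⟩
    rw [← hu]
    constructor
    · intro h
      rw [mul_apply_eq_comp, ← h, ← mul_apply_eq_comp, u.inv_mul]; rfl
    · rintro rfl
      rw [← mul_apply_eq_comp, u.mul_inv_cancel_left]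

omit [CompleteSpace E] in
theorem isUnit_one_sub_smul_iff {R : E →L[ℂ] E} {τ : ℝ} (hτ : τ ≠ 0) :
    IsUnit (1 - (τ : ℂ) • R) ↔ τ⁻¹ ∉ spectrum ℝ R := by
  rw [spectrum.notMem_iff]
  have h : (1 - (τ : ℂ) • R) = (Units.mk0 (τ : ℂ) (by exact_mod_cast hτ)) •
      (algebraMap ℝ (E →L[ℂ] E) τ⁻¹ - R) := by
    rw [smul_sub, Algebra.algebraMap_eq_smul_one]
    congr 1
    ext x
    simp only [Units.smul_mk0, smul_apply, one_apply_eq_self]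
    rw [← Complex.coe_smul, smul_smul, Complex.ofReal_inv, mul_inv_cancel₀ (by exact_mod_cast hτ),
      one_smul]
  rw [h, isUnit_smul_iff]

omit [CompleteSpace E] in
theorem eigenspace_shiftedInverse {R : E →L[ℂ] E} {c t : ℝ} {ψ : E} :
    ψ ∈ eigenspace (shiftedInverse R c) t ↔ ψ = ((t + c : ℝ) : ℂ) • R ψ := by
  have h : {ψ | (ψ, (t : ℂ) • ψ) ∈ shiftedInverse R c} =
      (LinearMap.ker ((1 - ((t + c : ℝ) : ℂ) • R : E →L[ℂ] E) : E →ₗ[ℂ] E) : Set E) := by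
    ext ψ
    simp only [shiftedInverse, Set.mem_ofPred_eq, SetLike.mem_coe, LinearMap.mem_ker]
    rw [← add_smul, map_smul]
    simp [sub_eq_zero]
  rw [eigenspace, h, Submodule.span_eq, LinearMap.mem_ker]
  simp [sub_eq_zero]

end SelfAdjoint

/-! ### Counting function of R⁻¹ - c in terms of the quadratic form of R -/

section SelfAdjoint
variable {E : Type*} [NormedAddCommGroup E] [InnerProductSpace ℂ E] [CompleteSpace E]

omit [CompleteSpace E] in
theorem IsPositive.eigenvalue_pos {R : E →L[ℂ] E} (hR : R.IsPositive) {τ : ℝ} {ψ : E}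
    (hψ : ψ = (τ : ℂ) • R ψ) (h0 : ψ ≠ 0) : 0 < τ := by
  by_contra! h
  have h1 : (inner ℂ ψ ψ : ℂ) = τ * inner ℂ ψ (R ψ) := by
    rw [← inner_smul_right, ← hψ]
  have h2 := congrArg Complex.re h1
  have h3 := (Complex.nonneg_iff.1 (hR.inner_nonneg_right ψ)).1
  rw [Complex.re_ofReal_mul] at h2
  have h4 : 0 < (inner ℂ ψ ψ : ℂ).re := by
    have := inner_self_eq_norm_sq_to_K (𝕜 := ℂ) ψ
    rw [this]
    have h5 : 0 < ‖ψ‖ := norm_pos_iff.2 h0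
    have h6 : 0 < ‖ψ‖ ^ 2 := by positivity
    exact_mod_cast h6
  nlinarith

theorem mem_spec_shiftedInverse_iff {R : E →L[ℂ] E} (hR : R.IsPositive) {c t : ℝ} :
    t ∈ spec (shiftedInverse R c) ↔ 0 < t + c ∧ (t + c)⁻¹ ∈ spectrum ℝ R := by
  rw [mem_spec_shiftedInverse]
  by_cases h0 : t + c = 0
  · simp [h0]
  rw [isUnit_one_sub_smul_iff h0, not_not]
  refine ⟨fun h => ⟨?_, h⟩, fun h => h.2⟩
  have := spectrum_nonneg_of_nonneg ((ContinuousLinearMap.nonneg_iff_isPositive R).2 hR) h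
  exact lt_of_le_of_ne (inv_nonneg.1 this) (Ne.symm h0)

/-- The map s ↦ s⁻¹ - c is continuous at (t + c)⁻¹ and carries positive spectral points of R to
spectral points of the shifted inverse, so isolation transfers. -/
theorem exists_isolated_spectrum {R : E →L[ℂ] E} (hR : R.IsPositive) {c t ε : ℝ} (hε : 0 < ε)
    (ht : t ∈ spec (shiftedInverse R c))
    (hiso : ∀ s ∈ spec (shiftedInverse R c), |s - t| < ε → s = t) :
    ∃ δ > 0, ∀ s ∈ spectrum ℝ R, |s - (t + c)⁻¹| < δ → s = (t + c)⁻¹ := by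
  obtain ⟨h0, -⟩ := (mem_spec_shiftedInverse_iff hR).1 ht
  have hc : ContinuousAt (fun s : ℝ => s⁻¹ - c) (t + c)⁻¹ :=
    (continuousAt_inv₀ (by positivity)).sub continuousAt_const
  have h1 : ∀ᶠ s in nhds (t + c)⁻¹, |s⁻¹ - c - t| < ε := by
    have := hc.eventually (Metric.ball_mem_nhds _ hε)
    filter_upwards [this] with s hs
    rw [Real.dist_eq] at hs
    simpa using hs
  have h2 : ∀ᶠ s in nhds (t + c)⁻¹, 0 < s := lt_mem_nhds (by positivity)
  obtain ⟨δ, hδ, h⟩ := Metric.eventually_nhds_iff.1 (h1.and h2)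
  refine ⟨δ, hδ, fun s hs hd => ?_⟩
  obtain ⟨h3, h4⟩ := h (by rwa [Real.dist_eq])
  have h5 : s⁻¹ - c = t := by
    refine hiso _ ?_ h3
    rw [mem_spec_shiftedInverse_iff hR]
    simpa using ⟨h4, hs⟩
  rw [← h5]; simp

/-- The operator f(R), with f = 1 above (a + c + ε/2)⁻¹ and f = 0 below (a + c + ε)⁻¹, plays the
role of a spectral projection. A count of at least n provides n independent vectors fixed by f(R),
and on its fixed space R is injective and satisfies the Rayleigh bound. -/
theorem exists_linearIndependent_of_le_counting {R : E →L[ℂ] E} (hR : R.IsPositive) {a c ε : ℝ}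
    (hac : 0 < a + c) {n : ℕ} (hn : (n : ℕ∞) ≤ counting (shiftedInverse R c) a) (hε : 0 < ε) :
    ∃ v : Fin n → E, LinearIndependent ℂ v ∧ ∀ x ∈ Submodule.span ℂ (Set.range v),
      (inner ℂ x (R x) : ℂ).re ≤ (a + c + ε) * ‖R x‖ ^ 2 ∧ (R x = 0 → x = 0) := by
  have hsa := hR.isSelfAdjoint
  set b := (a + c + ε / 2)⁻¹ with hb
  set s₀ := (a + c + ε)⁻¹ with hs₀
  have hs₀pos : 0 < s₀ := by positivity
  have hbs : s₀ < b := inv_strictAnti₀ (by positivity) (by linarith)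
  have hba : b < (a + c)⁻¹ := inv_strictAnti₀ (by positivity) (by linarith)
  set f : ℝ → ℝ := fun x => max 0 (min 1 ((x - s₀) / (b - s₀))) with hf
  have hfc : Continuous f := by fun_prop
  have hf1 : ∀ x, b ≤ x → f x = 1 := fun x hx => by
    have : 1 ≤ (x - s₀) / (b - s₀) := by rw [le_div_iff₀ (by linarith)]; linarith
    simp [hf, min_eq_left this]
  have hf0 : ∀ x, x ≤ s₀ → f x = 0 := fun x hx => by
    have : (x - s₀) / (b - s₀) ≤ 0 := div_nonpos_of_nonpos_of_nonneg (by linarith) (by linarith)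
    simp only [hf]
    rw [max_eq_left]
    exact (min_le_right _ _).trans this
  have hFsa : IsSelfAdjoint (cfc f R) := cfc_predicate _ _
  have hsymm : ∀ x y, (inner ℂ (cfc f R x) y : ℂ) = inner ℂ x (cfc f R y) := fun x y =>
    (ContinuousLinearMap.isSelfAdjoint_iff_isSymmetric.1 hFsa) x y
  have hRsymm : ∀ x y, (inner ℂ (R x) y : ℂ) = inner ℂ x (R y) := fun x y =>
    (ContinuousLinearMap.isSelfAdjoint_iff_isSymmetric.1 hsa) x y
  have heig : ∀ t ≤ a, ∀ ψ ∈ eigenspace (shiftedInverse R c) t, cfc f R ψ = ψ := by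
    intro t ht ψ hψ
    rw [eigenspace_shiftedInverse] at hψ
    by_cases h0 : ψ = 0
    · simp [h0]
    have hpos := IsPositive.eigenvalue_pos hR hψ h0
    refine cfc_apply_eigenvector hsa hfc (b := b) (s := (t + c)⁻¹) ?_ hf1 ?_
    · exact hba.trans_le (inv_anti₀ hpos (by linarith))
    · conv_rhs => rw [hψ]
      rw [smul_smul, ← Complex.ofReal_mul, inv_mul_cancel₀ hpos.ne']; simp
  obtain ⟨v, hv, hFv⟩ : ∃ v : Fin n → E, LinearIndependent ℂ v ∧ ∀ i, cfc f R (v i) = v i := by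
    have sub : ∀ W : Submodule ℂ E, (∀ ψ ∈ W, cfc f R ψ = ψ) → (n : Cardinal) ≤ Module.rank ℂ W →
        ∃ v : Fin n → E, LinearIndependent ℂ v ∧ ∀ i, cfc f R (v i) = v i := by
      intro W hW hr
      obtain ⟨v, hv⟩ := Module.le_rank_iff.1 hr
      exact ⟨fun i => v i, hv.map' W.subtype (Submodule.ker_subtype W), fun i => hW _ (v i).2⟩
    -- Three sources of n fixed vectors: an isolated point of the essential spectrum is an
    -- eigenvalue, hence of infinite multiplicity; a non-isolated one has infinitely many spectral
    -- points within ε/2; without essential spectrum the eigenspaces up to a have total dimension at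
    -- least n.
    by_cases hess : (essSpec (shiftedInverse R c) ∩ Set.Iic a).Nonempty
    · obtain ⟨t, ⟨htS, htd⟩, hta⟩ := hess
      obtain ⟨htc, hts⟩ := (mem_spec_shiftedInverse_iff hR).1 htS
      by_cases hiso : ∃ ε > 0, ∀ s ∈ spec (shiftedInverse R c), |s - t| < ε → s = t
      · obtain ⟨ε', hε', hiso'⟩ := hiso
        obtain ⟨δ, hδ, hd⟩ := exists_isolated_spectrum hR hε' htS hiso'
        obtain ⟨x, hx0, hx⟩ := exists_eigenvector_of_isolated hsa hδ hts hd
        have hxe : x ∈ eigenspace (shiftedInverse R c) t := by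
          rw [eigenspace_shiftedInverse, hx, smul_smul, ← Complex.ofReal_mul,
            mul_inv_cancel₀ htc.ne']; simp
        have hfin : ¬ FiniteDimensional ℂ (eigenspace (shiftedInverse R c) t) := by
          intro hfin
          refine htd ⟨htS, ⟨ε', hε', hiso'⟩, ?_, hfin⟩
          intro hbot
          rw [hbot, Submodule.mem_bot] at hxe
          exact hx0 hxe
        refine sub _ (heig t hta) ?_
        have : ¬ Module.rank ℂ (eigenspace (shiftedInverse R c) t) < Cardinal.aleph0 := by
          rwa [Module.rank_lt_aleph0_iff]
        exact (Cardinal.natCast_lt_aleph0.le).trans (not_lt.1 this)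
      · push Not at hiso
        have hinf : {s ∈ spec (shiftedInverse R c) | |s - t| < ε / 2}.Infinite := by
          intro hfin
          have hcl := (hfin.subset (Set.sdiff_subset (t := {t}))).isClosed
          have hmem : t ∈ ({s ∈ spec (shiftedInverse R c) | |s - t| < ε / 2} \ {t})ᶜ := by simp
          obtain ⟨η, hη, hball⟩ := Metric.isOpen_iff.1 hcl.isOpen_compl t hmem
          obtain ⟨s, hs, hst, hne⟩ := hiso (min η (ε / 2)) (by positivity)
          have := hball (show s ∈ Metric.ball t η by
            rw [Metric.mem_ball, Real.dist_eq]; exact hst.trans_le (min_le_left _ _))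
          exact this ⟨⟨hs, hst.trans_le (min_le_right _ _)⟩, hne⟩
        obtain ⟨S, hS, hcard⟩ := hinf.exists_subset_card_eq n
        let e := S.equivFinOfCardEq hcard
        have hmem : ∀ i, ((e.symm i : S) : ℝ) ∈ spec (shiftedInverse R c) ∧
          |((e.symm i : S) : ℝ) - t| < ε / 2 := fun i => hS (e.symm i).2
        refine exists_linearIndependent_of_spectrum hsa hfc hf1
          (s := fun i => (((e.symm i : S) : ℝ) + c)⁻¹) ?_ ?_ ?_
        · intro i j hij
          have := inv_injective hij
          exact e.symm.injective (Subtype.ext (by linarith))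
        · exact fun i => ((mem_spec_shiftedInverse_iff hR).1 (hmem i).1).2
        · intro i
          refine inv_strictAnti₀ ((mem_spec_shiftedInverse_iff hR).1 (hmem i).1).1 ?_
          have := (abs_lt.1 (hmem i).2).2
          have : t ≤ a := hta
          linarith
    · rw [counting, if_neg hess, Cardinal.natCast_le_toENat] at hn
      refine sub _ (fun ψ hψ => ?_) hn
      have : (⨆ t : Set.Iic a, eigenspace (shiftedInverse R c) (t : ℝ)) ≤
          LinearMap.ker ((cfc f R - 1 : E →L[ℂ] E) : E →ₗ[ℂ] E) := by
        refine iSup_le fun t χ hχ => ?_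
        simp [heig t t.2 χ hχ]
      have := this hψ
      simpa [sub_eq_zero] using this
  refine ⟨v, hv, fun x hx => ?_⟩
  have hFx : cfc f R x = x := by
    have : Submodule.span ℂ (Set.range v) ≤
        LinearMap.ker ((cfc f R - 1 : E →L[ℂ] E) : E →ₗ[ℂ] E) := by
      refine Submodule.span_le.2 ?_
      rintro _ ⟨i, rfl⟩
      simp [hFv i]
    have := this hx
    simpa [sub_eq_zero] using this
  constructor
  -- The factor s₀⁻¹y² - y is negative only for 0 < y < s₀, where f vanishes; evaluate the positive
  -- operator at x = f(R)x.
  · have hpos : (cfc (fun y => f y * ((s₀⁻¹ * (y * y) - y) * f y)) R).IsPositive := by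
      rw [← ContinuousLinearMap.nonneg_iff_isPositive]
      refine cfc_nonneg fun y hy => ?_
      by_cases h : y ≤ s₀
      · simp [hf0 y h]
      · have : 0 ≤ s₀⁻¹ * (y * y) - y := by
          have h1 : 1 ≤ s₀⁻¹ * y := by
            rw [inv_mul_eq_div, le_div_iff₀ hs₀pos]; linarith [not_le.1 h]
          nlinarith [not_le.1 h]
        have h2 : 0 ≤ f y := le_max_left _ _
        positivity
    have hcomp : cfc (fun y => f y * ((s₀⁻¹ * (y * y) - y) * f y)) R x =
        cfc f R ((s₀⁻¹ : ℂ) • R (R x) - R x) := by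
      rw [cfc_mul f _ R hfc.continuousOn (by fun_prop),
        cfc_mul _ f R (by fun_prop) hfc.continuousOn,
        cfc_sub (fun y : ℝ => s₀⁻¹ * (y * y)) (fun y => y) R (by fun_prop) (by fun_prop),
        cfc_const_mul s₀⁻¹ (fun y => y * y) R (by fun_prop),
        cfc_mul (fun y : ℝ => y) (fun y => y) R (by fun_prop) (by fun_prop), cfc_id' ℝ R]
      simp only [mul_apply_eq_comp, sub_apply, smul_apply, hFx]
      rw [← Complex.coe_smul, Complex.ofReal_inv]
    have h1 := (Complex.nonneg_iff.1 (hpos.inner_nonneg_right x)).1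
    rw [hcomp, ← hsymm, hFx, inner_sub_right, inner_smul_right, ← hRsymm,
      inner_self_eq_norm_sq_to_K, Complex.sub_re] at h1
    have h2 : ((s₀⁻¹ : ℂ) * ((‖R x‖ : ℝ) : ℂ) ^ 2).re = (a + c + ε) * ‖R x‖ ^ 2 := by
      rw [hs₀]; norm_cast; simp
    have h3 : (inner ℂ x (R x) : ℂ).re ≤ ((s₀⁻¹ : ℂ) * ((‖R x‖ : ℝ) : ℂ) ^ 2).re := by
      simpa using h1
    rwa [h2] at h3
  · intro h0
    -- Since f(y) = (f(y) / max(y, s₀)) y, the operator f(R) factors through R, and Rx = 0 forces x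
    -- = f(R)x = 0.
    have hg : Continuous fun y => f y / max y s₀ :=
      hfc.div₀ (by fun_prop) fun y => (lt_max_of_lt_right hs₀pos).ne'
    have h1 : cfc f R = cfc (fun y => f y / max y s₀) R * R := by
      conv_rhs => rw [← cfc_id' ℝ R]
      conv_rhs => enter [1]; rw [cfc_id' ℝ R]
      rw [← cfc_mul _ _ R hg.continuousOn (by fun_prop)]
      congr 1; ext y
      by_cases h : y ≤ s₀
      · simp [hf0 y h]
      · rw [max_eq_left (not_le.1 h).le]
        have : y ≠ 0 := by linarith [not_le.1 h]
        field_simp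
    rw [h1, mul_apply_eq_comp, h0, map_zero] at hFx
    exact hFx.symm

omit [CompleteSpace E] in
-- On the range of P the operator s - RP is s - R, and on the kernel of P it is s. The inverse is
-- therefore the sum of (s - R)⁻¹P and s⁻¹(1 - P).
theorem spectrum_compression {R P : E →L[ℂ] E} (hP : P * P = P) (hRP : R * P = P * R) {s : ℝ}
    (hs : s ≠ 0) (h : s ∈ spectrum ℝ (R * P)) : s ∈ spectrum ℝ R := by
  by_contra hn
  rw [spectrum.notMem_iff] at hn
  refine h ?_
  obtain ⟨u, hu⟩ := hn
  set z : E →L[ℂ] E := algebraMap ℝ _ s with hz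
  set z' : E →L[ℂ] E := algebraMap ℝ _ s⁻¹ with hz'
  have hzz : z * z' = 1 := by rw [hz, hz', ← map_mul, mul_inv_cancel₀ hs, map_one]
  have hzz' : z' * z = 1 := by rw [hz, hz', ← map_mul, inv_mul_cancel₀ hs, map_one]
  have hcz : ∀ x, z * x = x * z := fun x => Algebra.commutes s x
  have hcz' : ∀ x, z' * x = x * z' := fun x => Algebra.commutes s⁻¹ x
  have hPu : Commute P (u : E →L[ℂ] E) := by
    rw [hu]; unfold Commute SemiconjBy; rw [mul_sub, sub_mul, hcz, hRP]
  have hPu' : P * (↑u⁻¹ : E →L[ℂ] E) = ↑u⁻¹ * P := hPu.units_inv_right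
  have e1 : z - R * P = u * P + z * (1 - P) := by rw [hu]; noncomm_ring
  have hPQ : P * (1 - P) = 0 := by rw [mul_sub, hP, mul_one, sub_self]
  have hQP : (1 - P) * P = 0 := by rw [sub_mul, hP, one_mul, sub_self]
  have hQQ : (1 - P) * (1 - P) = 1 - P := by rw [mul_sub, hQP, mul_one, sub_zero]
  have hQz : (1 - P) * z' = z' * (1 - P) := (hcz' _).symm
  have hQzz : (1 - P) * z = z * (1 - P) := (hcz _).symm
  have hPz : P * z' = z' * P := (hcz' _).symm
  have hPzz : P * z = z * P := (hcz _).symm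
  have hQu : (1 - P) * (↑u⁻¹ : E →L[ℂ] E) = ↑u⁻¹ * (1 - P) := by
    rw [sub_mul, mul_sub, hPu']; simp
  have hQu2 : (1 - P) * (↑u : E →L[ℂ] E) = ↑u * (1 - P) := by
    rw [sub_mul, mul_sub, hPu]; simp
  have mid : ∀ a b X Y : E →L[ℂ] E, X * b = b * X → a * X * (b * Y) = a * b * (X * Y) :=
    fun a b X Y hX => by rw [mul_assoc, ← mul_assoc X, hX]; noncomm_ring
  change IsUnit (z - R * P)
  rw [e1]
  refine isUnit_iff_exists.2 ⟨↑u⁻¹ * P + z' * (1 - P), ?_, ?_⟩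
  · rw [add_mul, mul_add, mul_add, mid _ _ _ _ hPu', mid _ _ _ _ hPz, mid _ _ _ _ hQu,
      mid _ _ _ _ hQz, hP, hPQ, hQP, hQQ, u.mul_inv, hzz]
    noncomm_ring
  · rw [add_mul, mul_add, mul_add, mid _ _ _ _ hPu, mid _ _ _ _ hPzz, mid _ _ _ _ hQu2,
      mid _ _ _ _ hQzz, hP, hPQ, hQP, hQQ, u.inv_mul, hzz']
    noncomm_ring

/-- W is the sum of the eigenspaces up to a, and r is the norm of the compression A of R to Wᗮ. This
norm lies in the spectrum of A, so r(a + c) ≥ 1 would give a spectral point r⁻¹ - c ≤ a. That point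
would be discrete, thus isolated, and A would have an eigenvector lying both in Wᗮ and in W. -/
theorem exists_submodule_of_counting_lt {R : E →L[ℂ] E} (hR : R.IsPositive) {a c : ℝ}
    {n : ℕ} (hn : counting (shiftedInverse R c) a < n) :
    ∃ W : Submodule ℂ E, FiniteDimensional ℂ W ∧ Module.finrank ℂ W < n ∧
      ∃ r : ℝ, 0 ≤ r ∧ r * (a + c) < 1 ∧ ∀ x ∈ Wᗮ, (inner ℂ x (R x) : ℂ).re ≤ r * ‖x‖ ^ 2 := by
  have hsa := hR.isSelfAdjoint
  have hRsymm : ∀ x y, (inner ℂ (R x) y : ℂ) = inner ℂ x (R y) := fun x y =>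
    (ContinuousLinearMap.isSelfAdjoint_iff_isSymmetric.1 hsa) x y
  have hess : ¬ (essSpec (shiftedInverse R c) ∩ Set.Iic a).Nonempty := by
    intro h
    rw [counting, if_pos h] at hn
    exact absurd hn (by simp)
  rw [counting, if_neg hess] at hn
  set W : Submodule ℂ E := ⨆ t : Set.Iic a, eigenspace (shiftedInverse R c) (t : ℝ) with hW
  have hrank : Module.rank ℂ W < n := by
    by_contra! h
    exact absurd hn (not_lt.2 (Cardinal.natCast_le_toENat.2 h))
  have hfin : FiniteDimensional ℂ W :=
    Module.rank_lt_aleph0_iff.1 (hrank.trans Cardinal.natCast_lt_aleph0)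
  have hfr : Module.finrank ℂ W < n := by
    rw [← Module.finrank_eq_rank] at hrank
    exact_mod_cast hrank
  refine ⟨W, hfin, hfr, ?_⟩
  have hinv : ∀ x ∈ W, R x ∈ W := by
    have : W ≤ W.comap (R : E →ₗ[ℂ] E) := by
      refine iSup_le fun t ψ hψ => ?_
      have h1 : ψ ∈ W := Submodule.mem_iSup_of_mem t hψ
      rw [eigenspace_shiftedInverse] at hψ
      rw [Submodule.mem_comap]
      by_cases h0 : ψ = 0
      · simp [h0]
      have hpos := IsPositive.eigenvalue_pos hR hψ h0
      have h2 : R ψ = (((t : ℝ) + c : ℝ) : ℂ)⁻¹ • ψ := by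
        conv_rhs => rw [hψ]
        rw [smul_smul, inv_mul_cancel₀ (by exact_mod_cast hpos.ne'), one_smul]
      rw [ContinuousLinearMap.coe_coe, h2]
      exact W.smul_mem _ h1
    exact this
  have hinv' : ∀ x ∈ Wᗮ, R x ∈ Wᗮ := fun x hx => by
    rw [Submodule.mem_orthogonal] at hx ⊢
    intro u hu
    rw [← hRsymm]
    exact hx _ (hinv u hu)
  set P : E →L[ℂ] E := Wᗮ.starProjection with hPdef
  have hPmem : ∀ x, P x ∈ Wᗮ := fun x => Submodule.starProjection_apply_mem _ x
  have hPself : ∀ x ∈ Wᗮ, P x = x := fun x hx => Submodule.starProjection_eq_self_iff.2 hx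
  have hPW : ∀ x ∈ W, P x = 0 := fun x hx => by
    rw [hPdef, Submodule.starProjection_orthogonal]
    simp [Submodule.starProjection_eq_self_iff.2 hx]
  have hPP : P * P = P := ContinuousLinearMap.ext fun x => hPself _ (hPmem x)
  have hRP : R * P = P * R := ContinuousLinearMap.ext fun x => by
    have h1 : x = W.starProjection x + P x := by
      rw [hPdef, Submodule.starProjection_orthogonal]; simp
    have h2 : R x = R (W.starProjection x) + R (P x) := by
      conv_lhs => rw [h1, map_add]
    rw [mul_apply_eq_comp, mul_apply_eq_comp, h2, map_add, hPself _ (hinv' _ (hPmem x)),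
      hPW _ (hinv _ (Submodule.starProjection_apply_mem _ x)), zero_add]
  have hPsa : IsSelfAdjoint P := isSelfAdjoint_starProjection Wᗮ
  set A := R * P with hA
  have hAx : ∀ x ∈ Wᗮ, A x = R x := fun x hx => by rw [hA, mul_apply_eq_comp, hPself x hx]
  have hApos : A.IsPositive := by
    have h := hR.conj_adjoint P
    rw [ContinuousLinearMap.isSelfAdjoint_iff'.1 hPsa] at h
    have : P ∘SL R ∘SL P = A := by
      change P * (R * P) = A
      rw [← mul_assoc, ← hRP, hA, mul_assoc, hPP]
    rwa [this] at h
  refine ⟨‖A‖, norm_nonneg _, ?_, fun x hx => ?_⟩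
  · by_cases hA0 : A = 0
    · simp [hA0]
    have : Nontrivial (E →L[ℂ] E) := ⟨A, 0, hA0⟩
    have hmem : ‖A‖ ∈ spectrum ℝ A := CStarAlgebra.norm_mem_spectrum_of_nonneg
      ((ContinuousLinearMap.nonneg_iff_isPositive A).2 hApos)
    have hrpos : 0 < ‖A‖ := norm_pos_iff.2 hA0
    by_contra! hr
    set t := ‖A‖⁻¹ - c with ht
    have hta : t ≤ a := by
      have : ‖A‖⁻¹ ≤ a + c := by rwa [inv_le_iff_one_le_mul₀' hrpos]
      linarith
    have htS : t ∈ spec (shiftedInverse R c) := by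
      rw [mem_spec_shiftedInverse_iff hR]
      simpa [ht] using ⟨hA0, spectrum_compression hPP hRP hrpos.ne' hmem⟩
    have htd : t ∈ discreteSpec (shiftedInverse R c) := by
      by_contra h
      exact hess ⟨t, ⟨htS, h⟩, hta⟩
    obtain ⟨-, ⟨ε, hε, hiso⟩, -, -⟩ := htd
    obtain ⟨δ, hδ, hd⟩ := exists_isolated_spectrum hR hε htS hiso
    have htr : (t + c)⁻¹ = ‖A‖ := by simp [ht]
    rw [htr] at hd
    obtain ⟨x, hx0, hx⟩ := exists_eigenvector_of_isolated hApos.isSelfAdjoint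
      (δ := min δ ‖A‖) (by positivity) hmem (fun s hs hsd => by
        refine hd s (spectrum_compression hPP hRP ?_ hs) (hsd.trans_le (min_le_left _ _))
        rintro rfl
        have := hsd.trans_le (min_le_right _ _)
        simp at this)
    have hxW : x ∈ Wᗮ := by
      have h1 : A x ∈ Wᗮ := by rw [hA, mul_apply_eq_comp]; exact hinv' _ (hPmem x)
      rw [hx] at h1
      exact (Submodule.smul_mem_iff _ (by exact_mod_cast hrpos.ne')).1 h1
    have hxW' : x ∈ W := by
      refine Submodule.mem_iSup_of_mem (⟨t, hta⟩ : Set.Iic a) ?_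
      rw [eigenspace_shiftedInverse, ← hAx x hxW, hx, smul_smul]
      simp only [ht]
      rw [← Complex.ofReal_mul, sub_add_cancel, inv_mul_cancel₀ hrpos.ne']; simp
    exact hx0 (inner_self_eq_zero.1 (Submodule.inner_right_of_mem_orthogonal hxW' hxW))
  · rw [← hAx x hx]
    calc (inner ℂ x (A x) : ℂ).re ≤ ‖(inner ℂ x (A x) : ℂ)‖ := Complex.re_le_norm _
      _ ≤ ‖x‖ * ‖A x‖ := norm_inner_le_norm _ _
      _ ≤ ‖x‖ * (‖A‖ * ‖x‖) := by gcongr; exact A.le_opNorm x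
      _ = ‖A‖ * ‖x‖ ^ 2 := by ring

end SelfAdjoint

/-! ### Min-max principle for (JJ*)⁻¹ - c -/

section Hilbert
variable {E H : Type*} [NormedAddCommGroup E] [InnerProductSpace ℂ E] [CompleteSpace E]
  [NormedAddCommGroup H] [InnerProductSpace ℂ H] [CompleteSpace H]

theorem isPositive_comp_adjoint (J : H →L[ℂ] E) :
    (J ∘SL ContinuousLinearMap.adjoint J).IsPositive := by
  have := (ContinuousLinearMap.isPositive_one (𝕜 := ℂ) (E := H)).conj_adjoint J
  simpa [ContinuousLinearMap.one_def] using this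

/-- The weak equation determines v as the Riesz representative J*(g + cψ). -/
theorem shiftedInverse_comp_adjoint (J : H →L[ℂ] E) (c : ℝ) :
    shiftedInverse (J ∘SL ContinuousLinearMap.adjoint J) c =
      {p | ∃ v : H, J v = p.1 ∧ ∀ w, (inner ℂ w v : ℂ) = inner ℂ (J w) (p.2 + (c : ℂ) • p.1)} := by
  ext ⟨ψ, g⟩
  simp only [shiftedInverse, Set.mem_ofPred_eq, ContinuousLinearMap.comp_apply]
  constructor
  · intro h
    exact ⟨_, h.symm, fun w => ContinuousLinearMap.adjoint_inner_right J w _⟩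
  · rintro ⟨v, hv, h⟩
    have : v = ContinuousLinearMap.adjoint J (g + (c : ℂ) • ψ) := by
      refine ext_inner_left ℂ fun w => ?_
      rw [h w, ContinuousLinearMap.adjoint_inner_right]
    rw [← this, hv]

/-- The trial vectors are the images under J* of the spectral vectors: ‖J*y‖² = ⟨y, JJ*y⟩, and the
bound for R = JJ* becomes the Rayleigh bound for J*y. -/
theorem exists_of_le_counting (J : H →L[ℂ] E) {a c ε : ℝ} (hac : 0 < a + c) {n : ℕ}
    (hn : (n : ℕ∞) ≤ counting (shiftedInverse (J ∘SL ContinuousLinearMap.adjoint J) c) a)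
    (hε : 0 < ε) : ∃ v : Fin n → H, ∀ x : Fin n → ℂ, x ≠ 0 →
      ‖∑ i, x i • v i‖ ^ 2 < (a + c + ε) * ‖J (∑ i, x i • v i)‖ ^ 2 := by
  obtain ⟨χ, hχ, h⟩ := exists_linearIndependent_of_le_counting (isPositive_comp_adjoint J) hac hn
    (half_pos hε)
  refine ⟨fun i => ContinuousLinearMap.adjoint J (χ i), fun x hx => ?_⟩
  set y := ∑ i, x i • χ i with hy
  have hsum : ∑ i, x i • ContinuousLinearMap.adjoint J (χ i) = ContinuousLinearMap.adjoint J y := by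
    simp [hy, map_sum]
  have hy0 : y ≠ 0 := fun h0 => hx (funext fun i =>
    Fintype.linearIndependent_iff.1 hχ x h0 i)
  obtain ⟨h1, h2⟩ := h y (Submodule.sum_mem _ fun i _ => Submodule.smul_mem _ _
    (Submodule.subset_span ⟨i, rfl⟩))
  rw [hsum]
  have h3 : ‖ContinuousLinearMap.adjoint J y‖ ^ 2 =
      (inner ℂ y ((J ∘SL ContinuousLinearMap.adjoint J) y) : ℂ).re := by
    rw [ContinuousLinearMap.comp_apply, ← ContinuousLinearMap.adjoint_inner_left,
      inner_self_eq_norm_sq_to_K]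
    norm_cast
  rw [h3]
  refine h1.trans_lt ?_
  have h4 : 0 < ‖(J ∘SL ContinuousLinearMap.adjoint J) y‖ :=
    norm_pos_iff.2 fun h0 => hy0 (h2 h0)
  change (a + c + ε / 2) * ‖(J ∘SL ContinuousLinearMap.adjoint J) y‖ ^ 2 <
    (a + c + ε) * ‖(J ∘SL ContinuousLinearMap.adjoint J) y‖ ^ 2
  have : 0 < ‖(J ∘SL ContinuousLinearMap.adjoint J) y‖ ^ 2 := by positivity
  nlinarith

/-- If the count were below n, some nonzero combination w would have Jw orthogonal to W, whose
dimension is below n. Then ‖Jw‖² = ⟨w, J*Jw⟩ and Cauchy–Schwarz give ‖Jw‖² ≤ r‖w‖², which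
contradicts the hypothesis once r(a + c + ε) ≤ 1. -/
theorem le_counting_of_exists (J : H →L[ℂ] E) {a c : ℝ} {n : ℕ}
    (h : ∀ ε > 0, ∃ v : Fin n → H, ∀ x : Fin n → ℂ, x ≠ 0 →
      ‖∑ i, x i • v i‖ ^ 2 < (a + c + ε) * ‖J (∑ i, x i • v i)‖ ^ 2) :
    (n : ℕ∞) ≤ counting (shiftedInverse (J ∘SL ContinuousLinearMap.adjoint J) c) a := by
  by_contra! hn
  obtain ⟨W, hfin, hfr, r, hr0, hr, hW⟩ :=
    exists_submodule_of_counting_lt (isPositive_comp_adjoint J) hn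
  obtain ⟨ε, hε, hrε⟩ : ∃ ε > 0, r * (a + c + ε) ≤ 1 := by
    -- Dividing by r + 1 instead of r covers the case r = 0.
    refine ⟨(1 - r * (a + c)) / (r + 1), div_pos (by linarith) (by linarith), ?_⟩
    have : r * ((1 - r * (a + c)) / (r + 1)) ≤ 1 - r * (a + c) := by
      rw [mul_div_assoc', div_le_iff₀ (by linarith)]
      nlinarith
    linarith
  obtain ⟨v, hv⟩ := h ε hε
  let f : (Fin n → ℂ) →ₗ[ℂ] W := (W.orthogonalProjectionOnto : E →ₗ[ℂ] W) ∘ₗ (J : H →ₗ[ℂ] E) ∘ₗ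
    Fintype.linearCombination ℂ v
  have hker : LinearMap.ker f ≠ ⊥ := LinearMap.ker_ne_bot_of_finrank_lt (by simpa using hfr)
  obtain ⟨x, hxk, hx0⟩ := Submodule.exists_mem_ne_zero_of_ne_bot hker
  have h1 := hv x hx0
  set w := ∑ i, x i • v i with hw
  have hJw : J w ∈ Wᗮ := by
    have : W.orthogonalProjectionOnto (J w) = 0 := by
      simpa [f, Fintype.linearCombination_apply, ← hw] using hxk
    simpa using this
  have h2 := hW _ hJw
  have h3 : (inner ℂ (J w) ((J ∘SL ContinuousLinearMap.adjoint J) (J w)) : ℂ).re =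
      ‖ContinuousLinearMap.adjoint J (J w)‖ ^ 2 := by
    rw [ContinuousLinearMap.comp_apply, ← ContinuousLinearMap.adjoint_inner_left,
      inner_self_eq_norm_sq_to_K]
    norm_cast
  rw [h3] at h2
  have h4 : ‖J w‖ ^ 2 ≤ ‖w‖ * ‖ContinuousLinearMap.adjoint J (J w)‖ := by
    have h5 : ((‖J w‖ ^ 2 : ℝ) : ℂ) = inner ℂ w (ContinuousLinearMap.adjoint J (J w)) := by
      rw [ContinuousLinearMap.adjoint_inner_right, inner_self_eq_norm_sq_to_K]; norm_cast
    have h6 := norm_inner_le_norm (𝕜 := ℂ) w (ContinuousLinearMap.adjoint J (J w))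
    rw [← h5, Complex.norm_real, Real.norm_of_nonneg (by positivity)] at h6
    exact h6
  have h5 : (‖J w‖ ^ 2) ^ 2 ≤ ‖w‖ ^ 2 * (r * ‖J w‖ ^ 2) := by
    calc (‖J w‖ ^ 2) ^ 2 ≤ (‖w‖ * ‖ContinuousLinearMap.adjoint J (J w)‖) ^ 2 := by gcongr
      _ = ‖w‖ ^ 2 * ‖ContinuousLinearMap.adjoint J (J w)‖ ^ 2 := by ring
      _ ≤ _ := by gcongr
  have h6 : 0 < ‖J w‖ ^ 2 := by
    by_contra! h7
    have h8 : ‖J w‖ ^ 2 = 0 := le_antisymm h7 (by positivity)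
    rw [h8, mul_zero] at h1
    exact absurd h1 (not_lt.2 (by positivity))
  have h7 : ‖J w‖ ^ 2 ≤ r * ‖w‖ ^ 2 := by
    by_contra! h8
    nlinarith
  by_cases hr00 : r = 0
  · rw [hr00, zero_mul] at h7; linarith
  · have : 0 < r := lt_of_le_of_ne hr0 (Ne.symm hr00)
    nlinarith

omit [CompleteSpace E] [CompleteSpace H] in
-- By homogeneity the strict inequality is a condition on the compact unit sphere of coefficients.
-- It therefore survives small perturbations of v, and v can be moved into a dense set such as the
-- test functions.
theorem exists_mem_dense (J : H →L[ℂ] E) {S : Set H} (hS : Dense S) {b : ℝ} {n : ℕ}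
    (h : ∃ v : Fin n → H, ∀ x : Fin n → ℂ, x ≠ 0 →
      ‖∑ i, x i • v i‖ ^ 2 < b * ‖J (∑ i, x i • v i)‖ ^ 2) :
    ∃ v : Fin n → H, (∀ i, v i ∈ S) ∧ ∀ x : Fin n → ℂ, x ≠ 0 →
      ‖∑ i, x i • v i‖ ^ 2 < b * ‖J (∑ i, x i • v i)‖ ^ 2 := by
  obtain ⟨v, hv⟩ := h
  have hev : ∀ᶠ w in nhds v, ∀ x ∈ Metric.sphere (0 : Fin n → ℂ) 1,
      ‖∑ i, x i • w i‖ ^ 2 < b * ‖J (∑ i, x i • w i)‖ ^ 2 := by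
    refine IsCompact.eventually_forall_of_forall_eventually (isCompact_sphere _ _) fun x hx => ?_
    have hx0 : x ≠ 0 := by rintro rfl; simp at hx
    have hc1 : Continuous fun z : (Fin n → H) × (Fin n → ℂ) => ‖∑ i, z.2 i • z.1 i‖ ^ 2 := by
      fun_prop
    have hc2 : Continuous fun z : (Fin n → H) × (Fin n → ℂ) => b * ‖J (∑ i, z.2 i • z.1 i)‖ ^ 2 := by
      fun_prop
    exact (isOpen_lt hc1 hc2).mem_nhds (hv x hx0)
  have hd : Dense (Set.pi Set.univ fun _ : Fin n => S) := dense_pi Set.univ fun _ _ => hS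
  obtain ⟨w, hw, hwS⟩ := mem_closure_iff_nhds.1 (hd v) _ hev
  refine ⟨w, fun i => hwS i (Set.mem_univ i), fun x hx => ?_⟩
  have hnx : ‖x‖ ≠ 0 := norm_ne_zero_iff.2 hx
  have h1 := hw ((‖x‖⁻¹ : ℂ) • x) (by
    rw [mem_sphere_zero_iff_norm, norm_smul]; simp [hnx])
  have h2 : ∑ i, ((‖x‖⁻¹ : ℂ) • x) i • w i = (‖x‖⁻¹ : ℂ) • ∑ i, x i • w i := by
    simp [Finset.smul_sum, smul_smul]
  rw [h2, map_smul, norm_smul, norm_smul, mul_pow, mul_pow, mul_left_comm] at h1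
  exact lt_of_mul_lt_mul_left h1 (by positivity)

end Hilbert

/-! ### Closed semi-bounded forms and their operators -/

section Form
universe u v
variable {E : Type u} {F : Type v} [NormedAddCommGroup E] [InnerProductSpace ℂ E]
  [NormedAddCommGroup F] [NormedSpace ℂ F]

/-- A bounded hermitian form `B` on `E × F` which is semi-bounded and closed on the closure
of `D`. -/
structure IsClosedForm (D : Submodule ℂ (E × F)) (B : E × F → E × F → ℂ) : Prop where
  add_right : ∀ w v v', B w (v + v') = B w v + B w v'
  smul_right : ∀ w v (z : ℂ), B w (z • v) = z * B w v
  conj_symm : ∀ w v, (starRingEnd ℂ) (B v w) = B w v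
  bound : ∃ K : ℝ, ∀ w v, ‖B w v‖ ≤ K * ‖w‖ * ‖v‖
  coercive : ∃ c δ : ℝ, 0 < δ ∧ ∀ v ∈ D, δ * ‖v‖ ^ 2 ≤ (B v v).re + c * ‖v.1‖ ^ 2

namespace IsClosedForm
variable {D : Submodule ℂ (E × F)} {B : E × F → E × F → ℂ}

theorem add_left (hB : IsClosedForm D B) (w w' v : E × F) : B (w + w') v = B w v + B w' v := by
  rw [← hB.conj_symm, hB.add_right, map_add, hB.conj_symm, hB.conj_symm]

theorem smul_left (hB : IsClosedForm D B) (w v : E × F) (z : ℂ) :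
    B (z • w) v = (starRingEnd ℂ) z * B w v := by
  rw [← hB.conj_symm, hB.smul_right, map_mul, hB.conj_symm]

theorem continuous_diag (hB : IsClosedForm D B) : Continuous fun v => B v v := by
  obtain ⟨K, hK⟩ := hB.bound
  refine continuous_iff_continuousAt.2 fun v₀ => ?_
  have hsub : ∀ v, B v v - B v₀ v₀ = B (v - v₀) v + B v₀ (v - v₀) := fun v => by
    have h1 := hB.add_left (v - v₀) v₀ v
    have h2 := hB.add_right v₀ (v - v₀) v₀
    rw [sub_add_cancel] at h1 h2
    rw [h1, h2]; ring
  have h0 : Filter.Tendsto (fun v => K * ‖v - v₀‖ * ‖v‖ + K * ‖v₀‖ * ‖v - v₀‖) (nhds v₀)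
      (nhds 0) := by
    have : Continuous fun v => K * ‖v - v₀‖ * ‖v‖ + K * ‖v₀‖ * ‖v - v₀‖ := by fun_prop
    simpa using this.tendsto v₀
  refine tendsto_iff_norm_sub_tendsto_zero.2 (squeeze_zero (fun _ => norm_nonneg _) (fun v => ?_) h0)
  rw [hsub]
  exact (norm_add_le _ _).trans (add_le_add (hK _ _) (hK _ _))

theorem coercive_closure (hB : IsClosedForm D B) (b : ℝ) : ∃ c δ : ℝ, 0 < b + c ∧ 0 < δ ∧
    ∀ v ∈ D.topologicalClosure, δ * ‖v‖ ^ 2 ≤ (B v v).re + c * ‖v.1‖ ^ 2 := by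
  obtain ⟨c₀, δ, hδ, hc₀⟩ := hB.coercive
  -- Coercivity persists when the shift is enlarged, and 1 - b makes b + c positive.
  refine ⟨max c₀ (1 - b), δ, by linarith [le_max_right c₀ (1 - b)], hδ, ?_⟩
  have hcl : IsClosed {v : E × F | δ * ‖v‖ ^ 2 ≤ (B v v).re + max c₀ (1 - b) * ‖v.1‖ ^ 2} := by
    refine isClosed_le (by fun_prop) ?_
    have := Complex.continuous_re.comp hB.continuous_diag
    exact this.add (by fun_prop)
  refine closure_minimal (fun v hv => ?_) hcl
  have h1 := hc₀ v hv
  have h2 : c₀ * ‖v.1‖ ^ 2 ≤ max c₀ (1 - b) * ‖v.1‖ ^ 2 := by gcongr; exact le_max_left _ _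
  change δ * ‖v‖ ^ 2 ≤ (B v v).re + max c₀ (1 - b) * ‖v.1‖ ^ 2
  linarith

/-- The form domain, to be equipped with the inner product `B + c`. -/
def FormDomain (D : Submodule ℂ (E × F)) : Type _ := D.topologicalClosure

instance : AddCommGroup (FormDomain D) := inferInstanceAs (AddCommGroup D.topologicalClosure)

instance : Module ℂ (FormDomain D) := inferInstanceAs (Module ℂ D.topologicalClosure)

/-- The identification of `FormDomain D` with a subspace of `E × F`. -/
def FormDomain.equiv (D : Submodule ℂ (E × F)) : FormDomain D ≃ₗ[ℂ] D.topologicalClosure :=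
  LinearEquiv.refl ℂ D.topologicalClosure

omit [NormedAddCommGroup F] [NormedSpace ℂ F] in
theorem re_inner_fst (v : E × F) (z : ℂ) (c : ℝ) :
    (z + c * inner ℂ v.1 v.1).re = z.re + c * ‖v.1‖ ^ 2 := by
  have h2 : (inner ℂ v.1 v.1 : ℂ) = ((‖v.1‖ ^ 2 : ℝ) : ℂ) := by
    rw [inner_self_eq_norm_sq_to_K]; norm_cast
  rw [h2, ← Complex.ofReal_mul, Complex.add_re, Complex.ofReal_re]

/-- The inner product `B + c` on the form domain. -/
@[reducible] noncomputable def core (hB : IsClosedForm D B) {c δ : ℝ} (hδ : 0 < δ)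
    (h : ∀ v ∈ D.topologicalClosure, δ * ‖v‖ ^ 2 ≤ (B v v).re + c * ‖v.1‖ ^ 2) :
    InnerProductSpace.Core ℂ (FormDomain D) where
  inner v w := B (FormDomain.equiv D v : E × F) (FormDomain.equiv D w : E × F) +
    c * inner ℂ (FormDomain.equiv D v : E × F).1 (FormDomain.equiv D w : E × F).1
  conj_inner_symm v w := by
    simp only [map_add, map_mul, hB.conj_symm, Complex.conj_ofReal, inner_conj_symm]
  re_inner_nonneg v := by
    rw [RCLike.re_eq_complex_re]
    rw [re_inner_fst]
    exact le_trans (by positivity) (h _ (FormDomain.equiv D v).2)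
  add_left v w u := by
    simp only [map_add, Submodule.coe_add, Prod.fst_add, hB.add_left, _root_.inner_add_left]; ring
  smul_left v w z := by
    simp only [map_smul, Submodule.coe_smul, Prod.smul_fst, hB.smul_left,
      _root_.inner_smul_left]; ring
  definite v hv := by
    have h1 := h _ (FormDomain.equiv D v).2
    have h3 := congrArg Complex.re hv
    rw [re_inner_fst, Complex.zero_re] at h3
    rw [h3] at h1
    have h4 : ‖(FormDomain.equiv D v : E × F)‖ ^ 2 ≤ 0 := by nlinarith
    have h5 : ‖(FormDomain.equiv D v : E × F)‖ = 0 :=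
      pow_eq_zero_iff two_ne_zero |>.1 (le_antisymm h4 (by positivity))
    have h6 : FormDomain.equiv D v = 0 := Subtype.ext (norm_eq_zero.1 h5)
    simpa using h6

/-- H is the form domain with inner product B + c. Boundedness and coercivity make its norm
equivalent to that of E × F on the closed subspace, which gives completeness and the density of D.
The parameter b allows c to be chosen large enough for a given threshold. -/
theorem exists_hilbert [CompleteSpace E] [CompleteSpace F] (hB : IsClosedForm D B) (b : ℝ) :
    ∃ (c : ℝ) (H : Type (max u v)) (_ : NormedAddCommGroup H) (_ : InnerProductSpace ℂ H)
      (_ : CompleteSpace H) (e : H ≃ₗ[ℂ] D.topologicalClosure) (J : H →L[ℂ] E), 0 < b + c ∧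
      (∀ v w : H, (inner ℂ v w : ℂ) =
        B (e v : E × F) (e w : E × F) + c * inner ℂ (e v : E × F).1 (e w : E × F).1) ∧
      (∀ v, J v = (e v : E × F).1) ∧ Dense {v : H | (e v : E × F) ∈ D} := by
  obtain ⟨c, δ, hbc, hδ, h⟩ := hB.coercive_closure b
  obtain ⟨K, hK⟩ := hB.bound
  let cr := hB.core hδ h
  let i1 : NormedAddCommGroup (FormDomain D) := cr.toNormedAddCommGroup
  let i2 : InnerProductSpace ℂ (FormDomain D) := InnerProductSpace.ofCore cr.toCore
  let e := FormDomain.equiv D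
  have hin : ∀ v w : FormDomain D, (inner ℂ v w : ℂ) =
      B (e v : E × F) (e w : E × F) + c * inner ℂ (e v : E × F).1 (e w : E × F).1 :=
    fun v w => rfl
  have hnorm : ∀ v : FormDomain D, ‖v‖ ^ 2 = (B (e v : E × F) (e v : E × F)).re +
      c * ‖(e v : E × F).1‖ ^ 2 := fun v => by
    rw [← re_inner_fst, ← hin, inner_self_eq_norm_sq_to_K]; norm_cast
  have hlow : ∀ v : FormDomain D, ‖e v‖ ≤ (√δ)⁻¹ * ‖v‖ := fun v => by
    have h1 := h _ (e v).2
    rw [← hnorm] at h1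
    have h2 : √δ * ‖e v‖ ≤ ‖v‖ := by
      refine le_of_sq_le_sq ?_ (norm_nonneg _)
      rw [mul_pow, Real.sq_sqrt hδ.le]; exact h1
    rw [inv_mul_eq_div, le_div_iff₀ (by positivity), mul_comm]; exact h2
  have hup : ∀ v : FormDomain D, ‖v‖ ≤ √(|K| + |c|) * ‖e v‖ := fun v => by
    refine le_of_sq_le_sq ?_ (by positivity)
    rw [mul_pow, Real.sq_sqrt (by positivity), hnorm, add_mul]
    refine add_le_add ?_ ?_
    · calc (B (e v : E × F) (e v : E × F)).re ≤ ‖B (e v : E × F) (e v : E × F)‖ :=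
            Complex.re_le_norm _
        _ ≤ K * ‖(e v : E × F)‖ * ‖(e v : E × F)‖ := hK _ _
        _ ≤ |K| * ‖(e v : E × F)‖ * ‖(e v : E × F)‖ := by gcongr; exact le_abs_self K
        _ = _ := by rw [mul_assoc, ← sq]; rfl
    · calc c * ‖(e v : E × F).1‖ ^ 2 ≤ |c| * ‖(e v : E × F).1‖ ^ 2 := by
            gcongr; exact le_abs_self c
        _ ≤ |c| * ‖(e v : E × F)‖ ^ 2 := by gcongr; exact norm_fst_le _
  let e' : FormDomain D ≃L[ℂ] D.topologicalClosure := e.toContinuousLinearEquivOfBounds _ _ hlow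
    (fun v => by simpa using hup (e.symm v))
  have hcomp : CompleteSpace (FormDomain D) := by
    rw [e'.isUniformEmbedding.isUniformInducing.completeSpace_congr e'.surjective]
    exact (Submodule.isClosed_topologicalClosure D).completeSpace_coe
  refine ⟨c, FormDomain D, i1, i2, hcomp, e,
    (ContinuousLinearMap.fst ℂ E F).comp (D.topologicalClosure.subtypeL.comp
      (e' : FormDomain D →L[ℂ] D.topologicalClosure)), hbc, hin, fun v => rfl, ?_⟩
  have hd : Dense {v : D.topologicalClosure | (v : E × F) ∈ D} := by
    intro v
    rw [closure_subtype]
    have himg : Subtype.val '' {v : D.topologicalClosure | (v : E × F) ∈ D} = (D : Set (E × F)) := by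
      ext x
      simp only [Set.mem_image, Set.mem_ofPred_eq, Subtype.exists, exists_and_left, exists_prop,
        exists_eq_right_right, SetLike.mem_coe, and_iff_left_iff_imp]
      exact fun hx => D.le_topologicalClosure hx
    rw [himg]
    exact v.2
  exact hd.preimage e'.toHomeomorph.isOpenMap

/-- Adding c⟨w, ψ⟩ to both sides of the weak equation turns B into the inner product of H, so the
form operator plus c is the inverse of JJ*. -/
theorem formOperator_eq_shiftedInverse [CompleteSpace E] {H : Type*} [NormedAddCommGroup H]
    [InnerProductSpace ℂ H] [CompleteSpace H] {c : ℝ} (e : H ≃ₗ[ℂ] D.topologicalClosure)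
    (J : H →L[ℂ] E) (hin : ∀ v w : H, (inner ℂ v w : ℂ) =
      B (e v : E × F) (e w : E × F) + c * inner ℂ (e v : E × F).1 (e w : E × F).1)
    (hJ : ∀ v, J v = (e v : E × F).1) :
    formOperator (closure D) B = shiftedInverse (J ∘SL ContinuousLinearMap.adjoint J) c := by
  rw [shiftedInverse_comp_adjoint]
  ext ⟨ψ, g⟩
  simp only [formOperator, Set.mem_ofPred_eq]
  have key : ∀ w v : H, J v = ψ → ((inner ℂ w v : ℂ) = inner ℂ (J w) (g + (c : ℂ) • ψ) ↔
      B (e w : E × F) (e v : E × F) = inner ℂ (e w : E × F).1 g) := fun w v hv => by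
    rw [hin, inner_add_right, inner_smul_right, hJ, ← hv, hJ, add_left_inj]
  constructor
  · rintro ⟨v, hv, rfl, h⟩
    refine ⟨e.symm ⟨v, hv⟩, by simp [hJ], fun w => ?_⟩
    rw [key _ _ (by simp [hJ])]
    simpa using h _ (e w).2
  · rintro ⟨v, hv, h⟩
    refine ⟨e v, (e v).2, by rw [← hJ, hv], fun w hw => ?_⟩
    have := (key (e.symm ⟨w, hw⟩) v hv).1 (h _)
    simpa using this

theorem norm_sq_lt_iff {H : Type*} [NormedAddCommGroup H] [InnerProductSpace ℂ H] {a c : ℝ}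
    (e : H ≃ₗ[ℂ] D.topologicalClosure) (J : H →L[ℂ] E) (hin : ∀ v w : H, (inner ℂ v w : ℂ) =
      B (e v : E × F) (e w : E × F) + c * inner ℂ (e v : E × F).1 (e w : E × F).1)
    (hJ : ∀ v, J v = (e v : E × F).1) (v : H) : ‖v‖ ^ 2 < (a + c) * ‖J v‖ ^ 2 ↔
      (B (e v : E × F) (e v : E × F)).re < a * ‖(e v : E × F).1‖ ^ 2 := by
  have : ‖v‖ ^ 2 = (B (e v : E × F) (e v : E × F)).re + c * ‖(e v : E × F).1‖ ^ 2 := by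
    rw [← re_inner_fst, ← hin, inner_self_eq_norm_sq_to_K]; norm_cast
  rw [this, hJ, add_mul, add_lt_add_iff_right]

/-- If for all `ε > 0` there is an `n`-dimensional subspace of the form domain on which the form
is smaller than `a + ε`, then the sum of the multiplicities up to `a` is at least `n`. -/
theorem le_counting [CompleteSpace E] [CompleteSpace F] (hB : IsClosedForm D B) {a : ℝ} {n : ℕ}
    (h : ∀ ε > 0, ∃ v : Fin n → E × F, (∀ i, v i ∈ closure (D : Set (E × F))) ∧
      ∀ x : Fin n → ℂ, x ≠ 0 →
        (B (∑ i, x i • v i) (∑ i, x i • v i)).re < (a + ε) * ‖(∑ i, x i • v i).1‖ ^ 2) :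
    (n : ℕ∞) ≤ counting (formOperator (closure D) B) a := by
  obtain ⟨c, H, _, _, _, e, J, -, hin, hJ, -⟩ := hB.exists_hilbert a
  rw [formOperator_eq_shiftedInverse e J hin hJ]
  refine le_counting_of_exists J fun ε hε => ?_
  obtain ⟨v, hv, h⟩ := h ε hε
  refine ⟨fun i => e.symm ⟨v i, hv i⟩, fun x hx => ?_⟩
  rw [add_right_comm, norm_sq_lt_iff e J hin hJ]
  simpa using h x hx

/-- The min-max principle: the sum of the multiplicities up to `a` is at least `n` only if for all
`ε > 0` there is an `n`-dimensional space of elements of the core on which the form is smaller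
than `a + ε`. -/
theorem exists_of_le_counting [CompleteSpace E] [CompleteSpace F] (hB : IsClosedForm D B) {a : ℝ}
    {n : ℕ} (hn : (n : ℕ∞) ≤ counting (formOperator (closure D) B) a) {ε : ℝ} (hε : 0 < ε) :
    ∃ v : Fin n → E × F, (∀ i, v i ∈ D) ∧ ∀ x : Fin n → ℂ, x ≠ 0 →
        (B (∑ i, x i • v i) (∑ i, x i • v i)).re < (a + ε) * ‖(∑ i, x i • v i).1‖ ^ 2 := by
  obtain ⟨c, H, _, _, _, e, J, hac, hin, hJ, hd⟩ := hB.exists_hilbert a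
  rw [formOperator_eq_shiftedInverse e J hin hJ] at hn
  obtain ⟨v, hv, h⟩ := exists_mem_dense J hd (BrokenDelta.exists_of_le_counting J hac hn hε)
  refine ⟨fun i => e (v i), hv, fun x hx => ?_⟩
  have := h x hx
  rw [add_right_comm, norm_sq_lt_iff e J hin hJ] at this
  simpa using this

end IsClosedForm
end Form

open Filter Topology
open scoped Pointwise

/-! ### Dominated convergence, mollification and cutoff -/

section Dominated
variable {X : Type*} [MeasurableSpace X] {μ : Measure X}

/-- Dominated convergence in `L²`. -/
theorem exists_Lp_tendsto_of_dominated {f : ℕ → Lp ℂ 2 μ} {F : ℕ → X → ℂ} {G : X → ℂ} {b : X → ℝ}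
    (hf : ∀ n, f n =ᵐ[μ] F n) (hb : MemLp b 2 μ) (hFb : ∀ n, ∀ᵐ x ∂μ, ‖F n x‖ ≤ b x)
    (hFG : ∀ᵐ x ∂μ, Tendsto (fun n => F n x) atTop (𝓝 (G x))) :
    ∃ g : Lp ℂ 2 μ, g =ᵐ[μ] G ∧ Tendsto f atTop (𝓝 g) := by
  have hFm : ∀ n, AEStronglyMeasurable (F n) μ := fun n =>
    (Lp.aestronglyMeasurable (f n)).congr (hf n)
  have hGm : AEStronglyMeasurable G μ := aestronglyMeasurable_of_tendsto_ae atTop hFm hFG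
  have hGb : ∀ᵐ x ∂μ, ‖G x‖ ≤ b x := by
    filter_upwards [ae_all_iff.2 hFb, hFG] with x h1 h2
    exact le_of_tendsto h2.norm (Eventually.of_forall h1)
  have hG : MemLp G 2 μ := hb.mono' hGm hGb
  refine ⟨hG.toLp G, hG.coeFn_toLp, ?_⟩
  rw [Lp.tendsto_Lp_iff_tendsto_eLpNorm']
  have hlim : Tendsto (fun n => ∫⁻ x, ‖F n x - G x‖ₑ ^ 2 ∂μ) atTop (𝓝 0) := by
    have h0 : (∫⁻ _ : X, 0 ∂μ) = 0 := by simp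
    rw [← h0]
    refine tendsto_lintegral_of_dominated_convergence' (fun x => (2 * ‖b x‖ₑ) ^ 2)
      (fun n => ((hFm n).sub hGm).enorm.pow_const _) (fun n => ?_) ?_ ?_
    · filter_upwards [hFb n, hGb] with x h1 h2
      gcongr
      calc ‖F n x - G x‖ₑ ≤ ‖F n x‖ₑ + ‖G x‖ₑ := enorm_sub_le
        _ ≤ ‖b x‖ₑ + ‖b x‖ₑ := by
          gcongr
          · exact enorm_le_iff_norm_le.2 (h1.trans (Real.le_norm_self _))
          · exact enorm_le_iff_norm_le.2 (h2.trans (Real.le_norm_self _))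
        _ = 2 * ‖b x‖ₑ := (two_mul _).symm
    · simp_rw [mul_pow]
      rw [lintegral_const_mul' _ _ (by simp)]
      refine ENNReal.mul_ne_top (by simp) ?_
      have := hb.eLpNorm_lt_top
      rw [eLpNorm_lt_top_iff_lintegral_rpow_enorm_lt_top (by simp) (by simp)] at this
      simpa using this.ne
    · filter_upwards [hFG] with x hx
      have : Tendsto (fun n => ‖F n x - G x‖ₑ ^ 2) atTop (𝓝 (‖G x - G x‖ₑ ^ 2)) :=
        (ENNReal.continuous_pow 2).continuousAt.tendsto.comp
          ((continuous_enorm.tendsto _).comp (hx.sub_const _))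
      simpa using this
  have heq : ∀ n, eLpNorm (⇑(f n) - ⇑(hG.toLp G)) 2 μ =
      (∫⁻ x, ‖F n x - G x‖ₑ ^ 2 ∂μ) ^ (1 / 2 : ℝ) := fun n => by
    rw [eLpNorm_congr_ae ((hf n).sub hG.coeFn_toLp),
      eLpNorm_eq_lintegral_rpow_enorm_toReal (by simp) (by simp)]
    simp
  simp_rw [heq]
  simpa using hlim.ennrpow_const (1 / 2 : ℝ)

end Dominated

section Mollify
variable {X : Type*} [NormedAddCommGroup X] [NormedSpace ℝ X] [FiniteDimensional ℝ X]
  [MeasurableSpace X] [BorelSpace X] {μ : Measure X} [μ.IsAddHaarMeasure]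

open scoped Convolution

/-- The bump functions used for mollification. -/
noncomputable def mollifier (X : Type*) [NormedAddCommGroup X] (n : ℕ) : ContDiffBump (0 : X) where
  rIn := 1 / (n + 1)
  rOut := 2 / (n + 1)
  rIn_pos := by positivity
  rIn_lt_rOut := by gcongr; norm_num

omit [NormedSpace ℝ X] [FiniteDimensional ℝ X] [MeasurableSpace X] [BorelSpace X] in
theorem mollifier_rOut_tendsto : Tendsto (fun n => (mollifier X n).rOut) atTop (𝓝 0) := by
  have := (tendsto_one_div_add_atTop_nhds_zero_nat (𝕜 := ℝ)).const_mul 2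
  simpa [mollifier, div_eq_mul_inv] using this

omit [NormedSpace ℝ X] [FiniteDimensional ℝ X] [MeasurableSpace X] [BorelSpace X] in
theorem mollifier_rOut_le (n : ℕ) : (mollifier X n).rOut ≤ 2 := by
  simp only [mollifier]
  rw [div_le_iff₀ (by positivity)]
  have : (0 : ℝ) ≤ n := n.cast_nonneg
  linarith

/-- The mollification of `ψ`. -/
noncomputable def mollify (μ : Measure X) (ψ : X → ℂ) (n : ℕ) : X → ℂ :=
  ((mollifier X n).normed μ ⋆[ContinuousLinearMap.lsmul ℝ ℝ, μ] ψ)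

variable {ψ : X → ℂ}

theorem mollify_isTest (hψ : Continuous ψ) (hc : HasCompactSupport ψ) (n : ℕ) :
    IsTest (mollify μ ψ n) :=
  ⟨HasCompactSupport.contDiff_convolution_left _ (mollifier X n).hasCompactSupport_normed
    (mollifier X n).contDiff_normed hψ.locallyIntegrable,
   (mollifier X n).hasCompactSupport_normed.convolution _ hc⟩

theorem mollify_eq_zero {n : ℕ} {z : X}
    (hz : z ∉ Metric.closedBall (0 : X) 2 + tsupport ψ) : mollify μ ψ n z = 0 := by
  by_contra h
  refine hz ?_
  have := support_convolution_subset (L := ContinuousLinearMap.lsmul ℝ ℝ) (μ := μ)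
    (f := (mollifier X n).normed μ) (g := ψ) h
  refine Set.add_subset_add ?_ subset_closure this
  rw [ContDiffBump.support_normed_eq]
  exact Metric.ball_subset_closedBall.trans (Metric.closedBall_subset_closedBall (mollifier_rOut_le n))

theorem tendsto_mollify (hψ : Continuous ψ) (z : X) :
    Tendsto (fun n => mollify μ ψ n z) atTop (𝓝 (ψ z)) :=
  ContDiffBump.convolution_tendsto_right_of_continuous mollifier_rOut_tendsto hψ z

theorem integrable_mollifier_smul {Y : Type*} [NormedAddCommGroup Y] [NormedSpace ℝ Y] {g : X → Y}
    {C : ℝ} (n : ℕ) (hg : AEStronglyMeasurable g μ) (hC : ∀ z, ‖g z‖ ≤ C) (z : X) :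
    Integrable (fun w => (mollifier X n).normed μ w • g (z - w)) μ := by
  have h1 : Integrable ((mollifier X n).normed μ) μ := (mollifier X n).integrable_normed
  refine Integrable.mono' (h1.norm.mul_const C) (h1.aestronglyMeasurable.smul ?_) ?_
  · exact hg.comp_quasiMeasurePreserving (quasiMeasurePreserving_sub_left_of_right_invariant μ z)
  · refine Eventually.of_forall fun w => ?_
    rw [norm_smul]
    exact mul_le_mul_of_nonneg_left (hC _) (norm_nonneg _)

theorem norm_integral_mollifier_smul_le {Y : Type*} [NormedAddCommGroup Y] [NormedSpace ℝ Y]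
    {g : X → Y} {C : ℝ} (n : ℕ) (hC : ∀ z, ‖g z‖ ≤ C) :
    ‖∫ w, (mollifier X n).normed μ w • g w ∂μ‖ ≤ C := by
  have h1 : Integrable ((mollifier X n).normed μ) μ := (mollifier X n).integrable_normed
  calc ‖∫ w, (mollifier X n).normed μ w • g w ∂μ‖ ≤ ∫ w, (mollifier X n).normed μ w * C ∂μ := by
        refine norm_integral_le_of_norm_le (h1.mul_const C) (Eventually.of_forall fun w => ?_)
        rw [norm_smul, Real.norm_of_nonneg ((mollifier X n).nonneg_normed w)]
        exact mul_le_mul_of_nonneg_left (hC _) ((mollifier X n).nonneg_normed w)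
    _ = C := by rw [integral_mul_const, (mollifier X n).integral_normed, one_mul]

theorem norm_mollify_le {C : ℝ} (hC : ∀ z, ‖ψ z‖ ≤ C) (n : ℕ) (z : X) : ‖mollify μ ψ n z‖ ≤ C :=
  norm_integral_mollifier_smul_le (g := fun w => ψ (z - w)) n fun _ => hC _

/-- The derivative is put on ψ, where it exists almost everywhere by Rademacher's theorem. The
result is a mollification of `fderiv ℝ ψ`, to which Lebesgue differentiation applies. -/
theorem fderiv_mollify {K : NNReal} (hψ : LipschitzWith K ψ) {C : ℝ} (hC : ∀ z, ‖ψ z‖ ≤ C)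
    (n : ℕ) (z : X) : fderiv ℝ (mollify μ ψ n) z =
      ((mollifier X n).normed μ ⋆[ContinuousLinearMap.lsmul ℝ ℝ, μ] fderiv ℝ ψ) z := by
  have h1 : Integrable ((mollifier X n).normed μ) μ := (mollifier X n).integrable_normed
  have hm : ∀ z, AEStronglyMeasurable (fun w => (mollifier X n).normed μ w • ψ (z - w)) μ :=
    fun z => (integrable_mollifier_smul n hψ.continuous.aestronglyMeasurable hC z).1
  have := hasFDerivAt_integral_of_dominated_loc_of_lip (𝕜 := ℝ) (μ := μ) (x₀ := z) (s := Set.univ)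
    (F := fun z w => (mollifier X n).normed μ w • ψ (z - w))
    (F' := fun w => (mollifier X n).normed μ w • fderiv ℝ ψ (z - w))
    (bound := fun w => (mollifier X n).normed μ w * K) univ_mem (Eventually.of_forall hm)
    (integrable_mollifier_smul n hψ.continuous.aestronglyMeasurable hC z) ?_ ?_ (h1.mul_const _) ?_
  · exact this.2.fderiv
  · exact (integrable_mollifier_smul n (measurable_fderiv ℝ ψ).aestronglyMeasurable
      (fun z => norm_fderiv_le_of_lipschitz ℝ hψ) z).1
  · refine Eventually.of_forall fun w => LipschitzOnWith.of_dist_le_mul fun a _ b _ => ?_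
    rw [dist_eq_norm, ← smul_sub, norm_smul, ← dist_eq_norm]
    have h2 := hψ.dist_le_mul (a - w) (b - w)
    rw [dist_sub_right] at h2
    have h3 : (mollifier X n).normed μ w * K ≥ 0 :=
      mul_nonneg ((mollifier X n).nonneg_normed w) K.2
    rw [Real.coe_nnabs, abs_of_nonneg h3, Real.norm_of_nonneg ((mollifier X n).nonneg_normed w),
      mul_assoc]
    exact mul_le_mul_of_nonneg_left h2 ((mollifier X n).nonneg_normed w)
  · have h2 : ∀ᵐ w ∂μ, DifferentiableAt ℝ ψ (z - w) :=
      (quasiMeasurePreserving_sub_left_of_right_invariant μ z).ae hψ.ae_differentiableAt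
    filter_upwards [h2] with w hw
    have h3 : HasFDerivAt (fun z => ψ (z - w)) (fderiv ℝ ψ (z - w)) z :=
      by simpa [Function.comp_def] using HasFDerivAt.comp z hw.hasFDerivAt ((hasFDerivAt_id z).sub_const w)
    exact h3.const_smul ((mollifier X n).normed μ w)

theorem norm_fderiv_mollify_le {K : NNReal} (hψ : LipschitzWith K ψ) {C : ℝ} (hC : ∀ z, ‖ψ z‖ ≤ C)
    (n : ℕ) (z : X) : ‖fderiv ℝ (mollify μ ψ n) z‖ ≤ K := by
  rw [fderiv_mollify hψ hC]
  exact norm_integral_mollifier_smul_le (g := fun w => fderiv ℝ ψ (z - w)) n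
    fun _ => norm_fderiv_le_of_lipschitz ℝ hψ

theorem tendsto_fderiv_mollify {K : NNReal} (hψ : LipschitzWith K ψ) {C : ℝ}
    (hC : ∀ z, ‖ψ z‖ ≤ C) : ∀ᵐ z ∂μ,
      Tendsto (fun n => fderiv ℝ (mollify μ ψ n) z) atTop (𝓝 (fderiv ℝ ψ z)) := by
  simp_rw [fderiv_mollify hψ hC]
  -- The ratio of outer to inner radius is constantly 2; convergence at Lebesgue points needs it
  -- bounded.
  refine ContDiffBump.ae_convolution_tendsto_right_of_locallyIntegrable (K := 2)
    mollifier_rOut_tendsto (Eventually.of_forall fun n => ?_) ?_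
  · simp only [mollifier]; rw [mul_one_div]
  · have : Measurable (fderiv ℝ ψ) := measurable_fderiv ℝ ψ
    refine (locallyIntegrable_const (K : ℝ)).mono this.aestronglyMeasurable
      (Eventually.of_forall fun z => ?_)
    exact (norm_fderiv_le_of_lipschitz ℝ hψ).trans (Real.le_norm_self _)

end Mollify

section Cutoff
variable {X : Type*} [NormedAddCommGroup X] [NormedSpace ℝ X]

/-- A Lipschitz cutoff function, equal to `1` on the ball of radius `n + 1`. -/
noncomputable def cutoff (n : ℕ) (z : X) : ℝ := max 0 (min 1 (n + 2 - ‖z‖))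

omit [NormedSpace ℝ X] in
theorem cutoff_lipschitz (n : ℕ) : LipschitzWith 1 (cutoff n : X → ℝ) := by
  have h : LipschitzWith 1 fun z : X => (n : ℝ) + 2 - ‖z‖ := by
    refine LipschitzWith.of_dist_le_mul fun a b => ?_
    rw [Real.dist_eq, NNReal.coe_one, one_mul, dist_eq_norm]
    have := abs_norm_sub_norm_le a b
    rwa [show (n : ℝ) + 2 - ‖a‖ - (n + 2 - ‖b‖) = -(‖a‖ - ‖b‖) by ring, abs_neg]
  exact (h.const_min 1).const_max 0

omit [NormedSpace ℝ X] in
theorem cutoff_mem (n : ℕ) (z : X) : |cutoff n z| ≤ 1 := by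
  rw [abs_of_nonneg (le_max_left _ _)]
  exact max_le (by norm_num) (min_le_left _ _)

omit [NormedSpace ℝ X] in
theorem cutoff_eq_one {n : ℕ} {z : X} (hz : ‖z‖ ≤ n + 1) : cutoff n z = 1 := by
  simp [cutoff, min_eq_left (show (1 : ℝ) ≤ n + 2 - ‖z‖ by linarith)]

omit [NormedSpace ℝ X] in
theorem cutoff_eq_zero {n : ℕ} {z : X} (hz : (n : ℝ) + 2 ≤ ‖z‖) : cutoff n z = 0 := by
  rw [cutoff, max_eq_left]
  exact (min_le_right _ _).trans (by linarith)

variable {ψ : X → ℂ}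

omit [NormedSpace ℝ X] in
theorem cutoff_mul_lipschitz {K C : NNReal} (hψ : LipschitzWith K ψ) (hC : ∀ z, ‖ψ z‖ ≤ C) (n : ℕ) :
    LipschitzWith (K + C) fun z => (cutoff n z : ℂ) * ψ z := by
  refine LipschitzWith.of_dist_le_mul fun a b => ?_
  have h1 := hψ.dist_le_mul a b
  have h2 := (cutoff_lipschitz (X := X) n).dist_le_mul a b
  rw [dist_eq_norm] at h1
  rw [Real.dist_eq, NNReal.coe_one, one_mul] at h2
  rw [dist_eq_norm, show (cutoff n a : ℂ) * ψ a - cutoff n b * ψ b =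
    (cutoff n a : ℂ) * (ψ a - ψ b) + ((cutoff n a - cutoff n b : ℝ) : ℂ) * ψ b by push_cast; ring]
  refine (norm_add_le _ _).trans ?_
  rw [norm_mul, norm_mul, Complex.norm_real, Complex.norm_real, Real.norm_eq_abs, Real.norm_eq_abs]
  push_cast
  rw [add_mul]
  refine add_le_add ?_ ?_
  · exact (mul_le_of_le_one_left (norm_nonneg _) (cutoff_mem n a)).trans h1
  · rw [mul_comm]
    exact mul_le_mul (hC b) h2 (abs_nonneg _) C.2

omit [NormedSpace ℝ X] in
theorem cutoff_mul_hasCompactSupport [ProperSpace X] (n : ℕ) :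
    HasCompactSupport fun z => (cutoff n z : ℂ) * ψ z := by
  refine HasCompactSupport.intro (isCompact_closedBall (0 : X) (n + 2)) fun z hz => ?_
  have : (n : ℝ) + 2 ≤ ‖z‖ := by
    simp only [Metric.mem_closedBall, dist_zero_right, not_le] at hz; exact hz.le
  simp [cutoff_eq_zero this]

omit [NormedSpace ℝ X] in
theorem cutoff_mul_eventuallyEq {n : ℕ} {z : X} (hz : ‖z‖ < n + 1) :
    (fun z => (cutoff n z : ℂ) * ψ z) =ᶠ[𝓝 z] ψ := by
  have : ∀ᶠ w in 𝓝 z, ‖w‖ < n + 1 := continuous_norm.continuousAt.eventually (gt_mem_nhds hz)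
  filter_upwards [this] with w hw
  simp [cutoff_eq_one hw.le]

omit [NormedSpace ℝ X] in
theorem eventually_cutoff_mul_eventuallyEq (z : X) :
    ∀ᶠ n : ℕ in atTop, (fun z => (cutoff n z : ℂ) * ψ z) =ᶠ[𝓝 z] ψ := by
  obtain ⟨N, hN⟩ := exists_nat_gt ‖z‖
  filter_upwards [eventually_ge_atTop N] with n hn
  refine cutoff_mul_eventuallyEq (hN.trans_le ?_)
  have : (N : ℝ) ≤ n := by exact_mod_cast hn
  linarith

omit [NormedSpace ℝ X] in
theorem norm_cutoff_mul_le (n : ℕ) (z : X) : ‖(cutoff n z : ℂ) * ψ z‖ ≤ ‖ψ z‖ := by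
  rw [norm_mul, Complex.norm_real, Real.norm_eq_abs]
  exact mul_le_of_le_one_left (norm_nonneg _) (cutoff_mem n z)

theorem norm_fderiv_cutoff_mul_le [FiniteDimensional ℝ X] [MeasurableSpace X] [BorelSpace X]
    {μ : Measure X} [μ.IsAddHaarMeasure] {K : NNReal} (hψ : LipschitzWith K ψ) (n : ℕ) (v : X) :
    ∀ᵐ z ∂μ, ‖fderiv ℝ (fun z => (cutoff n z : ℂ) * ψ z) z v‖ ≤
      ‖fderiv ℝ ψ z v‖ + ‖ψ z‖ * ‖v‖ := by
  filter_upwards [hψ.ae_differentiableAt (μ := μ),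
    (cutoff_lipschitz (X := X) n).ae_differentiableAt (μ := μ)] with z h1 h2
  have h3 : HasFDerivAt (fun z => (cutoff n z : ℂ)) (Complex.ofRealCLM.comp (fderiv ℝ (cutoff n) z)) z :=
    Complex.ofRealCLM.hasFDerivAt.comp z h2.hasFDerivAt
  rw [(h3.fun_mul h1.hasFDerivAt).fderiv]
  simp only [add_apply, smul_apply, smul_eq_mul, ContinuousLinearMap.comp_apply,
    Complex.ofRealCLM_apply]
  refine (norm_add_le _ _).trans (add_le_add ?_ ?_)
  · rw [norm_mul, Complex.norm_real, Real.norm_eq_abs]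
    exact mul_le_of_le_one_left (norm_nonneg _) (cutoff_mem n z)
  · rw [norm_mul, Complex.norm_real]
    gcongr
    calc ‖fderiv ℝ (cutoff n) z v‖ ≤ ‖fderiv ℝ (cutoff n) z‖ * ‖v‖ :=
          ContinuousLinearMap.le_opNorm _ _
      _ ≤ 1 * ‖v‖ := by
        gcongr
        exact norm_fderiv_le_of_lipschitz ℝ (cutoff_lipschitz n)
      _ = ‖v‖ := one_mul _

end Cutoff

section Mollify
variable {X : Type*} [NormedAddCommGroup X] [NormedSpace ℝ X] [FiniteDimensional ℝ X]
  [MeasurableSpace X] [BorelSpace X] {μ : Measure X} [μ.IsAddHaarMeasure] {ψ : X → ℂ}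

/-- A compact set containing the supports of all mollifications. -/
def mollifySupport (ψ : X → ℂ) : Set X := Metric.closedBall (0 : X) 2 + tsupport ψ

omit [NormedSpace ℝ X] [MeasurableSpace X] [BorelSpace X] in
theorem isCompact_mollifySupport [ProperSpace X] (hc : HasCompactSupport ψ) :
    IsCompact (mollifySupport ψ) := (isCompact_closedBall _ _).add hc

omit [NormedSpace ℝ X] in
theorem memLp_indicator_mollifySupport [ProperSpace X]
    (hc : HasCompactSupport ψ) (C : ℝ) :
    MemLp ((mollifySupport ψ).indicator fun _ => C) 2 μ :=
  memLp_indicator_const 2 (isCompact_mollifySupport hc).measurableSet C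
    (Or.inr (isCompact_mollifySupport hc).measure_lt_top.ne)

theorem norm_mollify_le_indicator {C : ℝ} (hC : ∀ z, ‖ψ z‖ ≤ C) (n : ℕ) (z : X) :
    ‖mollify μ ψ n z‖ ≤ (mollifySupport ψ).indicator (fun _ => C) z := by
  by_cases hz : z ∈ mollifySupport ψ
  · rw [Set.indicator_of_mem hz]; exact norm_mollify_le hC n z
  · rw [Set.indicator_of_notMem hz, mollify_eq_zero hz, norm_zero]

theorem norm_fderiv_mollify_le_indicator {K : NNReal} (hψ : LipschitzWith K ψ) {C : ℝ}
    (hC : ∀ z, ‖ψ z‖ ≤ C) (hc : HasCompactSupport ψ) (n : ℕ) (z v : X) :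
    ‖fderiv ℝ (mollify μ ψ n) z v‖ ≤ (mollifySupport ψ).indicator (fun _ => K * ‖v‖) z := by
  have : ProperSpace X := FiniteDimensional.proper ℝ X
  by_cases hz : z ∈ mollifySupport ψ
  · rw [Set.indicator_of_mem hz]
    refine (ContinuousLinearMap.le_opNorm _ _).trans ?_
    gcongr
    exact norm_fderiv_mollify_le hψ hC n z
  · rw [Set.indicator_of_notMem hz]
    have h1 : mollify μ ψ n =ᶠ[𝓝 z] fun _ => 0 := by
      filter_upwards [(isCompact_mollifySupport hc).isClosed.isOpen_compl.mem_nhds hz] with w hw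
      exact mollify_eq_zero hw
    rw [h1.fderiv_eq]; simp

end Mollify

theorem IsTest.memLp {X : Type*} [NormedAddCommGroup X] [NormedSpace ℝ X] [MeasurableSpace X]
    [BorelSpace X] [FiniteDimensional ℝ X] {μ : Measure X} [IsFiniteMeasureOnCompacts μ] {φ : X → ℂ}
    (hφ : IsTest φ) : MemLp φ 2 μ := by
  have : ProperSpace X := FiniteDimensional.proper ℝ X
  exact hφ.1.continuous.memLp_of_hasCompactSupport hφ.2

/-! ### Lipschitz functions as elements of the Sobolev spaces, with point values and traces -/

section OneD

/-- `ψ` is (a representative of) an element of `H¹(ℝ)`, with derivative `deriv ψ`. -/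
def IsH1 (ψ : ℝ → ℂ) : Prop := ∃ p ∈ H1R, p.1 =ᵐ[volume] ψ ∧ p.2 =ᵐ[volume] deriv ψ

/-- `ψ` is the continuous representative of an element of `H¹(ℝ)`, evaluated at `±x`. -/
def IsH1Values (x : ℝ) (ψ : ℝ → ℂ) : Prop :=
  ∃ p ∈ H1RWithValues x, p.1 =ᵐ[volume] ψ ∧ p.2.1 =ᵐ[volume] deriv ψ ∧ p.2.2.1 = ψ (-x) ∧
    p.2.2.2 = ψ x

theorem IsTest.deriv {φ : ℝ → ℂ} (hφ : IsTest φ) : IsTest (deriv φ) :=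
  ⟨((contDiff_infty_iff_deriv (𝕜 := ℝ)).1 hφ.1).2, hφ.2.deriv⟩

theorem IsTest.isH1Values {φ : ℝ → ℂ} (hφ : IsTest φ) (x : ℝ) : IsH1Values x φ := by
  have h1 := hφ.memLp (μ := volume)
  have h2 := hφ.deriv.memLp (μ := volume)
  exact ⟨(h1.toLp φ, h2.toLp _, φ (-x), φ x),
    subset_closure ⟨φ, hφ, h1.coeFn_toLp, h2.coeFn_toLp, rfl, rfl⟩, h1.coeFn_toLp, h2.coeFn_toLp,
    rfl, rfl⟩

theorem IsH1Values.isH1 {x : ℝ} {ψ : ℝ → ℂ} (h : IsH1Values x ψ) : IsH1 ψ := by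
  obtain ⟨p, hp, h1, h2, -, -⟩ := h
  refine ⟨(p.1, p.2.1), ?_, h1, h2⟩
  have hc : Continuous fun p : L2R × (L2R × ℂ × ℂ) => (p.1, p.2.1) := by fun_prop
  refine map_mem_closure (f := fun p : L2R × (L2R × ℂ × ℂ) => (p.1, p.2.1)) hc hp ?_
  rintro q ⟨φ, hφ, h1, h2, -, -⟩
  exact ⟨φ, hφ, h1, h2⟩

/-- The functions must converge at every point, not just almost everywhere, because the values at ±x
belong to the data of the closure. -/
theorem IsH1Values.of_dominated {x : ℝ} {φ : ℕ → ℝ → ℂ} {ψ : ℝ → ℂ} {b b' : ℝ → ℝ}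
    (hφ : ∀ n, IsH1Values x (φ n)) (hb : MemLp b 2) (hb' : MemLp b' 2)
    (h1 : ∀ n z, ‖φ n z‖ ≤ b z) (h2 : ∀ n, ∀ᵐ z, ‖deriv (φ n) z‖ ≤ b' z)
    (h3 : ∀ z, Tendsto (fun n => φ n z) atTop (𝓝 (ψ z)))
    (h4 : ∀ᵐ z, Tendsto (fun n => deriv (φ n) z) atTop (𝓝 (deriv ψ z))) : IsH1Values x ψ := by
  choose p hp e1 e2 e3 e4 using hφ
  obtain ⟨g1, hg1, t1⟩ := exists_Lp_tendsto_of_dominated e1 hb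
    (fun n => Eventually.of_forall (h1 n)) (Eventually.of_forall h3)
  obtain ⟨g2, hg2, t2⟩ := exists_Lp_tendsto_of_dominated e2 hb' h2 h4
  refine ⟨(g1, g2, ψ (-x), ψ x), isClosed_closure.mem_of_tendsto
    (t1.prodMk_nhds (t2.prodMk_nhds (Tendsto.prodMk_nhds ?_ ?_)))
    (Eventually.of_forall hp), hg1, hg2, rfl, rfl⟩
  · simp_rw [e3]; exact h3 _
  · simp_rw [e4]; exact h3 _

theorem IsH1Values.of_lipschitz_of_hasCompactSupport {ψ : ℝ → ℂ} {K : NNReal}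
    (hψ : LipschitzWith K ψ) (hc : HasCompactSupport ψ) (x : ℝ) : IsH1Values x ψ := by
  obtain ⟨C, hC⟩ := hψ.continuous.bounded_above_of_compact_support hc
  refine IsH1Values.of_dominated (φ := mollify volume ψ)
    (fun n => (mollify_isTest hψ.continuous hc n).isH1Values x)
    (memLp_indicator_mollifySupport hc C) (memLp_indicator_mollifySupport hc (K * ‖(1 : ℝ)‖))
    (norm_mollify_le_indicator hC) (fun n => Eventually.of_forall fun z => ?_)
    (tendsto_mollify hψ.continuous) ?_
  · rw [← fderiv_apply_one_eq_deriv]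
    exact norm_fderiv_mollify_le_indicator hψ hC hc n z 1
  · filter_upwards [tendsto_fderiv_mollify (μ := volume) hψ hC] with z hz
    simp_rw [← fderiv_apply_one_eq_deriv]
    exact ((ContinuousLinearMap.apply ℝ ℂ (1 : ℝ)).continuous.tendsto _).comp hz

theorem IsH1Values.of_lipschitz {ψ : ℝ → ℂ} {K C : NNReal} (hψ : LipschitzWith K ψ)
    (hC : ∀ z, ‖ψ z‖ ≤ C) (h1 : MemLp ψ 2) (h2 : MemLp (deriv ψ) 2) (x : ℝ) : IsH1Values x ψ := by
  refine IsH1Values.of_dominated (φ := fun n z => (cutoff n z : ℂ) * ψ z)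
    (fun n => .of_lipschitz_of_hasCompactSupport (cutoff_mul_lipschitz hψ hC n)
      (cutoff_mul_hasCompactSupport n) x) h1.norm (h2.norm.add (h1.norm.mul_const ‖(1 : ℝ)‖))
    norm_cutoff_mul_le (fun n => ?_) (fun z => ?_) (Eventually.of_forall fun z => ?_)
  · filter_upwards [norm_fderiv_cutoff_mul_le (μ := volume) hψ n 1] with z hz
    simpa [fderiv_apply_one_eq_deriv] using hz
  · exact tendsto_const_nhds.congr' ((eventually_cutoff_mul_eventuallyEq z).mono
      fun n hn => hn.eq_of_nhds.symm)
  · exact tendsto_const_nhds.congr' ((eventually_cutoff_mul_eventuallyEq z).mono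
      fun n hn => hn.deriv_eq.symm)

end OneD

section TwoD

/-- `ψ` is the continuous representative of an element of `H¹(ℝ²)`. -/
def IsH1Trace (ψ : ℝ × ℝ → ℂ) : Prop :=
  ∃ p ∈ H1R2WithTrace, p.1 =ᵐ[volume] ψ ∧ p.2.1 =ᵐ[volume] (fun z => fderiv ℝ ψ z (1, 0)) ∧
    p.2.2.1 =ᵐ[volume] (fun z => fderiv ℝ ψ z (0, 1)) ∧
    p.2.2.2 =ᵐ[volume] fun s : ℝ => ψ (|s|, s)

instance : (volume : Measure (ℝ × ℝ)).IsAddHaarMeasure :=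
  inferInstanceAs ((volume : Measure ℝ).prod volume).IsAddHaarMeasure

theorem IsTest.fderiv_apply {φ : ℝ × ℝ → ℂ} (hφ : IsTest φ) (v : ℝ × ℝ) :
    IsTest fun z => fderiv ℝ φ z v :=
  ⟨(hφ.1.fderiv_right (m := (⊤ : ℕ∞)) (by simp)).clm_apply contDiff_const, hφ.2.fderiv_apply ℝ v⟩

/-- Closedness gives traces of compactly supported functions compact support. -/
theorem isClosedEmbedding_brokenLine : IsClosedEmbedding fun s : ℝ => (|s|, s) := by
  have hc : Continuous fun s : ℝ => (|s|, s) := by fun_prop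
  refine IsClosedEmbedding.of_continuous_injective_isClosedMap hc (fun a b h => (Prod.ext_iff.1 h).2) ?_
  intro S hS
  have : (fun s : ℝ => (|s|, s)) '' S = {z : ℝ × ℝ | z.1 = |z.2|} ∩ Prod.snd ⁻¹' S := by
    ext ⟨a, b⟩
    simp only [Set.mem_image, Prod.mk.injEq, Set.mem_inter_iff, Set.mem_ofPred_eq, Set.mem_preimage]
    constructor
    · rintro ⟨s, hs, rfl, rfl⟩; exact ⟨rfl, hs⟩
    · rintro ⟨rfl, hb⟩; exact ⟨b, hb, rfl, rfl⟩
  rw [this]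
  exact (isClosed_eq (by fun_prop) (by fun_prop)).inter (hS.preimage continuous_snd)

theorem memLp_trace {ψ : ℝ × ℝ → ℂ} (hψ : Continuous ψ) (hc : HasCompactSupport ψ) :
    MemLp (fun s : ℝ => ψ (|s|, s)) 2 :=
  (hψ.comp isClosedEmbedding_brokenLine.continuous).memLp_of_hasCompactSupport
    (hc.comp_isClosedEmbedding isClosedEmbedding_brokenLine)

theorem IsTest.isH1Trace {φ : ℝ × ℝ → ℂ} (hφ : IsTest φ) : IsH1Trace φ := by
  have h1 := hφ.memLp (μ := volume)
  have h2 := (hφ.fderiv_apply (1, 0)).memLp (μ := volume)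
  have h3 := (hφ.fderiv_apply (0, 1)).memLp (μ := volume)
  have h4 := memLp_trace hφ.1.continuous hφ.2
  exact ⟨(h1.toLp φ, h2.toLp _, h3.toLp _, h4.toLp _),
    subset_closure ⟨φ, hφ, h1.coeFn_toLp, h2.coeFn_toLp, h3.coeFn_toLp, h4.coeFn_toLp⟩,
    h1.coeFn_toLp, h2.coeFn_toLp, h3.coeFn_toLp, h4.coeFn_toLp⟩

/-- The broken line is a null set of the plane, so convergence and domination of the functions are
required everywhere, while for the derivatives almost everywhere is enough. -/
theorem IsH1Trace.of_dominated {φ : ℕ → ℝ × ℝ → ℂ} {ψ : ℝ × ℝ → ℂ} {b b₁ b₂ : ℝ × ℝ → ℝ}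
    (hφ : ∀ n, IsH1Trace (φ n)) (hb : MemLp b 2) (hb₁ : MemLp b₁ 2) (hb₂ : MemLp b₂ 2)
    (hbt : MemLp (fun s : ℝ => b (|s|, s)) 2) (h1 : ∀ n z, ‖φ n z‖ ≤ b z)
    (h2 : ∀ n, ∀ᵐ z, ‖fderiv ℝ (φ n) z (1, 0)‖ ≤ b₁ z)
    (h3 : ∀ n, ∀ᵐ z, ‖fderiv ℝ (φ n) z (0, 1)‖ ≤ b₂ z)
    (h4 : ∀ z, Tendsto (fun n => φ n z) atTop (𝓝 (ψ z)))
    (h5 : ∀ᵐ z, Tendsto (fun n => fderiv ℝ (φ n) z) atTop (𝓝 (fderiv ℝ ψ z))) : IsH1Trace ψ := by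
  choose p hp e1 e2 e3 e4 using hφ
  have h6 : ∀ v : ℝ × ℝ, ∀ᵐ z, Tendsto (fun n => fderiv ℝ (φ n) z v) atTop (𝓝 (fderiv ℝ ψ z v)) :=
    fun v => by
      filter_upwards [h5] with z hz
      exact ((ContinuousLinearMap.apply ℝ ℂ v).continuous.tendsto _).comp hz
  obtain ⟨g1, hg1, t1⟩ := exists_Lp_tendsto_of_dominated e1 hb
    (fun n => Eventually.of_forall (h1 n)) (Eventually.of_forall h4)
  obtain ⟨g2, hg2, t2⟩ := exists_Lp_tendsto_of_dominated e2 hb₁ h2 (h6 _)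
  obtain ⟨g3, hg3, t3⟩ := exists_Lp_tendsto_of_dominated e3 hb₂ h3 (h6 _)
  obtain ⟨g4, hg4, t4⟩ := exists_Lp_tendsto_of_dominated (G := fun s : ℝ => ψ (|s|, s)) e4 hbt
    (fun n => Eventually.of_forall fun s => h1 n _) (Eventually.of_forall fun s => h4 _)
  exact ⟨(g1, g2, g3, g4), isClosed_closure.mem_of_tendsto
    (t1.prodMk_nhds (t2.prodMk_nhds (t3.prodMk_nhds t4))) (Eventually.of_forall hp),
    hg1, hg2, hg3, hg4⟩

theorem IsH1Trace.of_lipschitz_of_hasCompactSupport {ψ : ℝ × ℝ → ℂ} {K : NNReal}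
    (hψ : LipschitzWith K ψ) (hc : HasCompactSupport ψ) : IsH1Trace ψ := by
  obtain ⟨C, hC⟩ := hψ.continuous.bounded_above_of_compact_support hc
  refine IsH1Trace.of_dominated (φ := mollify volume ψ)
    (fun n => (mollify_isTest hψ.continuous hc n).isH1Trace)
    (memLp_indicator_mollifySupport hc C)
    (memLp_indicator_mollifySupport hc (K * ‖((1, 0) : ℝ × ℝ)‖))
    (memLp_indicator_mollifySupport hc (K * ‖((0, 1) : ℝ × ℝ)‖)) ?_
    (norm_mollify_le_indicator hC)
    (fun n => Eventually.of_forall fun z => norm_fderiv_mollify_le_indicator hψ hC hc n z _)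
    (fun n => Eventually.of_forall fun z => norm_fderiv_mollify_le_indicator hψ hC hc n z _)
    (tendsto_mollify hψ.continuous) (tendsto_fderiv_mollify hψ hC)
  have hcomp := isClosedEmbedding_brokenLine.isCompact_preimage (isCompact_mollifySupport hc)
  exact memLp_indicator_const (s := (fun s : ℝ => (|s|, s)) ⁻¹' mollifySupport ψ) 2
    hcomp.measurableSet C (Or.inr hcomp.measure_lt_top.ne)

theorem IsH1Trace.of_lipschitz {ψ : ℝ × ℝ → ℂ} {K C : NNReal} (hψ : LipschitzWith K ψ)
    (hC : ∀ z, ‖ψ z‖ ≤ C) (h1 : MemLp ψ 2) (h2 : MemLp (fun z => fderiv ℝ ψ z (1, 0)) 2)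
    (h3 : MemLp (fun z => fderiv ℝ ψ z (0, 1)) 2) (h4 : MemLp (fun s : ℝ => ψ (|s|, s)) 2) :
    IsH1Trace ψ := by
  refine IsH1Trace.of_dominated (φ := fun n z => (cutoff n z : ℂ) * ψ z)
    (fun n => .of_lipschitz_of_hasCompactSupport (cutoff_mul_lipschitz hψ hC n)
      (cutoff_mul_hasCompactSupport n)) h1.norm
    (h2.norm.add (h1.norm.mul_const ‖((1, 0) : ℝ × ℝ)‖))
    (h3.norm.add (h1.norm.mul_const ‖((0, 1) : ℝ × ℝ)‖)) h4.norm
    norm_cutoff_mul_le (fun n => norm_fderiv_cutoff_mul_le hψ n _)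
    (fun n => norm_fderiv_cutoff_mul_le hψ n _) (fun z => ?_) (Eventually.of_forall fun z => ?_)
  · exact tendsto_const_nhds.congr' ((eventually_cutoff_mul_eventuallyEq z).mono
      fun n hn => hn.eq_of_nhds.symm)
  · exact tendsto_const_nhds.congr' ((eventually_cutoff_mul_eventuallyEq z).mono
      fun n hn => hn.fderiv_eq.symm)

end TwoD

/-! ### The exponential kernel of -∂² + κ² -/

section Kernel

theorem abs_exp_neg_sub_le (α β : ℝ) :
    |Real.exp (-α) - Real.exp (-β)| ≤ |α - β| * Real.exp (-min α β) := by
  wlog h : α ≤ β generalizing α β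
  · rw [abs_sub_comm, abs_sub_comm α, min_comm]
    exact this β α (le_of_not_ge h)
  have h1 : Real.exp (-β) = Real.exp (-α) * Real.exp (-(β - α)) := by
    rw [← Real.exp_add]; ring_nf
  have h2 := Real.add_one_le_exp (-(β - α))
  have h3 : Real.exp (-β) ≤ Real.exp (-α) := Real.exp_le_exp.2 (by linarith)
  rw [min_eq_left h, abs_of_nonneg (by linarith), abs_of_nonpos (by linarith), h1]
  nlinarith [Real.exp_pos (-α)]

/-- The unnormalized fundamental solution of `-∂² + κ²` with pole `a`. -/
noncomputable def kernel (κ a y : ℝ) : ℝ := Real.exp (-(κ * |y - a|))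

theorem kernel_pos (κ a y : ℝ) : 0 < kernel κ a y := Real.exp_pos _

@[fun_prop]
theorem continuous_kernel (κ a : ℝ) : Continuous (kernel κ a) := by unfold kernel; fun_prop

theorem kernel_le_one {κ : ℝ} (hκ : 0 ≤ κ) (a y : ℝ) : kernel κ a y ≤ 1 :=
  Real.exp_le_one_iff.2 (by have := abs_nonneg (y - a); nlinarith)

theorem abs_kernel_sub_le {κ : ℝ} (hκ : 0 ≤ κ) (a y z : ℝ) :
    |kernel κ a y - kernel κ a z| ≤ κ * |y - z| := by
  refine (abs_exp_neg_sub_le _ _).trans ?_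
  have h1 : 0 ≤ min (κ * |y - a|) (κ * |z - a|) := le_min (by positivity) (by positivity)
  have h2 : Real.exp (-min (κ * |y - a|) (κ * |z - a|)) ≤ 1 := Real.exp_le_one_iff.2 (by linarith)
  have h3 : |(κ * |y - a|) - (κ * |z - a|)| ≤ κ * |y - z| := by
    rw [← mul_sub, abs_mul, abs_of_nonneg hκ]
    refine mul_le_mul_of_nonneg_left ?_ hκ
    have := abs_abs_sub_abs_le (y - a) (z - a)
    rwa [sub_sub_sub_cancel_right] at this
  calc _ ≤ κ * |y - z| * 1 := mul_le_mul h3 h2 (Real.exp_pos _).le (by positivity)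
    _ = _ := mul_one _

theorem integrable_kernel {κ : ℝ} (hκ : 0 < κ) (a : ℝ) : Integrable (kernel κ a) := by
  have h0 : Integrable (kernel κ 0) := by
    rw [← integrableOn_univ, ← Set.Iic_union_Ioi (a := (0 : ℝ))]
    refine IntegrableOn.union ?_ ?_
    · refine (integrableOn_exp_mul_Iic hκ 0).congr_fun (fun y hy => ?_) measurableSet_Iic
      simp [kernel, abs_of_nonpos (show y ≤ 0 from hy)]
    · refine (integrableOn_exp_mul_Ioi (neg_lt_zero.2 hκ) 0).congr_fun (fun y hy => ?_)
        measurableSet_Ioi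
      simp [kernel, abs_of_pos (show 0 < y from hy)]
  have := h0.comp_sub_right a
  refine this.congr (Eventually.of_forall fun y => ?_)
  simp [kernel]

theorem integral_kernel {κ : ℝ} (hκ : 0 < κ) (a : ℝ) : ∫ y, kernel κ a y = 2 / κ := by
  have h1 : ∀ y, kernel κ a y = (fun z => Real.exp (-(κ * |z|))) (y - a) := fun y => rfl
  simp_rw [h1]
  rw [integral_sub_right_eq_self (fun z => Real.exp (-(κ * |z|))) a,
    integral_comp_abs (f := fun z => Real.exp (-(κ * z)))]
  have h2 := integral_exp_mul_Ioi (neg_lt_zero.2 hκ) 0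
  simp only [neg_mul, mul_zero, Real.exp_zero] at h2
  rw [h2]; field_simp

theorem kernel_sq (κ a y : ℝ) : kernel κ a y ^ 2 = kernel (2 * κ) a y := by
  rw [kernel, kernel, ← Real.exp_nat_mul]; congr 1; push_cast; ring

theorem memLp_kernel {κ : ℝ} (hκ : 0 < κ) (a : ℝ) : MemLp (kernel κ a) 2 := by
  rw [memLp_two_iff_integrable_sq (continuous_kernel κ a).aestronglyMeasurable]
  simp_rw [kernel_sq]
  exact integrable_kernel (by positivity) a

/-- The complex valued kernel. -/
noncomputable def kernelC (κ a y : ℝ) : ℂ := kernel κ a y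

theorem kernelC_lipschitz {κ : NNReal} (a : ℝ) : LipschitzWith κ (kernelC κ a) :=
  LipschitzWith.of_dist_le_mul fun y z => by
    rw [dist_eq_norm, kernelC, kernelC, ← Complex.ofReal_sub, Complex.norm_real, Real.norm_eq_abs,
      Real.dist_eq]
    exact abs_kernel_sub_le κ.2 a y z

theorem hasDerivAt_kernelC_of_gt {κ a y : ℝ} (h : a < y) :
    HasDerivAt (kernelC κ a) (-κ * Real.exp (-(κ * (y - a))) : ℝ) y := by
  have h1 : HasDerivAt (fun y => Real.exp (-(κ * (y - a)))) (-κ * Real.exp (-(κ * (y - a)))) y := by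
    have : HasDerivAt (fun y => -(κ * (y - a))) (-κ) y := by
      simpa using (((hasDerivAt_id y).sub_const a).const_mul κ).fun_neg
    simpa [mul_comm] using this.exp
  refine (h1.ofReal_comp).congr_of_eventuallyEq ?_
  filter_upwards [lt_mem_nhds h] with z hz
  simp [kernelC, kernel, abs_of_pos (sub_pos.2 hz)]

theorem hasDerivAt_kernelC_of_lt {κ a y : ℝ} (h : y < a) :
    HasDerivAt (kernelC κ a) (κ * Real.exp (κ * (y - a)) : ℝ) y := by
  have h1 : HasDerivAt (fun y => Real.exp (κ * (y - a))) (κ * Real.exp (κ * (y - a))) y := by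
    have : HasDerivAt (fun y => κ * (y - a)) κ y := by
      simpa using ((hasDerivAt_id y).sub_const a).const_mul κ
    simpa [mul_comm] using this.exp
  refine (h1.ofReal_comp).congr_of_eventuallyEq ?_
  filter_upwards [gt_mem_nhds h] with z hz
  simp only [kernelC, kernel, abs_of_neg (sub_neg.2 hz)]
  congr 2; ring

theorem norm_deriv_kernelC_le {κ : ℝ} (hκ : 0 ≤ κ) (a : ℝ) :
    ∀ᵐ y, ‖deriv (kernelC κ a) y‖ ≤ κ * kernel κ a y := by
  have : ∀ᵐ y : ℝ, y ≠ a := by simp [ae_iff]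
  filter_upwards [this] with y hy
  rcases lt_or_gt_of_ne hy with h | h
  · rw [(hasDerivAt_kernelC_of_lt h).deriv, Complex.norm_real, Real.norm_of_nonneg (by positivity),
      kernel, abs_of_neg (sub_neg.2 h)]
    exact le_of_eq (by congr 2; ring)
  · rw [(hasDerivAt_kernelC_of_gt h).deriv, Complex.norm_real, Real.norm_eq_abs, abs_mul, abs_neg,
      abs_of_nonneg hκ, abs_of_pos (Real.exp_pos _), kernel, abs_of_pos (sub_pos.2 h)]

theorem isH1Values_kernelC {κ : ℝ} (hκ : 0 < κ) (a x : ℝ) : IsH1Values x (kernelC κ a) := by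
  lift κ to NNReal using hκ.le
  refine IsH1Values.of_lipschitz (C := 1) (kernelC_lipschitz a) (fun z => ?_) (memLp_kernel hκ a).ofReal
    ?_ x
  · rw [kernelC, Complex.norm_real, Real.norm_of_nonneg (kernel_pos _ _ _).le]
    exact kernel_le_one hκ.le a z
  · exact ((memLp_kernel hκ a).const_mul (κ : ℝ)).mono' (measurable_deriv _).aestronglyMeasurable
      (norm_deriv_kernelC_le hκ.le a)

/-- This is (-∂² + κ²)e^{-κ|y-a|} = 2κδ_a in weak form. To the right of a the integrand is
-κ(e^{-κ(y-a)}φ)', to the left it is κ(e^{κ(y-a)}φ)', and each half contributes κφ(a). -/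
theorem integral_kernel_test {φ : ℝ → ℂ} (hφ : IsTest φ) (κ a : ℝ) :
    Integrable (fun y => deriv (kernelC κ a) y * deriv φ y + κ ^ 2 * (kernelC κ a y * φ y)) ∧
    ∫ y, (deriv (kernelC κ a) y * deriv φ y + κ ^ 2 * (kernelC κ a y * φ y)) = 2 * κ * φ a := by
  set F : ℝ → ℂ := fun y => deriv (kernelC κ a) y * deriv φ y + κ ^ 2 * (kernelC κ a y * φ y) with hF
  have hd : ∀ y, HasDerivAt φ (deriv φ y) y := fun y =>
    (hφ.1.differentiable (by simp) y).hasDerivAt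
  have hlim : ∀ (e : ℝ → ℝ) (_ : Continuous e), HasCompactSupport fun y => (e y : ℂ) * φ y :=
    fun e he => hφ.2.mul_left
  have htop : ∀ (e : ℝ → ℝ) (_ : Continuous e),
      Tendsto (fun y => (e y : ℂ) * φ y) (cocompact ℝ) (𝓝 0) := fun e he =>
    (hlim e he).is_zero_at_infty
  have hdc : Continuous (deriv φ) := hφ.deriv.1.continuous
  have hint : ∀ (e : ℝ → ℝ) (_ : Continuous e) (c : ℂ),
      Integrable fun y => (e y : ℂ) * (deriv φ y + c * φ y) := fun e he c => by
    refine Continuous.integrable_of_hasCompactSupport ?_ ?_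
    · have := hφ.1.continuous
      exact (Complex.continuous_ofReal.comp he).mul (hdc.add (this.const_mul c))
    · exact (hφ.deriv.2.add (hφ.2.mul_left (f := fun _ => c))).mul_left
  set e₁ : ℝ → ℝ := fun y => Real.exp (-(κ * (y - a)))
  set e₂ : ℝ → ℝ := fun y => Real.exp (κ * (y - a))
  have he₁ : Continuous e₁ := by fun_prop
  have he₂ : Continuous e₂ := by fun_prop
  have hd₁ : ∀ y, HasDerivAt (fun y => (e₁ y : ℂ) * φ y) ((e₁ y : ℂ) * (deriv φ y + (-κ) * φ y)) y := by
    intro y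
    have h1 : HasDerivAt e₁ (-κ * e₁ y) y := by
      have : HasDerivAt (fun y => -(κ * (y - a))) (-κ) y := by
        simpa using (((hasDerivAt_id y).sub_const a).const_mul κ).fun_neg
      simpa [e₁, mul_comm] using this.exp
    refine (h1.ofReal_comp.fun_mul (hd y)).congr_deriv ?_
    push_cast; ring
  have hd₂ : ∀ y, HasDerivAt (fun y => (e₂ y : ℂ) * φ y) ((e₂ y : ℂ) * (deriv φ y + κ * φ y)) y := by
    intro y
    have h1 : HasDerivAt e₂ (κ * e₂ y) y := by
      have : HasDerivAt (fun y => κ * (y - a)) κ y := by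
        simpa using ((hasDerivAt_id y).sub_const a).const_mul κ
      simpa [e₂, mul_comm] using this.exp
    refine (h1.ofReal_comp.fun_mul (hd y)).congr_deriv ?_
    push_cast; ring
  have i₁ : ∫ y in Set.Ioi a, (e₁ y : ℂ) * (deriv φ y + (-κ) * φ y) = -φ a := by
    rw [integral_Ioi_of_hasDerivAt_of_tendsto (hd₁ a).continuousAt.continuousWithinAt
      (fun y _ => hd₁ y) (hint e₁ he₁ _).integrableOn ((htop e₁ he₁).mono_left atTop_le_cocompact)]
    simp [e₁]
  have i₂ : ∫ y in Set.Iic a, (e₂ y : ℂ) * (deriv φ y + κ * φ y) = φ a := by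
    rw [integral_Iic_of_hasDerivAt_of_tendsto (hd₂ a).continuousAt.continuousWithinAt
      (fun y _ => hd₂ y) (hint e₂ he₂ _).integrableOn ((htop e₂ he₂).mono_left atBot_le_cocompact)]
    simp [e₂]
  have f₁ : Set.EqOn (fun y => (-κ : ℂ) * ((e₁ y : ℂ) * (deriv φ y + (-κ) * φ y))) F (Set.Ioi a) := by
    intro y hy
    simp only [hF, (hasDerivAt_kernelC_of_gt (κ := κ) hy).deriv, kernelC, kernel,
      abs_of_pos (sub_pos.2 (show a < y from hy)), e₁]
    push_cast; ring
  have f₂ : Set.EqOn (fun y => (κ : ℂ) * ((e₂ y : ℂ) * (deriv φ y + κ * φ y))) F (Set.Iio a) := by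
    intro y hy
    simp only [hF, (hasDerivAt_kernelC_of_lt (κ := κ) hy).deriv, kernelC, kernel,
      abs_of_neg (sub_neg.2 (show y < a from hy)), e₂]
    push_cast; ring_nf
  have g₁ : IntegrableOn F (Set.Ioi a) :=
    (((hint e₁ he₁ (-κ)).const_mul (-κ : ℂ)).integrableOn).congr_fun f₁ measurableSet_Ioi
  have g₂ : IntegrableOn F (Set.Iic a) := by
    rw [integrableOn_Iic_iff_integrableOn_Iio]
    exact (((hint e₂ he₂ κ).const_mul (κ : ℂ)).integrableOn).congr_fun f₂ measurableSet_Iio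
  have hFi : Integrable F := by
    rw [← integrableOn_univ, ← Set.Iic_union_Ioi (a := a)]
    exact g₂.union g₁
  refine ⟨hFi, ?_⟩
  rw [← intervalIntegral.integral_Iic_add_Ioi g₂ g₁, ← setIntegral_congr_fun measurableSet_Ioi f₁,
    integral_const_mul, i₁, integral_Iic_eq_integral_Iio,
    ← setIntegral_congr_fun measurableSet_Iio f₂, ← integral_Iic_eq_integral_Iio,
    integral_const_mul, i₂]
  ring

end Kernel

/-! ### The double well through its reproducing kernels -/

section Well

theorem inner_self_eq_ofReal {E : Type*} [NormedAddCommGroup E] [InnerProductSpace ℂ E] (x : E) :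
    (inner ℂ x x : ℂ) = ((‖x‖ ^ 2 : ℝ) : ℂ) := by
  rw [inner_self_eq_norm_sq_to_K]; norm_cast

/-- The test functions, as elements `(φ, φ', φ(-x), φ(x))`. -/
noncomputable def testValues (x : ℝ) : Submodule ℂ (L2R × (L2R × ℂ × ℂ)) where
  carrier := {p | ∃ φ : ℝ → ℂ, IsTest φ ∧ p.1 =ᵐ[volume] φ ∧ p.2.1 =ᵐ[volume] deriv φ ∧
    p.2.2.1 = φ (-x) ∧ p.2.2.2 = φ x}
  zero_mem' := ⟨0, ⟨contDiff_const, HasCompactSupport.zero⟩, Lp.coeFn_zero _ _ _, by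
    have : deriv (0 : ℝ → ℂ) = 0 := by ext; simp
    rw [this]; exact Lp.coeFn_zero _ _ _, rfl, rfl⟩
  add_mem' := by
    rintro p q ⟨φ, hφ, h1, h2, h3, h4⟩ ⟨χ, hχ, k1, k2, k3, k4⟩
    refine ⟨φ + χ, ⟨hφ.1.add hχ.1, hφ.2.add hχ.2⟩, (Lp.coeFn_add _ _).trans (h1.add k1), ?_,
      by simp [h3, k3], by simp [h4, k4]⟩
    have : deriv (φ + χ) = deriv φ + deriv χ := by
      ext y
      exact deriv_add (hφ.1.differentiable (by simp) y) (hχ.1.differentiable (by simp) y)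
    rw [this]
    exact (Lp.coeFn_add _ _).trans (h2.add k2)
  smul_mem' := by
    rintro c p ⟨φ, hφ, h1, h2, h3, h4⟩
    refine ⟨c • φ, ⟨contDiff_const.smul hφ.1, hφ.2.smul_left (f := fun _ => c)⟩,
      (Lp.coeFn_smul _ _).trans (h1.const_smul c), ?_, by simp [h3], by simp [h4]⟩
    have : deriv (c • φ) = c • deriv φ := by
      ext y
      exact deriv_const_smul c (hφ.1.differentiable (by simp) y)
    rw [this]
    exact (Lp.coeFn_smul _ _).trans (h2.const_smul c)

/-- `H1RWithValues x` as a submodule. -/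
noncomputable def valueSpace (x : ℝ) : Submodule ℂ (L2R × (L2R × ℂ × ℂ)) :=
  (testValues x).topologicalClosure

theorem mem_valueSpace {x : ℝ} {v : L2R × (L2R × ℂ × ℂ)} : v ∈ valueSpace x ↔ v ∈ H1RWithValues x :=
  Iff.rfl

/-- The sesquilinear form of `‖ψ'‖² + κ² ‖ψ‖²`. -/
noncomputable def kernelForm (κ : ℝ) (w v : L2R × (L2R × ℂ × ℂ)) : ℂ :=
  inner ℂ w.2.1 v.2.1 + (κ : ℂ) ^ 2 * inner ℂ w.1 v.1

theorem kernelForm_conj (κ : ℝ) (w v : L2R × (L2R × ℂ × ℂ)) :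
    (starRingEnd ℂ) (kernelForm κ w v) = kernelForm κ v w := by
  simp [kernelForm]

theorem kernelForm_self_re (κ : ℝ) (v : L2R × (L2R × ℂ × ℂ)) :
    (kernelForm κ v v).re = ‖v.2.1‖ ^ 2 + κ ^ 2 * ‖v.1‖ ^ 2 := by
  rw [kernelForm, inner_self_eq_ofReal, inner_self_eq_ofReal, ← Complex.ofReal_pow,
    ← Complex.ofReal_mul, ← Complex.ofReal_add, Complex.ofReal_re]

theorem kernelForm_self_nonneg (κ : ℝ) (v : L2R × (L2R × ℂ × ℂ)) : 0 ≤ (kernelForm κ v v).re := by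
  rw [kernelForm_self_re]; positivity

theorem kernelForm_comb (κ : ℝ) (w v k l : L2R × (L2R × ℂ × ℂ)) (a b c : ℂ) :
    kernelForm κ w (a • v - b • k - c • l) =
      a * kernelForm κ w v - b * kernelForm κ w k - c * kernelForm κ w l := by
  simp only [kernelForm, Prod.snd_sub, Prod.fst_sub, Prod.smul_fst, Prod.smul_snd, inner_sub_right,
    inner_smul_right]
  ring

theorem kernelForm_comb_left (κ : ℝ) (w v k l : L2R × (L2R × ℂ × ℂ)) (a b c : ℂ) :
    kernelForm κ (a • v - b • k - c • l) w = (starRingEnd ℂ) a * kernelForm κ v w -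
      (starRingEnd ℂ) b * kernelForm κ k w - (starRingEnd ℂ) c * kernelForm κ l w := by
  rw [← kernelForm_conj, kernelForm_comb]
  simp [kernelForm_conj]

/-- Here κ is arbitrary. The shift by κ² isolates a positive form whose point evaluations are
represented by exponentials. -/
theorem wellForm_eq (κ : ℝ) (w v : L2R × (L2R × ℂ × ℂ)) :
    wellForm w v = kernelForm κ w v - (starRingEnd ℂ) w.2.2.1 * v.2.2.1 -
      (starRingEnd ℂ) w.2.2.2 * v.2.2.2 - (κ : ℂ) ^ 2 * inner ℂ w.1 v.1 := by
  simp only [wellForm, kernelForm, RCLike.inner_apply]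
  ring

theorem conj_kernelC (κ a y : ℝ) : (starRingEnd ℂ) (kernelC κ a y) = kernelC κ a y :=
  Complex.conj_ofReal _

theorem conj_deriv_kernelC (κ a : ℝ) :
    ∀ᵐ y, (starRingEnd ℂ) (deriv (kernelC κ a) y) = deriv (kernelC κ a) y := by
  have : ∀ᵐ y : ℝ, y ≠ a := by simp [ae_iff]
  filter_upwards [this] with y hy
  rcases lt_or_gt_of_ne hy with h | h
  · rw [(hasDerivAt_kernelC_of_lt h).deriv, Complex.conj_ofReal]
  · rw [(hasDerivAt_kernelC_of_gt h).deriv, Complex.conj_ofReal]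

theorem kernelForm_kernel_test {κ a : ℝ} {k v : L2R × (L2R × ℂ × ℂ)} {φ : ℝ → ℂ}
    (h1 : k.1 =ᵐ[volume] kernelC κ a) (h2 : k.2.1 =ᵐ[volume] deriv (kernelC κ a)) (hφ : IsTest φ)
    (h3 : v.1 =ᵐ[volume] φ) (h4 : v.2.1 =ᵐ[volume] deriv φ) :
    kernelForm κ k v = 2 * κ * φ a := by
  have i1 := L2.integrable_inner (𝕜 := ℂ) k.2.1 v.2.1
  have i2 := L2.integrable_inner (𝕜 := ℂ) k.1 v.1
  rw [← (integral_kernel_test hφ κ a).2, kernelForm, L2.inner_def, L2.inner_def,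
    ← integral_const_mul, ← integral_add i1 (i2.const_mul _)]
  refine integral_congr_ae ?_
  filter_upwards [h1, h2, h3, h4, conj_deriv_kernelC κ a] with y e1 e2 e3 e4 e5
  rw [e1, e2, e3, e4, RCLike.inner_apply, RCLike.inner_apply, e5, conj_kernelC]
  ring

theorem continuous_kernelForm_right (κ : ℝ) (k : L2R × (L2R × ℂ × ℂ)) :
    Continuous fun v => kernelForm κ k v := by
  unfold kernelForm; fun_prop

theorem kernelForm_kernel {κ x : ℝ} {k v : L2R × (L2R × ℂ × ℂ)}
    (h1 : k.1 =ᵐ[volume] kernelC κ x) (h2 : k.2.1 =ᵐ[volume] deriv (kernelC κ x))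
    (hv : v ∈ valueSpace x) : kernelForm κ k v = 2 * κ * v.2.2.2 := by
  have hcl : IsClosed {v : L2R × (L2R × ℂ × ℂ) | kernelForm κ k v = 2 * κ * v.2.2.2} :=
    isClosed_eq (continuous_kernelForm_right κ k) (by fun_prop)
  refine closure_minimal ?_ hcl hv
  rintro w ⟨φ, hφ, e1, e2, -, e4⟩
  change kernelForm κ k w = 2 * κ * w.2.2.2
  rw [kernelForm_kernel_test h1 h2 hφ e1 e2, e4]

theorem kernelForm_kernel_neg {κ x : ℝ} {k v : L2R × (L2R × ℂ × ℂ)}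
    (h1 : k.1 =ᵐ[volume] kernelC κ (-x)) (h2 : k.2.1 =ᵐ[volume] deriv (kernelC κ (-x)))
    (hv : v ∈ valueSpace x) : kernelForm κ k v = 2 * κ * v.2.2.1 := by
  have hcl : IsClosed {v : L2R × (L2R × ℂ × ℂ) | kernelForm κ k v = 2 * κ * v.2.2.1} :=
    isClosed_eq (continuous_kernelForm_right κ k) (by fun_prop)
  refine closure_minimal ?_ hcl hv
  rintro w ⟨φ, hφ, e1, e2, e3, -⟩
  change kernelForm κ k w = 2 * κ * w.2.2.1
  rw [kernelForm_kernel_test h1 h2 hφ e1 e2, e3]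

/-- The reproducing kernels of the evaluations at `x` and `-x`. -/
theorem exists_kernels {κ x : ℝ} (hκ : 0 < κ) (hx : 0 ≤ x) :
    ∃ k ∈ valueSpace x, ∃ l ∈ valueSpace x, k.1 =ᵐ[volume] kernelC κ x ∧
      l.1 =ᵐ[volume] kernelC κ (-x) ∧ k.2.2 = (((Real.exp (-(2 * κ * x)) : ℝ) : ℂ), 1) ∧
      l.2.2 = (1, ((Real.exp (-(2 * κ * x)) : ℝ) : ℂ)) ∧
      (∀ v ∈ valueSpace x, kernelForm κ k v = 2 * κ * v.2.2.2 ∧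
        kernelForm κ l v = 2 * κ * v.2.2.1) ∧
      k.2.1 =ᵐ[volume] deriv (kernelC κ x) ∧ l.2.1 =ᵐ[volume] deriv (kernelC κ (-x)) := by
  obtain ⟨k, hk, k1, k2, k3, k4⟩ := isH1Values_kernelC hκ x x
  obtain ⟨l, hl, l1, l2, l3, l4⟩ := isH1Values_kernelC hκ (-x) x
  refine ⟨k, hk, l, hl, k1, l1, Prod.ext ?_ ?_, Prod.ext ?_ ?_, fun v hv =>
    ⟨kernelForm_kernel k1 k2 hv, kernelForm_kernel_neg l1 l2 hv⟩, k2, l2⟩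
  · rw [k3, kernelC, kernel]
    have : |(-x - x)| = 2 * x := by rw [abs_of_nonpos (by linarith)]; ring
    rw [this]; simp only; congr 3; ring
  · rw [k4, kernelC, kernel]; simp
  · rw [l3, kernelC, kernel]; simp
  · rw [l4, kernelC, kernel]
    have : |x - -x| = 2 * x := by rw [abs_of_nonneg (by linarith)]; ring
    rw [this]; simp only; congr 3; ring

/-- The lower bound of `‖ψ'‖² + κ² ‖ψ‖²` in terms of `ψ(±x)`. -/
theorem kernelForm_lower_bound {κ x : ℝ} (hκ : 0 < κ) (hx : 0 ≤ x) {v : L2R × (L2R × ℂ × ℂ)}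
    (hv : v ∈ valueSpace x) :
    2 * κ * (2 * (‖v.2.2.1‖ ^ 2 + ‖v.2.2.2‖ ^ 2)) - (‖v.2.2.1‖ ^ 2 + ‖v.2.2.2‖ ^ 2 +
      2 * Real.exp (-(2 * κ * x)) * ((starRingEnd ℂ) v.2.2.2 * v.2.2.1).re) ≤
      2 * κ * (kernelForm κ v v).re := by
  obtain ⟨k, hk, l, hl, -, -, k2, l2, h, -⟩ := exists_kernels hκ hx
  have e1 := (h v hv).1
  have e2 := (h v hv).2
  have e3 := (h k hk).1
  have e4 := (h k hk).2
  have e5 := (h l hl).1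
  have e6 := (h l hl).2
  simp only [k2, l2] at e3 e4 e5 e6
  have e1' : kernelForm κ v k = 2 * κ * (starRingEnd ℂ) v.2.2.2 := by
    rw [← kernelForm_conj, e1]; simp only [map_mul, map_ofNat, Complex.conj_ofReal]
  have e2' : kernelForm κ v l = 2 * κ * (starRingEnd ℂ) v.2.2.1 := by
    rw [← kernelForm_conj, e2]; simp only [map_mul, map_ofNat, Complex.conj_ofReal]
  -- A Bessel inequality: the kernels represent 2κ times the evaluations, and their Gram matrix is
  -- 2κ(1 E; E 1).
  have h0 := kernelForm_self_nonneg κ ((2 * κ : ℂ) • v - v.2.2.2 • k - v.2.2.1 • l)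
  rw [kernelForm_comb, kernelForm_comb_left, kernelForm_comb_left, kernelForm_comb_left,
    e1, e2, e3, e4, e5, e6, e1', e2'] at h0
  set p := v.2.2.2
  set q := v.2.2.1
  set E := Real.exp (-(2 * κ * x))
  have hp : ‖p‖ ^ 2 = p.re ^ 2 + p.im ^ 2 := by rw [Complex.sq_norm, Complex.normSq_apply]; ring
  have hq : ‖q‖ ^ 2 = q.re ^ 2 + q.im ^ 2 := by rw [Complex.sq_norm, Complex.normSq_apply]; ring
  have hF : kernelForm κ v v = ((kernelForm κ v v).re : ℂ) :=
    (Complex.conj_eq_iff_re.1 (kernelForm_conj κ v v)).symm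
  rw [hF] at h0
  generalize (kernelForm κ v v).re = r at h0 ⊢
  simp only [map_mul, map_ofNat, Complex.conj_ofReal] at h0
  simp only [Complex.sub_re, Complex.mul_re, Complex.mul_im, Complex.sub_im, Complex.conj_re,
    Complex.conj_im, Complex.ofReal_re, Complex.ofReal_im, Complex.re_ofNat, Complex.im_ofNat,
    Complex.one_re, Complex.one_im] at h0
  rw [hp, hq]
  simp only [Complex.mul_re, Complex.conj_re, Complex.conj_im]
  have h1 : 0 ≤ 2 * κ * (2 * κ * r - 2 * (2 * κ) * (p.re ^ 2 + p.im ^ 2 + q.re ^ 2 + q.im ^ 2) +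
      (p.re ^ 2 + p.im ^ 2 + q.re ^ 2 + q.im ^ 2 + 2 * E * (p.re * q.re + p.im * q.im))) := by
    linarith
  have h2 := nonneg_of_mul_nonneg_right h1 (by positivity)
  linarith

theorem wellForm_smul_right (w v : L2R × (L2R × ℂ × ℂ)) (c : ℂ) :
    wellForm w (c • v) = c * wellForm w v := by
  simp only [wellForm, Prod.smul_fst, Prod.smul_snd, inner_smul_right]; ring

theorem wellForm_sub_right (w v v' : L2R × (L2R × ℂ × ℂ)) :
    wellForm w (v - v') = wellForm w v - wellForm w v' := by
  simp only [wellForm, Prod.fst_sub, Prod.snd_sub, inner_sub_right]; ring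

theorem wellForm_conj (w v : L2R × (L2R × ℂ × ℂ)) :
    (starRingEnd ℂ) (wellForm w v) = wellForm v w := by
  simp [wellForm, -RCLike.inner_apply]

theorem wellForm_self_re (κ : ℝ) (v : L2R × (L2R × ℂ × ℂ)) : (wellForm v v).re =
    (kernelForm κ v v).re - (‖v.2.2.1‖ ^ 2 + ‖v.2.2.2‖ ^ 2) - κ ^ 2 * ‖v.1‖ ^ 2 := by
  have h : ∀ z : ℂ, (starRingEnd ℂ) z * z = ((‖z‖ ^ 2 : ℝ) : ℂ) := fun z => by
    rw [mul_comm, Complex.mul_conj, Complex.normSq_eq_norm_sq]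
  rw [wellForm_eq κ, h, h, inner_self_eq_ofReal, Complex.sub_re, Complex.sub_re,
    Complex.sub_re, Complex.ofReal_re, Complex.ofReal_re, ← Complex.ofReal_pow,
    ← Complex.ofReal_mul, Complex.ofReal_re]
  ring

/-- The double well is bounded from below by `-κ²`. -/
theorem wellForm_lower_bound {κ x : ℝ} (hκ : 1 + Real.exp (-(2 * κ * x)) = 2 * κ) (hx : 0 ≤ x)
    {v : L2R × (L2R × ℂ × ℂ)} (hv : v ∈ valueSpace x) :
    -κ ^ 2 * ‖v.1‖ ^ 2 ≤ (wellForm v v).re := by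
  have hE := Real.exp_pos (-(2 * κ * x))
  have hκ0 : 0 < κ := by linarith
  have h1 := kernelForm_lower_bound hκ0 hx hv
  rw [wellForm_self_re κ]
  set p := v.2.2.2
  set q := v.2.2.1
  set E := Real.exp (-(2 * κ * x))
  have hp : ‖p‖ ^ 2 = p.re ^ 2 + p.im ^ 2 := by rw [Complex.sq_norm, Complex.normSq_apply]; ring
  have hq : ‖q‖ ^ 2 = q.re ^ 2 + q.im ^ 2 := by rw [Complex.sq_norm, Complex.normSq_apply]; ring
  rw [hp, hq] at h1 ⊢
  simp only [Complex.mul_re, Complex.conj_re, Complex.conj_im] at h1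
  -- The largest eigenvalue of (1 E; E 1) is 1 + E, which equals 2κ by the choice of κ.
  have h2 : 2 * (p.re * q.re - -p.im * q.im) ≤ q.re ^ 2 + q.im ^ 2 + (p.re ^ 2 + p.im ^ 2) := by
    nlinarith [sq_nonneg (p.re - q.re), sq_nonneg (p.im - q.im)]
  have h3 := mul_le_mul_of_nonneg_left h2 hE.le
  have h4 : 2 * κ * (q.re ^ 2 + q.im ^ 2 + (p.re ^ 2 + p.im ^ 2)) ≤
      2 * κ * (kernelForm κ v v).re := by
    nlinarith
  have h5 := le_of_mul_le_mul_left h4 (by positivity)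
  linarith

/-- On functions with `ψ(x) + ψ(-x) = 0`, the double well is bounded from below by `-1/4`. -/
theorem wellForm_lower_bound_of_odd {x : ℝ} (hx : 0 ≤ x) {v : L2R × (L2R × ℂ × ℂ)}
    (hv : v ∈ valueSpace x) (hodd : v.2.2.1 = -v.2.2.2) :
    -(1 / 4) * ‖v.1‖ ^ 2 ≤ (wellForm v v).re := by
  -- For opposite values the Gram matrix only contributes its eigenvalue 1 - E, which is below 1 =
  -- 2κ already for κ = 1/2.
  have h1 := kernelForm_lower_bound (κ := 1 / 2) (by norm_num) hx hv
  rw [wellForm_self_re (1 / 2)]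
  rw [hodd] at h1 ⊢
  set p := v.2.2.2
  have hE := Real.exp_pos (-(2 * (1 / 2) * x))
  set E := Real.exp (-(2 * (1 / 2) * x))
  have hp : ‖p‖ ^ 2 = p.re ^ 2 + p.im ^ 2 := by rw [Complex.sq_norm, Complex.normSq_apply]; ring
  rw [norm_neg, hp] at h1 ⊢
  simp only [Complex.mul_re, Complex.conj_re, Complex.conj_im, Complex.neg_re, Complex.neg_im] at h1
  nlinarith [mul_nonneg hE.le (sq_nonneg p.re), mul_nonneg hE.le (sq_nonneg p.im)]

/-- The (unnormalized) ground state of the double well, its eigenvalue equation, its uniqueness,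
and the lower bound on its orthogonal complement. -/
theorem exists_ground {κ x : ℝ} (hκ : 1 + Real.exp (-(2 * κ * x)) = 2 * κ) (hx : 0 ≤ x) :
    ∃ U ∈ valueSpace x, U.1 =ᵐ[volume] (fun y => kernelC κ x y + kernelC κ (-x) y) ∧
      (∀ w ∈ valueSpace x, wellForm w U = -(κ : ℂ) ^ 2 * inner ℂ w.1 U.1) ∧
      (∀ v ∈ valueSpace x, (∀ w ∈ valueSpace x, wellForm w v = -(κ : ℂ) ^ 2 * inner ℂ w.1 v.1) →
        ∃ c : ℂ, v.1 = c • U.1) ∧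
      (∀ g ∈ valueSpace x, (inner ℂ g.1 U.1 : ℂ) = 0 →
        -(1 / 4) * ‖g.1‖ ^ 2 ≤ (wellForm g g).re) ∧
      U.2.1 =ᵐ[volume] deriv (fun y => kernelC κ x y + kernelC κ (-x) y) ∧
      U.2.2.1 = 2 * κ ∧ U.2.2.2 = 2 * κ := by
  have hE := Real.exp_pos (-(2 * κ * x))
  have hκ0 : 0 < κ := by linarith
  obtain ⟨k, hk, l, hl, k1, l1, k2, l2, h, k3, l3⟩ := exists_kernels hκ0 hx
  set E := Real.exp (-(2 * κ * x))
  have hκC : (2 * κ : ℂ) = 1 + E := by exact_mod_cast hκ.symm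
  have hright : ∀ w ∈ valueSpace x, kernelForm κ w k = 2 * κ * (starRingEnd ℂ) w.2.2.2 ∧
      kernelForm κ w l = 2 * κ * (starRingEnd ℂ) w.2.2.1 := fun w hw => by
    rw [← kernelForm_conj, ← kernelForm_conj κ l, (h w hw).1, (h w hw).2]
    simp only [map_mul, map_ofNat, Complex.conj_ofReal, true_and]
  have hadd : ∀ w, kernelForm κ w (k + l) = kernelForm κ w k + kernelForm κ w l := fun w => by
    simp only [kernelForm, Prod.fst_add, Prod.snd_add, inner_add_right]; ring
  have hU1 : (k + l).2.2.1 = 2 * κ := by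
    rw [Prod.snd_add, Prod.snd_add, Prod.fst_add, k2, l2, hκC]; ring
  have hU2 : (k + l).2.2.2 = 2 * κ := by
    rw [Prod.snd_add, Prod.snd_add, Prod.snd_add, k2, l2, hκC]
  have hUV : k + l ∈ valueSpace x := (valueSpace x).add_mem hk hl
  have heig : ∀ w ∈ valueSpace x, wellForm w (k + l) = -(κ : ℂ) ^ 2 * inner ℂ w.1 (k + l).1 := by
    intro w hw
    rw [wellForm_eq κ, hadd, (hright w hw).1, (hright w hw).2, hU1, hU2]; ring
  refine ⟨k + l, hUV, ?_, heig, ?_, ?_, ?_, hU1, hU2⟩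
  · filter_upwards [Lp.coeFn_add k.1 l.1, k1, l1] with y h1 h2 h3
    rw [Prod.fst_add, h1, Pi.add_apply, h2, h3]
  · intro v hv hve
    have key : ∀ w ∈ valueSpace x, kernelForm κ w v =
        (starRingEnd ℂ) w.2.2.1 * v.2.2.1 + (starRingEnd ℂ) w.2.2.2 * v.2.2.2 := fun w hw => by
      have h1 := hve w hw
      rw [wellForm_eq κ] at h1
      linear_combination h1
    -- With p, q the values at x, -x, testing with the kernel k gives 2κp = Eq + p; since 2κ = 1 +
    -- E, this forces p = q.
    have hpq : v.2.2.2 = v.2.2.1 := by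
      have h1 := key k hk
      rw [(h v hv).1, k2, hκC] at h1
      simp only [Complex.conj_ofReal, map_one] at h1
      have hE0 : (E : ℂ) ≠ 0 := by exact_mod_cast hE.ne'
      exact mul_left_cancel₀ hE0 (by linear_combination h1)
    set d := (2 * κ : ℂ) • v - v.2.2.2 • k - v.2.2.1 • l with hd
    have hdV : d ∈ valueSpace x := (valueSpace x).sub_mem ((valueSpace x).sub_mem
      ((valueSpace x).smul_mem _ hv) ((valueSpace x).smul_mem _ hk)) ((valueSpace x).smul_mem _ hl)
    have hd0 : kernelForm κ d d = 0 := by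
      conv_lhs => rw [hd]
      rw [← hd, kernelForm_comb, key d hdV, (hright d hdV).1, (hright d hdV).2]; ring
    have hd1 : d.1 = 0 := by
      have h1 := kernelForm_self_re κ d
      rw [hd0, Complex.zero_re] at h1
      have h2 : 0 < κ ^ 2 := by positivity
      have h3 : ‖d.1‖ ^ 2 = 0 := by nlinarith [sq_nonneg ‖d.2.1‖, sq_nonneg ‖d.1‖]
      exact norm_eq_zero.1 (pow_eq_zero_iff two_ne_zero |>.1 h3)
    refine ⟨(2 * κ : ℂ)⁻¹ * v.2.2.1, ?_⟩
    have h2κ : (2 * κ : ℂ) ≠ 0 := by exact_mod_cast (by positivity : 2 * κ ≠ 0)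
    have h1 : (2 * κ : ℂ) • v.1 = v.2.2.1 • (k + l).1 := by
      rw [hd, hpq] at hd1
      simp only [Prod.fst_sub, Prod.smul_fst] at hd1
      rw [sub_sub, sub_eq_zero] at hd1
      rw [hd1, Prod.fst_add, smul_add]
    rw [mul_smul, ← h1, smul_smul, inv_mul_cancel₀ h2κ, one_smul]
  · intro g hg hgU
    set U := k + l with hU
    -- This c makes the values of g - cU at ±x opposite, so the bound -1/4 applies to g - cU. As g
    -- is orthogonal to U, energy and norm both split, and the part along U has the right sign
    -- because κ² ≥ 1/4.
    set c : ℂ := (g.2.2.1 + g.2.2.2) / (4 * κ) with hc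
    have h4κ : (4 * κ : ℂ) ≠ 0 := by exact_mod_cast (by positivity : 4 * κ ≠ 0)
    set w := g - c • U with hw
    have hwV : w ∈ valueSpace x := (valueSpace x).sub_mem hg ((valueSpace x).smul_mem _ hUV)
    have hodd : w.2.2.1 = -w.2.2.2 := by
      simp only [hw, Prod.snd_sub, Prod.smul_snd, Prod.fst_sub, Prod.smul_fst, smul_eq_mul, hU1, hU2]
      have : c * (4 * κ) = g.2.2.1 + g.2.2.2 := by rw [hc, div_mul_cancel₀ _ h4κ]
      linear_combination -this
    have h1 := wellForm_lower_bound_of_odd hx hwV hodd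
    have hUg : (inner ℂ U.1 g.1 : ℂ) = 0 := by rw [← inner_conj_symm, hgU, map_zero]
    have e1 : wellForm g U = 0 := by rw [heig g hg, hgU, mul_zero]
    have e2 : wellForm U g = 0 := by rw [← wellForm_conj, e1, map_zero]
    have e3 : wellForm U U = ((-κ ^ 2 * ‖U.1‖ ^ 2 : ℝ) : ℂ) := by
      rw [heig U hUV, inner_self_eq_ofReal]; push_cast; ring
    have e4 : wellForm w w = wellForm g g + ((‖c‖ ^ 2 * (-κ ^ 2 * ‖U.1‖ ^ 2) : ℝ) : ℂ) := by
      have a1 : wellForm w g = wellForm g g := by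
        rw [← wellForm_conj, hw, wellForm_sub_right, wellForm_smul_right, e1, mul_zero, sub_zero,
          wellForm_conj]
      have a2 : wellForm w U = -((starRingEnd ℂ) c * wellForm U U) := by
        rw [← wellForm_conj, hw, wellForm_sub_right, wellForm_smul_right, e2, zero_sub, map_neg,
          map_mul, wellForm_conj]
      conv_lhs => rw [hw]
      rw [← hw, wellForm_sub_right, wellForm_smul_right, a1, a2, e3]
      have : c * (starRingEnd ℂ) c = ((‖c‖ ^ 2 : ℝ) : ℂ) := by
        rw [Complex.mul_conj, Complex.normSq_eq_norm_sq]
      push_cast at this ⊢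
      linear_combination (-(κ : ℂ) ^ 2 * (‖U.1‖ : ℂ) ^ 2) * this
    have e5 : ‖w.1‖ ^ 2 = ‖g.1‖ ^ 2 + ‖c‖ ^ 2 * ‖U.1‖ ^ 2 := by
      rw [hw, Prod.fst_sub, Prod.smul_fst, @norm_sub_sq ℂ, inner_smul_right, hgU, norm_smul, mul_pow]
      simp
    rw [e4, Complex.add_re, Complex.ofReal_re, e5] at h1
    have h2 : 0 ≤ ‖c‖ ^ 2 * ‖U.1‖ ^ 2 := by positivity
    have h3 : 1 / 4 ≤ κ ^ 2 := by nlinarith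
    nlinarith
  · filter_upwards [Lp.coeFn_add k.2.1 l.2.1, k3, l3, compl_mem_ae_iff.2 (measure_singleton x),
      compl_mem_ae_iff.2 (measure_singleton (-x))] with y h1 h2 h3 h4 h5
    have hd : ∀ a, y ≠ a → DifferentiableAt ℝ (kernelC κ a) y := fun a ha => by
      rcases lt_or_gt_of_ne ha with h | h
      · exact (hasDerivAt_kernelC_of_lt h).differentiableAt
      · exact (hasDerivAt_kernelC_of_gt h).differentiableAt
    rw [Prod.snd_add, Prod.fst_add, h1, Pi.add_apply, h2, h3]
    exact (deriv_fun_add (hd _ h4) (hd _ h5)).symm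

end Well

/-! ### The implicit eigenvalue and Lipschitz dependence of the ground state on x -/

section GroundState

theorem exists_kappa {x : ℝ} (hx : 0 ≤ x) :
    ∃ κ : ℝ, 1 + Real.exp (-(2 * κ * x)) = 2 * κ ∧ κ ≤ 1 := by
  have hc : ContinuousOn (fun κ : ℝ => 2 * κ - 1 - Real.exp (-(2 * κ * x))) (Set.Icc 0 1) := by
    fun_prop
  have h1 : Real.exp (-(2 * 1 * x)) ≤ 1 := Real.exp_le_one_iff.2 (by linarith)
  obtain ⟨κ, hκ, h⟩ := intermediate_value_Icc (zero_le_one' ℝ) hc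
    (show (0 : ℝ) ∈ Set.Icc _ _ from ⟨by simp, by linarith⟩)
  exact ⟨κ, by simp only at h; linarith, hκ.2⟩

/-- The square root of minus the lowest eigenvalue of the double well. -/
noncomputable def kappa (x : ℝ) : ℝ := Classical.choose (exists_kappa (le_max_right x 0))

theorem kappa_eq (x : ℝ) : 1 + Real.exp (-(2 * kappa x * max x 0)) = 2 * kappa x :=
  (Classical.choose_spec (exists_kappa (le_max_right x 0))).1

theorem kappa_le_one (x : ℝ) : kappa x ≤ 1 :=
  (Classical.choose_spec (exists_kappa (le_max_right x 0))).2

theorem half_lt_kappa (x : ℝ) : 1 / 2 < kappa x := by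
  have := kappa_eq x
  have := Real.exp_pos (-(2 * kappa x * max x 0))
  linarith

theorem kappa_pos (x : ℝ) : 0 < kappa x := by have := half_lt_kappa x; linarith

/-- As x increases, κ does not increase and κ max(x, 0) does not decrease. Since t ↦ e^{-t} is
1-Lipschitz on [0, ∞), the equation 2κ = 1 + e^{-2κx} bounds the drop of κ by the increment of
max(x, 0). -/
theorem kappa_lipschitz_aux {a b : ℝ} (hab : a ≤ b) :
    kappa b ≤ kappa a ∧ kappa a - kappa b ≤ max b 0 - max a 0 := by
  have ha := kappa_eq a
  have hb := kappa_eq b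
  have h1 := kappa_pos a
  have h2 := kappa_pos b
  have h3 : max a 0 ≤ max b 0 := max_le_max_right 0 hab
  have h4 : 0 ≤ max a 0 := le_max_right _ _
  have hle : kappa b ≤ kappa a := by
    by_contra! h
    have : kappa a * max a 0 ≤ kappa b * max b 0 := mul_le_mul h.le h3 h4 h2.le
    have := Real.exp_le_exp.2 (show -(2 * kappa b * max b 0) ≤ -(2 * kappa a * max a 0) by linarith)
    linarith
  refine ⟨hle, ?_⟩
  have h5 : kappa a * max a 0 ≤ kappa b * max b 0 := by
    by_contra! h
    have := Real.exp_le_exp.2 (show -(2 * kappa a * max a 0) ≤ -(2 * kappa b * max b 0) by linarith)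
    have h6 : kappa a = kappa b := by linarith
    rw [h6] at h
    nlinarith
  have h6 := abs_exp_neg_sub_le (2 * kappa a * max a 0) (2 * kappa b * max b 0)
  have h7 : Real.exp (-min (2 * kappa a * max a 0) (2 * kappa b * max b 0)) ≤ 1 :=
    Real.exp_le_one_iff.2 (neg_nonpos.2 (le_min (by positivity) (by
      have := h4.trans h3; positivity)))
  have h8 : |2 * kappa a * max a 0 - 2 * kappa b * max b 0| =
      2 * kappa b * max b 0 - 2 * kappa a * max a 0 := by
    rw [abs_of_nonpos (by linarith)]; ring
  have h9 := le_abs_self (Real.exp (-(2 * kappa a * max a 0)) - Real.exp (-(2 * kappa b * max b 0)))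
  rw [h8] at h6
  have h10 := h6.trans (mul_le_of_le_one_right (by linarith) h7)
  have h11 := kappa_le_one b
  nlinarith

theorem abs_max_sub_le (a b : ℝ) : |max a 0 - max b 0| ≤ |a - b| := by
  have := abs_max_sub_max_le_abs a b 0
  simpa using this

theorem abs_kappa_sub_le (a b : ℝ) : |kappa a - kappa b| ≤ |a - b| := by
  wlog h : a ≤ b generalizing a b
  · rw [abs_sub_comm, abs_sub_comm a]; exact this b a (le_of_not_ge h)
  obtain ⟨h1, h2⟩ := kappa_lipschitz_aux h
  have h3 := le_abs_self (max b 0 - max a 0)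
  have h4 := abs_max_sub_le b a
  rw [abs_of_nonneg (by linarith), abs_sub_comm a]
  linarith

theorem kappa_antitone : Antitone kappa := fun _ _ h => (kappa_lipschitz_aux h).1

/-- Sum of two exponentials with rate `c`, centred at `±x`. -/
noncomputable def twoExp (c x y : ℝ) : ℝ := kernel c (max x 0) y + kernel c (-max x 0) y

theorem twoExp_pos (c x y : ℝ) : 0 < twoExp c x y := add_pos (kernel_pos _ _ _) (kernel_pos _ _ _)

@[fun_prop]
theorem continuous_twoExp (c x : ℝ) : Continuous (twoExp c x) := by unfold twoExp; fun_prop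

theorem twoExp_le_two {c : ℝ} (hc : 0 ≤ c) (x y : ℝ) : twoExp c x y ≤ 2 := by
  have := kernel_le_one hc (max x 0) y
  have := kernel_le_one hc (-max x 0) y
  unfold twoExp; linarith

theorem memLp_twoExp {c : ℝ} (hc : 0 < c) (x : ℝ) : MemLp (twoExp c x) 2 :=
  (memLp_kernel hc _).add (memLp_kernel hc _)

theorem integral_twoExp_sq_le {c : ℝ} (hc : 0 < c) (x : ℝ) : ∫ y, twoExp c x y ^ 2 ≤ 4 / c := by
  have h1 := integrable_kernel (show 0 < 2 * c by positivity) (max x 0)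
  have h2 := integrable_kernel (show 0 < 2 * c by positivity) (-max x 0)
  calc ∫ y, twoExp c x y ^ 2 ≤
      ∫ y, 2 * (kernel (2 * c) (max x 0) y + kernel (2 * c) (-max x 0) y) := by
        refine integral_mono (memLp_twoExp hc x).integrable_sq ((h1.add h2).const_mul 2) fun y => ?_
        simp only [twoExp, ← kernel_sq]
        nlinarith [sq_nonneg (kernel c (max x 0) y - kernel c (-max x 0) y)]
    _ = 4 / c := by
        rw [integral_const_mul, integral_add h1 h2, integral_kernel (by positivity),
          integral_kernel (by positivity)]
        field_simp; ring

/-- The unnormalized ground state. -/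
noncomputable def rawState (x y : ℝ) : ℝ := twoExp (kappa x) x y

/-- The norm of the unnormalized ground state. -/
noncomputable def rawNorm (x : ℝ) : ℝ := √(∫ y, rawState x y ^ 2)

theorem rawState_pos (x y : ℝ) : 0 < rawState x y := twoExp_pos _ _ _

@[fun_prop]
theorem continuous_rawState (x : ℝ) : Continuous (rawState x) := continuous_twoExp _ _

theorem memLp_rawState (x : ℝ) : MemLp (rawState x) 2 := memLp_twoExp (kappa_pos x) x

theorem one_le_integral_rawState_sq (x : ℝ) : 1 ≤ ∫ y, rawState x y ^ 2 := by
  have h0 : 0 < 2 * kappa x := by have := kappa_pos x; positivity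
  calc (1 : ℝ) ≤ 2 / (2 * kappa x) := by
        rw [le_div_iff₀ h0]; linarith [kappa_le_one x]
    _ = ∫ y, kernel (2 * kappa x) (max x 0) y := (integral_kernel h0 _).symm
    _ ≤ _ := by
        refine integral_mono (integrable_kernel h0 _) (memLp_rawState x).integrable_sq fun y => ?_
        simp only [← kernel_sq]
        have := kernel_pos (kappa x) (-max x 0) y
        gcongr
        · exact (kernel_pos _ _ _).le
        · unfold rawState twoExp; linarith

theorem one_le_rawNorm (x : ℝ) : 1 ≤ rawNorm x :=
  Real.one_le_sqrt.2 (one_le_integral_rawState_sq x)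

theorem rawNorm_sq (x : ℝ) : rawNorm x ^ 2 = ∫ y, rawState x y ^ 2 :=
  Real.sq_sqrt (zero_le_one.trans (one_le_integral_rawState_sq x))

/-- The normalized ground state; it is constant in `x` for `x ≤ 0`. -/
noncomputable def state (x y : ℝ) : ℝ := rawState x y / rawNorm x

theorem rawNorm_pos (x : ℝ) : 0 < rawNorm x := zero_lt_one.trans_le (one_le_rawNorm x)

theorem state_pos (x y : ℝ) : 0 < state x y := div_pos (rawState_pos x y) (rawNorm_pos x)

@[fun_prop]
theorem continuous_state (x : ℝ) : Continuous (state x) := (continuous_rawState x).div_const _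

theorem integral_state_sq (x : ℝ) : ∫ y, state x y ^ 2 = 1 := by
  simp_rw [state, div_pow]
  rw [integral_div, rawNorm_sq, div_self]
  have := one_le_integral_rawState_sq x
  linarith

theorem state_of_nonpos {x : ℝ} (hx : x ≤ 0) : state x = state 0 := by
  have h : max x 0 = max 0 0 := by simp [hx]
  have hk : kappa x = kappa 0 := by
    have h1 := kappa_eq x
    have h2 := kappa_eq 0
    rw [h] at h1
    simp at h1 h2
    linarith
  ext y
  simp only [state, rawNorm, rawState, twoExp, h, hk]

theorem kernel_anti {c c' : ℝ} (h : c ≤ c') (a y : ℝ) : kernel c' a y ≤ kernel c a y :=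
  Real.exp_le_exp.2 (neg_le_neg (mul_le_mul_of_nonneg_right h (abs_nonneg _)))

theorem twoExp_anti {c c' : ℝ} (h : c ≤ c') (x y : ℝ) : twoExp c' x y ≤ twoExp c x y :=
  add_le_add (kernel_anti h _ _) (kernel_anti h _ _)

theorem rawState_le (x y : ℝ) : rawState x y ≤ twoExp (1 / 4) x y :=
  twoExp_anti (by linarith [half_lt_kappa x]) x y

theorem state_le (x y : ℝ) : state x y ≤ twoExp (1 / 4) x y :=
  (div_le_self (rawState_pos x y).le (one_le_rawNorm x)).trans (rawState_le x y)

theorem memLp_state (x : ℝ) : MemLp (state x) 2 := by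
  have := (memLp_rawState x).const_mul (rawNorm x)⁻¹
  refine this.congr_norm (continuous_state x).aestronglyMeasurable (Eventually.of_forall fun y => ?_)
  rw [state, div_eq_inv_mul]

/-- The exponents differ by at most r(1 + |y - b|), while rates of at least 1/2 leave a decay of
order e^{-|y-b|/2}. Half of that decay absorbs the factor 1 + |y - b|, and rate 1/4 remains. -/
theorem kernel_sub_le {κ κ' a b r y : ℝ} (hκ : 1 / 2 ≤ κ) (hκ1 : κ ≤ 1) (hκ' : 1 / 2 ≤ κ')
    (hr : |κ - κ'| ≤ r) (hab : |a - b| ≤ r) (hr1 : r ≤ 1) :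
    |kernel κ a y - kernel κ' b y| ≤ 8 * r * kernel (1 / 4) b y := by
  have hr0 : 0 ≤ r := (abs_nonneg _).trans hab
  set ρ := |y - b| with hρ
  have hρ0 : 0 ≤ ρ := abs_nonneg _
  have h1 : |(|y - a|) - ρ| ≤ r := by
    refine (abs_abs_sub_abs_le _ _).trans ?_
    rw [sub_sub_sub_cancel_left, abs_sub_comm]; exact hab
  obtain ⟨h1a, h1b⟩ := abs_le.1 h1
  have hya := abs_nonneg (y - a)
  have h2 : |κ * |y - a| - κ' * ρ| ≤ r * (1 + ρ) := by
    rw [show κ * |y - a| - κ' * ρ = κ * (|y - a| - ρ) + (κ - κ') * ρ by ring]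
    refine (abs_add_le _ _).trans ?_
    rw [abs_mul, abs_mul, abs_of_nonneg (by linarith : 0 ≤ κ), abs_of_nonneg hρ0]
    have e1 : κ * |(|y - a|) - ρ| ≤ 1 * r := mul_le_mul hκ1 h1 (abs_nonneg _) zero_le_one
    have e2 := mul_le_mul_of_nonneg_right hr hρ0
    linarith
  have h3 : (ρ - 1) / 2 ≤ min (κ * |y - a|) (κ' * ρ) := by
    refine le_min ?_ ?_ <;> nlinarith
  have h4 : Real.exp (-min (κ * |y - a|) (κ' * ρ)) ≤
      2 * (Real.exp (-(1 / 4 * ρ)) * Real.exp (-(1 / 4 * ρ))) := by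
    have e1 : Real.exp (1 / 2) ≤ 2 := by
      have e2 : Real.exp (1 / 2) ^ 2 = Real.exp 1 := by
        rw [← Real.exp_nat_mul]; norm_num
      have e3 := Real.exp_one_lt_d9
      nlinarith [Real.exp_pos (1 / 2)]
    calc Real.exp (-min (κ * |y - a|) (κ' * ρ)) ≤
        Real.exp (1 / 2 + (-(1 / 4 * ρ) + -(1 / 4 * ρ))) := Real.exp_le_exp.2 (by linarith)
      _ = Real.exp (1 / 2) * (Real.exp (-(1 / 4 * ρ)) * Real.exp (-(1 / 4 * ρ))) := by
        rw [Real.exp_add, Real.exp_add]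
      _ ≤ _ := by gcongr
  have h5 : (1 + ρ) * Real.exp (-(1 / 4 * ρ)) ≤ 4 := by
    have e1 := Real.add_one_le_exp (1 / 4 * ρ)
    rw [Real.exp_neg, ← div_eq_mul_inv, div_le_iff₀ (Real.exp_pos _)]
    linarith
  have h6 := Real.exp_pos (-(1 / 4 * ρ))
  calc |kernel κ a y - kernel κ' b y| ≤
      |κ * |y - a| - κ' * ρ| * Real.exp (-min (κ * |y - a|) (κ' * ρ)) := abs_exp_neg_sub_le _ _
    _ ≤ r * (1 + ρ) * (2 * (Real.exp (-(1 / 4 * ρ)) * Real.exp (-(1 / 4 * ρ)))) := by gcongr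
    _ = 2 * r * ((1 + ρ) * Real.exp (-(1 / 4 * ρ))) * Real.exp (-(1 / 4 * ρ)) := by ring
    _ ≤ 2 * r * 4 * Real.exp (-(1 / 4 * ρ)) := by gcongr
    _ = 8 * r * kernel (1 / 4) b y := by rw [kernel]; ring

theorem abs_rawState_sub_le {t s : ℝ} (h : |t - s| ≤ 1) (y : ℝ) :
    |rawState t y - rawState s y| ≤ 8 * |t - s| * twoExp (1 / 4) s y := by
  have h1 := kernel_sub_le (y := y) (half_lt_kappa t).le (kappa_le_one t) (half_lt_kappa s).le
    (abs_kappa_sub_le t s) (abs_max_sub_le t s) h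
  have h2 := kernel_sub_le (y := y) (a := -max t 0) (b := -max s 0) (half_lt_kappa t).le
    (kappa_le_one t) (half_lt_kappa s).le (abs_kappa_sub_le t s) (by
      rw [neg_sub_neg, abs_sub_comm]; exact abs_max_sub_le t s) h
  unfold rawState
  rw [twoExp, twoExp, twoExp, add_sub_add_comm, mul_add]
  exact (abs_add_le _ _).trans (add_le_add h1 h2)

theorem norm_toLp_real {f : ℝ → ℝ} (hf : MemLp f 2) : ‖hf.toLp f‖ = √(∫ y, f y ^ 2) := by
  have h : ‖hf.toLp f‖ ^ 2 = ∫ y, f y ^ 2 := by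
    rw [← real_inner_self_eq_norm_sq, L2.inner_def]
    refine integral_congr_ae ?_
    filter_upwards [hf.coeFn_toLp] with y hy
    rw [hy]; simp [sq]
  rw [← h, Real.sqrt_sq (norm_nonneg _)]

/-- The constant is 8 · 4, where 4 bounds the L² norm of `twoExp (1 / 4) s`. -/
theorem abs_rawNorm_sub_le {t s : ℝ} (h : |t - s| ≤ 1) :
    |rawNorm t - rawNorm s| ≤ 32 * |t - s| := by
  rw [rawNorm, rawNorm, ← norm_toLp_real (memLp_rawState t), ← norm_toLp_real (memLp_rawState s)]
  refine (abs_norm_sub_norm_le _ _).trans ?_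
  rw [← MemLp.toLp_sub, norm_toLp_real ((memLp_rawState t).sub (memLp_rawState s))]
  have h1 := memLp_twoExp (show (0 : ℝ) < 1 / 4 by norm_num) s
  calc √(∫ y, (rawState t - rawState s) y ^ 2) ≤
      √(∫ y, (8 * |t - s|) ^ 2 * twoExp (1 / 4) s y ^ 2) := by
        refine Real.sqrt_le_sqrt (integral_mono ((memLp_rawState t).sub
          (memLp_rawState s)).integrable_sq (h1.integrable_sq.const_mul _) fun y => ?_)
        simp only [Pi.sub_apply]
        rw [← sq_abs, ← mul_pow]
        exact pow_le_pow_left₀ (abs_nonneg _) (abs_rawState_sub_le h y) 2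
    _ ≤ √((32 * |t - s|) ^ 2) := by
        refine Real.sqrt_le_sqrt ?_
        rw [integral_const_mul]
        have := integral_twoExp_sq_le (show (0 : ℝ) < 1 / 4 by norm_num) s
        have h2 : (0 : ℝ) ≤ (8 * |t - s|) ^ 2 := by positivity
        nlinarith
    _ = _ := Real.sqrt_sq (by positivity)

/-- This bound takes the place of a formula for ∂ₓu_x: it controls `dState`, hence M, and it
provides the majorants for differentiation under the integral. The constant 40 is 8 from the
unnormalized state plus 32 from its norm. -/
theorem abs_state_sub_le {t s : ℝ} (h : |t - s| ≤ 1) (y : ℝ) :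
    |state t y - state s y| ≤ 40 * |t - s| * twoExp (1 / 4) s y := by
  have ht := one_le_rawNorm t
  have hs := one_le_rawNorm s
  have ht0 := rawNorm_pos t
  have hs0 := rawNorm_pos s
  have hw := twoExp_pos (1 / 4) s y
  have e : state t y - state s y = (rawState t y - rawState s y) / rawNorm t +
      state s y * ((rawNorm s - rawNorm t) / rawNorm t) := by
    unfold state; field_simp; ring
  rw [e]
  refine (abs_add_le _ _).trans ?_
  have h1 : |(rawState t y - rawState s y) / rawNorm t| ≤ 8 * |t - s| * twoExp (1 / 4) s y := by
    rw [abs_div, abs_of_pos ht0]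
    exact (div_le_self (abs_nonneg _) ht).trans (abs_rawState_sub_le h y)
  have h2 : |state s y * ((rawNorm s - rawNorm t) / rawNorm t)| ≤
      twoExp (1 / 4) s y * (32 * |t - s|) := by
    rw [abs_mul, abs_of_pos (state_pos s y), abs_div, abs_of_pos ht0]
    refine mul_le_mul (state_le s y) ((div_le_self (abs_nonneg _) ht).trans ?_) (by positivity) hw.le
    rw [abs_sub_comm]; exact abs_rawNorm_sub_le h
  linarith

theorem state_le_two (x y : ℝ) : state x y ≤ 2 :=
  (state_le x y).trans (twoExp_le_two (by norm_num) x y)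

theorem abs_state_sub_le_global (t s y : ℝ) : |state t y - state s y| ≤ 80 * |t - s| := by
  by_cases h : |t - s| ≤ 1
  · refine (abs_state_sub_le h y).trans ?_
    have := twoExp_le_two (show (0 : ℝ) ≤ 1 / 4 by norm_num) s y
    nlinarith [abs_nonneg (t - s)]
  · push Not at h
    have h1 := state_le_two t y
    have h2 := state_le_two s y
    have h3 := state_pos t y
    have h4 := state_pos s y
    rw [abs_le]; constructor <;> linarith

theorem abs_state_sub_le_right (t y z : ℝ) : |state t y - state t z| ≤ 2 * |y - z| := by
  rw [state, state, ← sub_div, abs_div, abs_of_pos (rawNorm_pos t)]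
  refine (div_le_self (abs_nonneg _) (one_le_rawNorm t)).trans ?_
  rw [rawState, rawState, twoExp, twoExp, add_sub_add_comm]
  refine (abs_add_le _ _).trans ?_
  have h1 := abs_kernel_sub_le (kappa_pos t).le (max t 0) y z
  have h2 := abs_kernel_sub_le (kappa_pos t).le (-max t 0) y z
  have := kappa_le_one t
  nlinarith [abs_nonneg (y - z)]

/-- Joint Lipschitz continuity gives differentiability almost everywhere in the plane by
Rademacher's theorem, and makes the trial functions Lipschitz. -/
theorem state_lipschitz : LipschitzWith 82 fun z : ℝ × ℝ => state z.1 z.2 := by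
  refine LipschitzWith.of_dist_le_mul fun z w => ?_
  have h1 := abs_state_sub_le_global z.1 w.1 z.2
  have h2 := abs_state_sub_le_right w.1 z.2 w.2
  have h3 : |z.1 - w.1| ≤ dist z w := by
    rw [← Real.dist_eq]; exact le_max_left _ _
  have h4 : |z.2 - w.2| ≤ dist z w := by
    rw [← Real.dist_eq]; exact le_max_right _ _
  rw [Real.dist_eq]
  have h5 := abs_sub_le (state z.1 z.2) (state w.1 z.2) (state w.1 w.2)
  simp only [NNReal.coe_ofNat]
  linarith

end GroundState

/-! ### Identification of the ground state, and its derivative in x -/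

section GroundState

theorem kappa_eq_of_nonneg {x : ℝ} (hx : 0 ≤ x) :
    1 + Real.exp (-(2 * kappa x * x)) = 2 * kappa x := by
  have := kappa_eq x
  rwa [max_eq_left hx] at this

theorem rawState_eq {x : ℝ} (hx : 0 ≤ x) (y : ℝ) :
    kernelC (kappa x) x y + kernelC (kappa x) (-x) y = (rawState x y : ℂ) := by
  simp [kernelC, rawState, twoExp, max_eq_left hx]

theorem rawState_self {x : ℝ} (hx : 0 ≤ x) : rawState x x = 2 * kappa x := by
  rw [← kappa_eq_of_nonneg hx, rawState, twoExp, max_eq_left hx, kernel, kernel, sub_self, abs_zero,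
    mul_zero, neg_zero, Real.exp_zero, sub_neg_eq_add, abs_of_nonneg (by linarith)]
  ring_nf

theorem rawState_neg_self {x : ℝ} (hx : 0 ≤ x) : rawState x (-x) = 2 * kappa x := by
  rw [← kappa_eq_of_nonneg hx, rawState, twoExp, max_eq_left hx, kernel, kernel, sub_self, abs_zero,
    mul_zero, neg_zero, Real.exp_zero, abs_of_nonpos (by linarith)]
  ring_nf

theorem norm_eq_rawNorm {x : ℝ} {U : L2R} (hU : U =ᵐ[volume] fun y => (rawState x y : ℂ)) :
    ‖U‖ = rawNorm x := by
  have h : ((‖U‖ ^ 2 : ℝ) : ℂ) = ((∫ y, rawState x y ^ 2 : ℝ) : ℂ) := by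
    rw [← inner_self_eq_ofReal, L2.inner_def, ← integral_complex_ofReal]
    refine integral_congr_ae ?_
    filter_upwards [hU] with y hy
    rw [hy, RCLike.inner_apply, Complex.conj_ofReal]
    push_cast; ring
  rw [rawNorm, ← Complex.ofReal_inj.1 h, Real.sqrt_sq (norm_nonneg _)]

/-- The elements of the form domain that correspond to the ground state of the double well,
and the characterizations of the ground state. -/
theorem exists_state {x : ℝ} (hx : 0 ≤ x) :
    ∃ u ∈ valueSpace x, u.1 =ᵐ[volume] (fun y => (state x y : ℂ)) ∧ ‖u.1‖ = 1 ∧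
      (∀ w ∈ valueSpace x, wellForm w u = -(kappa x : ℂ) ^ 2 * inner ℂ w.1 u.1) ∧
      (∀ v ∈ valueSpace x,
        (∀ w ∈ valueSpace x, wellForm w v = -(kappa x : ℂ) ^ 2 * inner ℂ w.1 v.1) →
        ∃ c : ℂ, v.1 = c • u.1) ∧
      (∀ g ∈ valueSpace x, (inner ℂ g.1 u.1 : ℂ) = 0 →
        -(1 / 4) * ‖g.1‖ ^ 2 ≤ (wellForm g g).re) ∧
      u.2.1 =ᵐ[volume] deriv (fun y => (state x y : ℂ)) ∧ u.2.2.1 = state x (-x) ∧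
      u.2.2.2 = state x x := by
  obtain ⟨U, hU, hU1, h1, h2, h3, hU2, hU3, hU4⟩ := exists_ground (kappa_eq_of_nonneg hx) hx
  simp_rw [rawState_eq hx] at hU1 hU2
  have hN := rawNorm_pos x
  have hNC : (rawNorm x : ℂ) ≠ 0 := by exact_mod_cast hN.ne'
  have hnorm := norm_eq_rawNorm hU1
  refine ⟨(rawNorm x : ℂ)⁻¹ • U, (valueSpace x).smul_mem _ hU, ?_, ?_, fun w hw => ?_,
    fun v hv hve => ?_, fun g hg hgu => h3 g hg ?_, ?_, ?_, ?_⟩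
  · filter_upwards [Lp.coeFn_smul (rawNorm x : ℂ)⁻¹ U.1, hU1] with y e1 e2
    rw [Prod.smul_fst, e1, Pi.smul_apply, e2, state]
    push_cast
    rw [smul_eq_mul, div_eq_inv_mul]
  · rw [Prod.smul_fst, norm_smul, hnorm, norm_inv, Complex.norm_real, Real.norm_of_nonneg hN.le,
      inv_mul_cancel₀ hN.ne']
  · rw [wellForm_smul_right, h1 w hw, Prod.smul_fst, inner_smul_right]; ring
  · obtain ⟨c, hc⟩ := h2 v hv hve
    refine ⟨c * rawNorm x, ?_⟩
    rw [hc, Prod.smul_fst, smul_smul, mul_assoc, mul_inv_cancel₀ hNC, mul_one]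
  · rw [Prod.smul_fst, inner_smul_right, mul_eq_zero] at hgu
    exact hgu.resolve_left (inv_ne_zero hNC)
  · have hd : (fun y => (state x y : ℂ)) = fun y => (rawNorm x : ℂ)⁻¹ * (rawState x y : ℂ) := by
      ext y
      rw [state]; push_cast; rw [div_eq_inv_mul]
    rw [hd]
    filter_upwards [Lp.coeFn_smul (rawNorm x : ℂ)⁻¹ U.2.1, hU2] with y e1 e2
    rw [Prod.smul_snd, Prod.smul_fst, e1, Pi.smul_apply, e2, deriv_const_mul_field, smul_eq_mul]
  · rw [Prod.smul_snd, Prod.smul_snd, Prod.smul_fst, hU3, state, rawState_neg_self hx, smul_eq_mul,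
      div_eq_inv_mul]
    push_cast; rfl
  · rw [Prod.smul_snd, Prod.smul_snd, Prod.smul_snd, hU4, state, rawState_self hx, smul_eq_mul,
      div_eq_inv_mul]
    push_cast; rfl

theorem mem_wellOperator_iff {x : ℝ} {ψ : L2R} {t : ℝ} : (ψ, (t : ℂ) • ψ) ∈ wellOperator x ↔
    ∃ v ∈ valueSpace x, v.1 = ψ ∧ ∀ w ∈ valueSpace x, wellForm w v = t * inner ℂ w.1 v.1 := by
  simp only [wellOperator, formOperator, Set.mem_ofPred_eq, mem_valueSpace]
  constructor
  · rintro ⟨v, hv, rfl, h⟩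
    exact ⟨v, hv, rfl, fun w hw => by rw [h w hw, inner_smul_right]⟩
  · rintro ⟨v, hv, rfl, h⟩
    exact ⟨v, hv, rfl, fun w hw => by rw [h w hw, inner_smul_right]⟩

theorem mu1_eq {x : ℝ} (hx : 0 ≤ x) : mu1 x = -kappa x ^ 2 := by
  obtain ⟨u, hu, -, hn, he, -⟩ := exists_state hx
  refine IsLeast.csInf_eq ⟨?_, ?_⟩
  · rw [Set.mem_ofPred_eq, ne_eq, eigenspace, Submodule.span_eq_bot]
    intro h
    have h0 : u.1 = 0 := h u.1 (mem_wellOperator_iff.2 ⟨u, hu, rfl, fun w hw => by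
      rw [he w hw]; push_cast; ring⟩)
    rw [h0, norm_zero] at hn
    exact zero_ne_one hn
  · rintro t ht
    rw [Set.mem_ofPred_eq, ne_eq, eigenspace, Submodule.span_eq_bot] at ht
    push Not at ht
    obtain ⟨ψ, hψ, h0⟩ := ht
    obtain ⟨v, hv, rfl, hve⟩ := mem_wellOperator_iff.1 hψ
    have h1 := wellForm_lower_bound (kappa_eq_of_nonneg hx) hx hv
    rw [hve v hv, inner_self_eq_ofReal, ← Complex.ofReal_mul, Complex.ofReal_re] at h1
    have h2 : 0 < ‖v.1‖ ^ 2 := by have := norm_pos_iff.2 h0; positivity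
    exact le_of_mul_le_mul_right h1 h2

/-- The eigenspace is spanned by `state x`; unit norm leaves a phase and positivity makes it 1. So
the choice made in `groundState` has only one possible outcome. -/
theorem isGroundState_iff {x : ℝ} (hx : 0 ≤ x) {u : ℝ → ℝ} : IsGroundState x u ↔ u = state x := by
  obtain ⟨U, hU, hU1, hn, he, huniq, -⟩ := exists_state hx
  have hmu : (mu1 x : ℂ) = -(kappa x : ℂ) ^ 2 := by rw [mu1_eq hx]; push_cast; ring
  constructor
  · rintro ⟨hc, hpos, ψ, hψ, hψn, hψo⟩
    obtain ⟨v, hv, rfl, hve⟩ := mem_wellOperator_iff.1 hψo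
    obtain ⟨c, hc'⟩ := huniq v hv (fun w hw => by rw [hve w hw, hmu])
    have hcn : ‖c‖ = 1 := by
      have := hψn
      rw [hc', norm_smul, hn, mul_one] at this
      exact this
    have hae : ∀ᵐ y, (u y : ℂ) = c * state x y := by
      filter_upwards [hψ, Lp.coeFn_smul c U.1, hU1] with y e1 e2 e3
      rw [← e1, hc', e2, Pi.smul_apply, e3, smul_eq_mul]
    have hre : u =ᵐ[volume] fun y => c.re * state x y := by
      filter_upwards [hae] with y hy
      have := congrArg Complex.re hy
      rwa [Complex.ofReal_re, Complex.re_mul_ofReal] at this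
    have hall := (hc.ae_eq_iff_eq volume ((continuous_state x).const_mul c.re)).1 hre
    obtain ⟨y, hy⟩ := hae.exists
    have hs := state_pos x y
    have him : c.im = 0 := by
      have := congrArg Complex.im hy
      rw [Complex.ofReal_im, Complex.im_mul_ofReal] at this
      exact (mul_eq_zero.1 this.symm).resolve_right hs.ne'
    have hcpos : 0 < c.re := by
      have h1 := hpos y
      rw [hall] at h1
      exact pos_of_mul_pos_left h1 hs.le
    have hc1 : c.re = 1 := by
      have h1 : c = (c.re : ℂ) := Complex.ext (by simp) (by simp [him])
      rw [h1, Complex.norm_real, Real.norm_of_nonneg hcpos.le] at hcn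
      exact hcn
    rw [hall, hc1]; simp
  · rintro rfl
    refine ⟨continuous_state x, state_pos x, U.1, hU1, hn, mem_wellOperator_iff.2
      ⟨U, hU, rfl, fun w hw => by rw [he w hw, hmu]⟩⟩

theorem groundState_eq {x : ℝ} (hx : 0 ≤ x) : groundState x = state x :=
  (isGroundState_iff hx).1 (Classical.epsilon_spec ⟨_, (isGroundState_iff hx).2 rfl⟩)

/-- The derivative of the ground state with respect to the parameter. -/
noncomputable def dState (x y : ℝ) : ℝ := deriv (fun t => state t y) x

theorem R_eq {x : ℝ} (hx : 0 < x) : R x = ∫⁻ y : ℝ, ‖dState x y‖ₑ ^ 2 := by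
  unfold R dState
  congr 1; ext y
  have : (fun t => groundState t y) =ᶠ[𝓝 x] fun t => state t y := by
    filter_upwards [lt_mem_nhds hx] with t ht
    rw [groundState_eq ht.le]
  rw [this.deriv_eq]

/-- A local Lipschitz bound controls `deriv` even where the derivative does not exist, since its
value there is 0. -/
theorem abs_dState_le (x y : ℝ) : |dState x y| ≤ 40 * twoExp (1 / 4) x y := by
  rw [← Real.norm_eq_abs]
  refine norm_deriv_le_of_lip' (by have := twoExp_pos (1 / 4) x y; positivity) ?_
  filter_upwards [Metric.ball_mem_nhds x one_pos] with t ht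
  rw [Metric.mem_ball, Real.dist_eq] at ht
  have := abs_state_sub_le ht.le y
  rw [Real.norm_eq_abs, Real.norm_eq_abs]
  linarith

theorem dState_of_neg {x : ℝ} (hx : x < 0) (y : ℝ) : dState x y = 0 := by
  have : (fun t => state t y) =ᶠ[𝓝 x] fun _ => state 0 y := by
    filter_upwards [gt_mem_nhds hx] with t ht
    rw [state_of_nonpos ht.le]
  rw [dState, this.deriv_eq, deriv_const]

theorem measurable_deriv_of_continuous {f : ℝ → ℝ → ℝ} (hf : Continuous fun z : ℝ × ℝ => f z.1 z.2)
    (x : ℝ) : Measurable fun y => deriv (fun t => f t y) x := by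
  have h : Measurable fun p : ℝ × ℝ => deriv (fun t => f t p.1) p.2 :=
    measurable_deriv_with_param (f := fun y t => f t y) (hf.comp continuous_swap)
  exact h.comp (measurable_id.prodMk measurable_const)

theorem measurable_dState (x : ℝ) : Measurable (dState x) :=
  measurable_deriv_of_continuous state_lipschitz.continuous x

theorem memLp_dState (x : ℝ) : MemLp (dState x) 2 := by
  have h : MemLp (fun y => 40 * twoExp (1 / 4) x y) 2 :=
    (memLp_twoExp (show (0 : ℝ) < 1 / 4 by norm_num) x).const_mul 40
  exact MemLp.mono' (E := ℝ) (f := dState x) (g := fun y => 40 * twoExp (1 / 4) x y) h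
    (measurable_dState x).aestronglyMeasurable
    (ae_of_all _ fun y => (Real.norm_eq_abs (dState x y)).le.trans (abs_dState_le x y))

theorem R_eq_ofReal {x : ℝ} (hx : 0 < x) : R x = ENNReal.ofReal (∫ y, dState x y ^ 2) := by
  rw [R_eq hx, ofReal_integral_eq_lintegral_ofReal (memLp_dState x).integrable_sq
    (Eventually.of_forall fun y => sq_nonneg _)]
  congr 1; ext y
  rw [← ofReal_norm, ← ENNReal.ofReal_pow (norm_nonneg _), Real.norm_eq_abs, sq_abs]

/-- The bound is 40² · 16, where 16 bounds the integral of `twoExp (1 / 4) x y ^ 2` over y. -/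
theorem M_ne_top : M ≠ ⊤ := by
  refine ne_top_of_le_ne_top (b := ENNReal.ofReal 25600) ENNReal.ofReal_ne_top ?_
  refine iSup₂_le fun x hx => ?_
  rw [R_eq_ofReal hx]
  refine ENNReal.ofReal_le_ofReal ?_
  calc ∫ y, dState x y ^ 2 ≤ ∫ y, 1600 * twoExp (1 / 4) x y ^ 2 := by
        refine integral_mono (memLp_dState x).integrable_sq
          ((memLp_twoExp (by norm_num) x).integrable_sq.const_mul _) fun y => ?_
        have h1 := abs_dState_le x y
        have h2 := pow_le_pow_left₀ (abs_nonneg _) h1 2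
        rw [sq_abs, mul_pow] at h2
        norm_num at h2 ⊢
        exact h2
    _ ≤ 25600 := by
        rw [integral_const_mul]
        have := integral_twoExp_sq_le (show (0 : ℝ) < 1 / 4 by norm_num) x
        linarith

theorem integral_dState_sq_le {x : ℝ} (hx : 0 < x) : ∫ y, dState x y ^ 2 ≤ M.toReal := by
  have h1 : R x ≤ M := le_iSup₂_of_le x hx le_rfl
  rw [R_eq_ofReal hx] at h1
  rw [← ENNReal.toReal_ofReal (integral_nonneg fun y => sq_nonneg (dState x y))]
  exact ENNReal.toReal_mono M_ne_top h1

theorem ae_differentiableAt_state :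
    ∀ᵐ x : ℝ, ∀ᵐ y : ℝ, DifferentiableAt ℝ (fun z : ℝ × ℝ => state z.1 z.2) (x, y) := by
  have h := state_lipschitz.ae_differentiableAt (μ := (volume : Measure (ℝ × ℝ)))
  rw [Measure.volume_eq_prod] at h
  exact Measure.ae_ae_of_ae_prod h

theorem hasDerivAt_state_of_differentiableAt {x y : ℝ}
    (h : DifferentiableAt ℝ (fun z : ℝ × ℝ => state z.1 z.2) (x, y)) :
    HasDerivAt (fun t => state t y) (dState x y) x := by
  have : DifferentiableAt ℝ (fun t => state t y) x :=
    DifferentiableAt.comp (g := fun z : ℝ × ℝ => state z.1 z.2) (f := fun t => (t, y)) x h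
      (by fun_prop)
  exact this.hasDerivAt

theorem abs_sub_le_of_mem_ball {x t s : ℝ} (ht : t ∈ Metric.ball x (1 / 2))
    (hs : s ∈ Metric.ball x (1 / 2)) : |t - s| ≤ 1 := by
  rw [Metric.mem_ball] at ht hs
  rw [← Real.dist_eq]
  have := dist_triangle_right t s x
  linarith

theorem twoExp_le_of_abs_sub_le {t s : ℝ} (h : |t - s| ≤ 1) (y : ℝ) :
    twoExp (1 / 4) t y ≤ 2 * twoExp (1 / 4) s y := by
  have key : ∀ a b : ℝ, |a - b| ≤ 1 → kernel (1 / 4) a y ≤ 2 * kernel (1 / 4) b y := by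
    intro a b hab
    have e1 : Real.exp (1 / 4) ≤ 2 := by
      have e2 : Real.exp (1 / 4) ^ 4 = Real.exp 1 := by
        rw [← Real.exp_nat_mul]; norm_num
      have e3 := Real.exp_one_lt_d9
      by_contra! h
      have : (2 : ℝ) ^ 4 < Real.exp (1 / 4) ^ 4 := pow_lt_pow_left₀ h (by norm_num) (by norm_num)
      linarith
    have e4 : |y - b| ≤ |y - a| + 1 := (abs_sub_le y a b).trans (by linarith)
    calc kernel (1 / 4) a y ≤ Real.exp (1 / 4 + -(1 / 4 * |y - b|)) :=
          Real.exp_le_exp.2 (by linarith)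
      _ = Real.exp (1 / 4) * kernel (1 / 4) b y := by rw [Real.exp_add, kernel]
      _ ≤ _ := mul_le_mul_of_nonneg_right e1 (kernel_pos _ _ _).le
  have h1 := (abs_max_sub_le t s).trans h
  have h2 := key _ _ h1
  have h3 := key (-max t 0) (-max s 0) (by rwa [neg_sub_neg, abs_sub_comm])
  unfold twoExp; linarith

/-- Differentiation of integrals against the ground state. -/
theorem hasDerivAt_integral_state_mul {x : ℝ} {g : ℝ → ℝ → ℂ} {g' : ℝ → ℂ} {G : ℝ → ℝ}
    (hx : ∀ᵐ y : ℝ, DifferentiableAt ℝ (fun z : ℝ × ℝ => state z.1 z.2) (x, y))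
    (hg : ∀ t, AEStronglyMeasurable (g t) volume) (hg' : AEStronglyMeasurable g' volume)
    (hG : MemLp G 2)
    (hb : ∀ t ∈ Metric.ball x (1 / 2), ∀ y, ‖g t y‖ ≤ G y)
    (hl : ∀ t ∈ Metric.ball x (1 / 2), ∀ s ∈ Metric.ball x (1 / 2), ∀ y,
      ‖g t y - g s y‖ ≤ |t - s| * G y)
    (hd : ∀ᵐ y, HasDerivAt (fun t => g t y) (g' y) x) :
    HasDerivAt (fun t => ∫ y, (state t y : ℂ) * g t y)
      (∫ y, ((dState x y : ℂ) * g x y + (state x y : ℂ) * g' y)) x := by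
  have hw : MemLp (twoExp (1 / 4) x) 2 := memLp_twoExp (by norm_num) x
  have hint : Integrable (fun y => 162 * (twoExp (1 / 4) x y * G y)) :=
    (hw.integrable_mul hG).const_mul _
  have hx0 : x ∈ Metric.ball x (1 / 2) := Metric.mem_ball_self (by norm_num)
  have hm : ∀ t, AEStronglyMeasurable (fun y => (state t y : ℂ) * g t y) volume := fun t =>
    (Complex.continuous_ofReal.comp (continuous_state t)).aestronglyMeasurable.mul (hg t)
  have hG0 : ∀ y, 0 ≤ G y := fun y => (norm_nonneg _).trans (hb x hx0 y)
  refine (hasDerivAt_integral_of_dominated_loc_of_lip (𝕜 := ℝ)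
    (F := fun t y => (state t y : ℂ) * g t y)
    (F' := fun y => (dState x y : ℂ) * g x y + (state x y : ℂ) * g' y)
    (bound := fun y => 162 * (twoExp (1 / 4) x y * G y)) (s := Metric.ball x (1 / 2))
    (Metric.ball_mem_nhds x (show (0 : ℝ) < 1 / 2 by norm_num)) (Eventually.of_forall hm) ?_ ?_ ?_ hint ?_).2
  · refine hint.mono' (hm x) (Eventually.of_forall fun y => ?_)
    rw [norm_mul, Complex.norm_real, Real.norm_of_nonneg (state_pos x y).le]
    have h1 := mul_le_mul (state_le x y) (hb x hx0 y) (norm_nonneg _) (twoExp_pos _ _ _).le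
    have h2 := mul_nonneg (twoExp_pos (1 / 4) x y).le (hG0 y)
    linarith
  · refine AEStronglyMeasurable.add ?_ ?_
    · exact (Complex.measurable_ofReal.comp (measurable_dState x)).aestronglyMeasurable.mul (hg x)
    · exact (Complex.continuous_ofReal.comp (continuous_state x)).aestronglyMeasurable.mul hg'
  · refine Eventually.of_forall fun y => LipschitzOnWith.of_dist_le_mul fun t ht s hs => ?_
    have hw0 := twoExp_pos (1 / 4) x y
    have hGy := hG0 y
    rw [Real.coe_nnabs, abs_of_nonneg (by positivity), dist_eq_norm, Real.dist_eq,
      show (state t y : ℂ) * g t y - state s y * g s y =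
        ((state t y - state s y : ℝ) : ℂ) * g t y + (state s y : ℂ) * (g t y - g s y) by
        push_cast; ring]
    have h1 := abs_state_sub_le (abs_sub_le_of_mem_ball ht hs) y
    have h2 := twoExp_le_of_abs_sub_le (abs_sub_le_of_mem_ball hs hx0) y
    have h3 := state_le s y
    refine (norm_add_le _ _).trans ?_
    rw [norm_mul, norm_mul, Complex.norm_real, Complex.norm_real, Real.norm_eq_abs,
      Real.norm_of_nonneg (state_pos s y).le]
    have h4 : |state t y - state s y| * ‖g t y‖ ≤ (80 * |t - s| * twoExp (1 / 4) x y) * G y := by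
      refine mul_le_mul (h1.trans ?_) (hb t ht y) (norm_nonneg _) (by positivity)
      nlinarith [abs_nonneg (t - s)]
    have h5 : state s y * ‖g t y - g s y‖ ≤ (2 * twoExp (1 / 4) x y) * (|t - s| * G y) :=
      mul_le_mul (h3.trans h2) (hl t ht s hs y) (norm_nonneg _) (by positivity)
    have h6 : 0 ≤ twoExp (1 / 4) x y * G y * |t - s| := by positivity
    linarith
  · filter_upwards [hx, hd] with y h1 h2
    exact (hasDerivAt_state_of_differentiableAt h1).ofReal_comp.fun_mul h2

/-- The normalization of the ground state implies that `∂ₓ u_x` is orthogonal to `u_x`. -/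
theorem integral_dState_mul_state {x : ℝ}
    (hx : ∀ᵐ y : ℝ, DifferentiableAt ℝ (fun z : ℝ × ℝ => state z.1 z.2) (x, y)) :
    ∫ y, dState x y * state x y = 0 := by
  have hw : MemLp (fun y => 80 * twoExp (1 / 4) x y) 2 :=
    (memLp_twoExp (by norm_num) x).const_mul 80
  have hx0 : x ∈ Metric.ball x (1 / 2) := Metric.mem_ball_self (by norm_num)
  have h := hasDerivAt_integral_state_mul (x := x) (g := fun t y => (state t y : ℂ))
    (g' := fun y => (dState x y : ℂ)) hx
    (fun t => (Complex.continuous_ofReal.comp (continuous_state t)).aestronglyMeasurable)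
    (Complex.measurable_ofReal.comp (measurable_dState x)).aestronglyMeasurable hw
    (fun t ht y => by
      have h1 := state_le t y
      have h2 := twoExp_le_of_abs_sub_le (abs_sub_le_of_mem_ball ht hx0) y
      have h3 := twoExp_pos (1 / 4) x y
      rw [Complex.norm_real, Real.norm_of_nonneg (state_pos t y).le]
      linarith)
    (fun t ht s hs y => by
      have h1 := abs_state_sub_le (abs_sub_le_of_mem_ball ht hs) y
      have h2 := twoExp_le_of_abs_sub_le (abs_sub_le_of_mem_ball hs hx0) y
      rw [← Complex.ofReal_sub, Complex.norm_real, Real.norm_eq_abs]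
      refine h1.trans ?_
      nlinarith [abs_nonneg (t - s)])
    (by
      filter_upwards [hx] with y hy
      exact (hasDerivAt_state_of_differentiableAt hy).ofReal_comp)
  have hconst : (fun t => ∫ y, (state t y : ℂ) * state t y) = fun _ => 1 := by
    ext t
    have : ∀ y, (state t y : ℂ) * state t y = ((state t y ^ 2 : ℝ) : ℂ) := fun y => by
      push_cast; ring
    simp_rw [this]
    rw [integral_complex_ofReal, integral_state_sq]; simp
  rw [hconst] at h
  have h1 := h.unique (hasDerivAt_const x (1 : ℂ))
  have h2 : ∀ y, (dState x y : ℂ) * state x y + state x y * dState x y =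
      ((2 * (dState x y * state x y) : ℝ) : ℂ) := fun y => by push_cast; ring
  simp_rw [h2] at h1
  rw [integral_complex_ofReal, integral_const_mul] at h1
  have h3 : 2 * ∫ y, dState x y * state x y = 0 := by exact_mod_cast h1
  linarith

end GroundState

/-! ### Energy of vertical slices -/

section Slice

theorem norm_sq_eq_integral {X : Type*} [MeasurableSpace X] {μ : Measure X} {f : Lp ℂ 2 μ}
    {φ : X → ℂ} (h : f =ᵐ[μ] φ) : ‖f‖ ^ 2 = ∫ x, ‖φ x‖ ^ 2 ∂μ := by
  have h1 : ((‖f‖ ^ 2 : ℝ) : ℂ) = ((∫ x, ‖φ x‖ ^ 2 ∂μ : ℝ) : ℂ) := by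
    rw [← inner_self_eq_ofReal, L2.inner_def, ← integral_complex_ofReal]
    refine integral_congr_ae ?_
    filter_upwards [h] with x hx
    rw [hx, inner_self_eq_ofReal]
  exact Complex.ofReal_inj.1 h1

theorem inner_eq_integral_ofReal {u v : L2R} {r : ℝ → ℝ} {ψ : ℝ → ℂ}
    (hu : u =ᵐ[volume] fun y => (r y : ℂ)) (hv : v =ᵐ[volume] ψ) :
    (inner ℂ u v : ℂ) = ∫ y, (r y : ℂ) * ψ y := by
  rw [L2.inner_def]
  refine integral_congr_ae ?_
  filter_upwards [hu, hv] with y h1 h2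
  rw [h1, h2, RCLike.inner_apply, Complex.conj_ofReal, mul_comm]

/-- The component of a test function along the ground state has a norm at most that of the
function. -/
theorem norm_integral_state_mul_le {φ : ℝ → ℂ} (hφ : IsTest φ) (x : ℝ) :
    ‖∫ y, (state x y : ℂ) * φ y‖ ^ 2 ≤ ∫ y, ‖φ y‖ ^ 2 := by
  have h1 : MemLp (fun y => (state x y : ℂ)) 2 := (memLp_state x).ofReal
  have h2 := hφ.memLp (μ := volume)
  rw [← inner_eq_integral_ofReal h1.coeFn_toLp h2.coeFn_toLp, ← norm_sq_eq_integral h2.coeFn_toLp]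
  have h3 : ‖h1.toLp _‖ = 1 := by
    have := norm_sq_eq_integral h1.coeFn_toLp
    simp_rw [Complex.norm_real, Real.norm_eq_abs, sq_abs, integral_state_sq] at this
    exact (pow_eq_one_iff_of_nonneg (norm_nonneg _) two_ne_zero).1 this
  have := norm_inner_le_norm (𝕜 := ℂ) (h1.toLp _) (h2.toLp φ)
  rw [h3, one_mul] at this
  exact pow_le_pow_left₀ (norm_nonneg _) this 2

theorem wellForm_self_re_eq_integral {x : ℝ} {v : L2R × (L2R × ℂ × ℂ)} {φ : ℝ → ℂ}
    (h2 : v.2.1 =ᵐ[volume] deriv φ) (h3 : v.2.2.1 = φ (-x)) (h4 : v.2.2.2 = φ x) :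
    (wellForm v v).re = (∫ y, ‖deriv φ y‖ ^ 2) - ‖φ (-x)‖ ^ 2 - ‖φ x‖ ^ 2 := by
  rw [wellForm, inner_self_eq_ofReal, inner_self_eq_ofReal, inner_self_eq_ofReal, Complex.sub_re,
    Complex.sub_re, Complex.ofReal_re, Complex.ofReal_re, Complex.ofReal_re, h3, h4,
    norm_sq_eq_integral h2]

/-- The lower bound of the double well that separates the component along the ground state. -/
theorem slice_lower_bound {x : ℝ} (hx : 0 ≤ x) {φ : ℝ → ℂ} (hφ : IsTest φ) :
    mu1 x * ‖∫ y, (state x y : ℂ) * φ y‖ ^ 2 -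
      1 / 4 * ((∫ y, ‖φ y‖ ^ 2) - ‖∫ y, (state x y : ℂ) * φ y‖ ^ 2) ≤
    (∫ y, ‖deriv φ y‖ ^ 2) - ‖φ (-x)‖ ^ 2 - ‖φ x‖ ^ 2 := by
  obtain ⟨u, hu, hu1, hn, he, -, hg, -⟩ := exists_state hx
  obtain ⟨v, hv, h1, h2, h3, h4⟩ := hφ.isH1Values x
  rw [← wellForm_self_re_eq_integral h2 h3 h4, ← norm_sq_eq_integral h1,
    ← inner_eq_integral_ofReal hu1 h1, mu1_eq hx]
  set c : ℂ := inner ℂ u.1 v.1 with hc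
  have huu : (inner ℂ u.1 u.1 : ℂ) = 1 := by rw [inner_self_eq_ofReal, hn]; norm_num
  have hvu : (inner ℂ v.1 u.1 : ℂ) = (starRingEnd ℂ) c := by rw [hc, inner_conj_symm]
  have hgu : (inner ℂ (v - c • u).1 u.1 : ℂ) = 0 := by
    rw [Prod.fst_sub, Prod.smul_fst, inner_sub_left, inner_smul_left, huu, hvu]; ring
  -- The remainder v - cu is orthogonal to u, and the eigenvalue equation for u removes the cross
  -- terms of the form.
  have h5 := hg _ ((valueSpace x).sub_mem hv ((valueSpace x).smul_mem c hu)) hgu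
  have hcc : c * (starRingEnd ℂ) c = ((‖c‖ ^ 2 : ℝ) : ℂ) := by
    rw [Complex.mul_conj, Complex.normSq_eq_norm_sq]
  have h6 : wellForm (v - c • u) (v - c • u) =
      wellForm v v + ((kappa x ^ 2 * ‖c‖ ^ 2 : ℝ) : ℂ) := by
    have a1 : wellForm (v - c • u) u = 0 := by
      rw [he _ ((valueSpace x).sub_mem hv ((valueSpace x).smul_mem c hu)), hgu, mul_zero]
    have a2 : wellForm (v - c • u) v = wellForm v v -
        (starRingEnd ℂ) (c * (starRingEnd ℂ) (wellForm u v)) := by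
      rw [← wellForm_conj, wellForm_sub_right, wellForm_smul_right, map_sub, wellForm_conj,
        wellForm_conj u v]
    have a3 : (starRingEnd ℂ) (wellForm u v) = -(kappa x : ℂ) ^ 2 * (starRingEnd ℂ) c := by
      rw [wellForm_conj, he v hv, hvu]
    rw [wellForm_sub_right, wellForm_smul_right, a1, a2, a3,
      show c * (-(kappa x : ℂ) ^ 2 * (starRingEnd ℂ) c) =
        ((-(kappa x ^ 2 * ‖c‖ ^ 2) : ℝ) : ℂ) by
          push_cast at hcc ⊢; linear_combination (-(kappa x : ℂ) ^ 2) * hcc, Complex.conj_ofReal]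
    push_cast; ring
  have h7 : ‖(v - c • u).1‖ ^ 2 = ‖v.1‖ ^ 2 - ‖c‖ ^ 2 := by
    have a1 : (inner ℂ (v - c • u).1 (v - c • u).1 : ℂ) = ((‖v.1‖ ^ 2 - ‖c‖ ^ 2 : ℝ) : ℂ) := by
      have : (inner ℂ (v - c • u).1 v.1 : ℂ) = inner ℂ v.1 v.1 - (starRingEnd ℂ) c * c := by
        rw [Prod.fst_sub, Prod.smul_fst, inner_sub_left, inner_smul_left]
      conv_lhs => rw [show (v - c • u).1 = v.1 - c • u.1 from rfl]
      rw [inner_sub_right, inner_smul_right]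
      change inner ℂ (v - c • u).1 v.1 - c * inner ℂ (v - c • u).1 u.1 = _
      rw [hgu, this, inner_self_eq_ofReal, mul_comm _ c, hcc]
      push_cast; ring
    rw [inner_self_eq_ofReal] at a1
    exact Complex.ofReal_inj.1 a1
  rw [h6, h7, Complex.add_re, Complex.ofReal_re] at h5
  linarith

theorem slice_state {x : ℝ} (hx : 0 ≤ x) :
    (∫ y, ‖deriv (fun y => (state x y : ℂ)) y‖ ^ 2) - state x (-x) ^ 2 - state x x ^ 2 = mu1 x := by
  obtain ⟨u, hu, hu1, hn, he, -, -, h2, h3, h4⟩ := exists_state hx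
  have h5 := wellForm_self_re_eq_integral (φ := fun y => (state x y : ℂ)) h2 h3 h4
  have h6 : (wellForm u u).re = mu1 x := by
    rw [he u hu, inner_self_eq_ofReal, hn, mu1_eq hx]
    have : -(kappa x : ℂ) ^ 2 * ((1 ^ 2 : ℝ) : ℂ) = ((-kappa x ^ 2 : ℝ) : ℂ) := by push_cast; ring
    rw [this, Complex.ofReal_re]
  rw [h6, Complex.norm_real, Complex.norm_real, Real.norm_eq_abs, Real.norm_eq_abs, sq_abs,
    sq_abs] at h5
  exact h5.symm

theorem kappa_zero : kappa 0 = 1 := by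
  have := kappa_eq 0
  rw [max_self, mul_zero, neg_zero, Real.exp_zero] at this
  linarith

theorem state_zero_zero : state 0 0 ^ 2 = 1 := by
  have h1 : rawState 0 0 = 2 := by rw [rawState_self le_rfl, kappa_zero]; norm_num
  have h2 : rawNorm 0 ^ 2 = 4 := by
    rw [rawNorm_sq]
    have : ∀ y, rawState 0 y ^ 2 = 4 * kernel 2 0 y := fun y => by
      have : rawState 0 y = 2 * kernel 1 0 y := by
        rw [rawState, twoExp, kappa_zero, max_self, neg_zero]; ring
      rw [this, mul_pow, kernel_sq]; norm_num
    simp_rw [this]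
    rw [integral_const_mul, integral_kernel (by norm_num)]; norm_num
  rw [state, div_pow, h1, h2]; norm_num

/-- The energy of the trial function at the left of the vertex. -/
theorem slice_state_of_neg {x : ℝ} (hx : x < 0) :
    ∫ y, ‖deriv (fun y => (state x y : ℂ)) y‖ ^ 2 = 1 := by
  -- At x = 0 both point interactions act at the origin with u₀(0)² = 1, and μ₁(0) = -1, so ∫|u₀'|²
  -- = 2 - 1. This is why the first potential is 1 on the negative axis.
  have h1 := slice_state (le_refl 0)
  rw [neg_zero, state_zero_zero, mu1_eq le_rfl, kappa_zero] at h1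
  rw [state_of_nonpos hx.le]
  linarith

theorem ae_norm_deriv_state_le (x : ℝ) :
    ∀ᵐ y, ‖deriv (fun y => (state x y : ℂ)) y‖ ≤ twoExp (1 / 4) x y := by
  set a := max x 0 with ha
  filter_upwards [compl_mem_ae_iff.2 (measure_singleton a),
      compl_mem_ae_iff.2 (measure_singleton (-a)), norm_deriv_kernelC_le (kappa_pos x).le a,
      norm_deriv_kernelC_le (kappa_pos x).le (-a)] with y h4 h5 h6 h7
  have hd : ∀ b, y ≠ b → DifferentiableAt ℝ (kernelC (kappa x) b) y := fun b hb => by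
    rcases lt_or_gt_of_ne hb with h | h
    · exact (hasDerivAt_kernelC_of_lt h).differentiableAt
    · exact (hasDerivAt_kernelC_of_gt h).differentiableAt
  have h1 : (fun y => (state x y : ℂ)) = fun y => (rawNorm x : ℂ)⁻¹ *
      (kernelC (kappa x) a y + kernelC (kappa x) (-a) y) := by
    ext y
    rw [state, rawState, twoExp, kernelC, kernelC]; push_cast; rw [div_eq_inv_mul]
  rw [h1, deriv_const_mul_field, deriv_fun_add (hd _ h4) (hd _ h5), norm_mul, norm_inv,
    Complex.norm_real, Real.norm_of_nonneg (rawNorm_pos x).le]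
  have h8 : kappa x * kernel (kappa x) a y + kappa x * kernel (kappa x) (-a) y ≤ rawState x y := by
    rw [← mul_add]
    exact mul_le_of_le_one_left (rawState_pos x y).le (kappa_le_one x)
  exact (mul_le_of_le_one_left (norm_nonneg _) (inv_le_one_of_one_le₀ (one_le_rawNorm x))).trans
    ((norm_add_le _ _).trans ((add_le_add h6 h7).trans (h8.trans (rawState_le x y))))

end Slice

/-! ### Closedness of the forms on test functions -/

section Forms

/-- The test functions, as elements `(φ, φ')`. -/
noncomputable def testLine : Submodule ℂ (L2R × L2R) where
  carrier := {p | ∃ φ : ℝ → ℂ, IsTest φ ∧ p.1 =ᵐ[volume] φ ∧ p.2 =ᵐ[volume] deriv φ}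
  zero_mem' := ⟨0, ⟨contDiff_const, HasCompactSupport.zero⟩, Lp.coeFn_zero _ _ _, by
    have : deriv (0 : ℝ → ℂ) = 0 := by ext; simp
    rw [this]; exact Lp.coeFn_zero _ _ _⟩
  add_mem' := by
    rintro p q ⟨φ, hφ, h1, h2⟩ ⟨χ, hχ, k1, k2⟩
    refine ⟨φ + χ, ⟨hφ.1.add hχ.1, hφ.2.add hχ.2⟩, (Lp.coeFn_add _ _).trans (h1.add k1), ?_⟩
    have : deriv (φ + χ) = deriv φ + deriv χ := by
      ext y
      exact deriv_add (hφ.1.differentiable (by simp) y) (hχ.1.differentiable (by simp) y)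
    rw [this]
    exact (Lp.coeFn_add _ _).trans (h2.add k2)
  smul_mem' := by
    rintro c p ⟨φ, hφ, h1, h2⟩
    refine ⟨c • φ, ⟨contDiff_const.smul hφ.1, hφ.2.smul_left (f := fun _ => c)⟩,
      (Lp.coeFn_smul _ _).trans (h1.const_smul c), ?_⟩
    have : deriv (c • φ) = c • deriv φ := by
      ext y
      exact deriv_const_smul c (hφ.1.differentiable (by simp) y)
    rw [this]
    exact (Lp.coeFn_smul _ _).trans (h2.const_smul c)

/-- The test functions in the plane, as elements `(φ, ∂ₓφ, ∂ᵧφ, s ↦ φ(|s|, s))`. -/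
noncomputable def testPlane : Submodule ℂ (L2R2 × (L2R2 × L2R2 × L2R)) where
  carrier := {p | ∃ φ : ℝ × ℝ → ℂ, IsTest φ ∧ p.1 =ᵐ[volume] φ ∧
    p.2.1 =ᵐ[volume] (fun z => fderiv ℝ φ z (1, 0)) ∧
    p.2.2.1 =ᵐ[volume] (fun z => fderiv ℝ φ z (0, 1)) ∧
    p.2.2.2 =ᵐ[volume] (fun s : ℝ => φ (|s|, s))}
  zero_mem' := ⟨0, ⟨contDiff_const, HasCompactSupport.zero⟩, Lp.coeFn_zero _ _ _, by
    have : ∀ v : ℝ × ℝ, (fun z => fderiv ℝ (0 : ℝ × ℝ → ℂ) z v) = 0 := fun v => by ext; simp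
    rw [this, this]
    exact ⟨Lp.coeFn_zero _ _ _, Lp.coeFn_zero _ _ _, Lp.coeFn_zero _ _ _⟩⟩
  add_mem' := by
    rintro p q ⟨φ, hφ, h1, h2, h3, h4⟩ ⟨χ, hχ, k1, k2, k3, k4⟩
    have : ∀ v : ℝ × ℝ, (fun z => fderiv ℝ (φ + χ) z v) =
        (fun z => fderiv ℝ φ z v) + fun z => fderiv ℝ χ z v := fun v => by
      ext z
      rw [fderiv_add (hφ.1.differentiable (by simp) z) (hχ.1.differentiable (by simp) z)]; rfl
    refine ⟨φ + χ, ⟨hφ.1.add hχ.1, hφ.2.add hχ.2⟩, (Lp.coeFn_add _ _).trans (h1.add k1), ?_, ?_,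
      (Lp.coeFn_add _ _).trans (h4.add k4)⟩
    · rw [this]; exact (Lp.coeFn_add _ _).trans (h2.add k2)
    · rw [this]; exact (Lp.coeFn_add _ _).trans (h3.add k3)
  smul_mem' := by
    rintro c p ⟨φ, hφ, h1, h2, h3, h4⟩
    have : ∀ v : ℝ × ℝ, (fun z => fderiv ℝ (c • φ) z v) = c • (fun z => fderiv ℝ φ z v) :=
      fun v => by
        ext z
        rw [fderiv_const_smul (hφ.1.differentiable (by simp) z)]; rfl
    refine ⟨c • φ, ⟨contDiff_const.smul hφ.1, hφ.2.smul_left (f := fun _ => c)⟩,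
      (Lp.coeFn_smul _ _).trans (h1.const_smul c), ?_, ?_,
      (Lp.coeFn_smul _ _).trans (h4.const_smul c)⟩
    · rw [this]; exact (Lp.coeFn_smul _ _).trans (h2.const_smul c)
    · rw [this]; exact (Lp.coeFn_smul _ _).trans (h3.const_smul c)

theorem integrable_mul_inner {W : ℝ → ℝ} (hW : Measurable W) (hW1 : ∀ x, |W x| ≤ 1) (w v : L2R) :
    Integrable fun x => (W x : ℂ) * inner ℂ (w x) (v x) := by
  refine (L2.integrable_inner (𝕜 := ℂ) w v).bdd_mul (c := 1)
    (Complex.measurable_ofReal.comp hW).aestronglyMeasurable (Eventually.of_forall fun x => ?_)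
  rw [Complex.norm_real]
  exact hW1 x

theorem norm_integral_mul_inner_le {W : ℝ → ℝ} (hW : Measurable W) (hW1 : ∀ x, |W x| ≤ 1)
    (w v : L2R) : ‖∫ x, (W x : ℂ) * inner ℂ (w x) (v x)‖ ≤ ‖w‖ * ‖v‖ := by
  have hb : ∀ x, ‖(W x : ℂ) * v x‖ ≤ ‖v x‖ := fun x => by
    rw [norm_mul, Complex.norm_real]
    exact mul_le_of_le_one_left (norm_nonneg _) (hW1 x)
  have hm : MemLp (fun x => (W x : ℂ) * v x) 2 := by
    refine (Lp.memLp v).mono ?_ (Eventually.of_forall hb)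
    exact (Complex.measurable_ofReal.comp hW).aestronglyMeasurable.mul
      (Lp.aestronglyMeasurable v)
  have h1 : (inner ℂ w (hm.toLp _) : ℂ) = ∫ x, (W x : ℂ) * inner ℂ (w x) (v x) := by
    rw [L2.inner_def]
    refine integral_congr_ae ?_
    filter_upwards [hm.coeFn_toLp] with x hx
    rw [hx, RCLike.inner_apply, RCLike.inner_apply]; ring
  have h2 : ‖hm.toLp _‖ ≤ ‖v‖ := by
    refine Lp.norm_le_norm_of_ae_le ?_
    filter_upwards [hm.coeFn_toLp] with x hx
    rw [hx]; exact hb x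
  rw [← h1]
  exact (norm_inner_le_norm _ _).trans (mul_le_mul_of_nonneg_left h2 (norm_nonneg _))

theorem schrodingerForm_self_re {h : ℝ} {W : ℝ → ℝ} {p : L2R × L2R} {f f' : ℝ → ℂ}
    (h1 : p.1 =ᵐ[volume] f) (h2 : p.2 =ᵐ[volume] f') :
    (schrodingerForm h W p p).re = h ^ 2 * (∫ x, ‖f' x‖ ^ 2) + ∫ x, W x * ‖f x‖ ^ 2 := by
  have e1 : (∫ x, (W x : ℂ) * inner ℂ (p.1 x) (p.1 x)) = ((∫ x, W x * ‖f x‖ ^ 2 : ℝ) : ℂ) := by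
    rw [← integral_complex_ofReal]
    refine integral_congr_ae ?_
    filter_upwards [h1] with x hx
    rw [hx, inner_self_eq_ofReal]; push_cast; rfl
  rw [schrodingerForm, e1, inner_self_eq_ofReal, norm_sq_eq_integral h2, Complex.add_re,
    Complex.ofReal_re, ← Complex.ofReal_pow, ← Complex.ofReal_mul, Complex.ofReal_re]

theorem norm_prod_sq_le {E F : Type*} [NormedAddCommGroup E] [NormedAddCommGroup F] (p : E × F) :
    ‖p‖ ^ 2 ≤ ‖p.1‖ ^ 2 + ‖p.2‖ ^ 2 := by
  rcases max_choice ‖p.1‖ ‖p.2‖ with h | h <;> rw [Prod.norm_def, h]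
  · exact le_add_of_nonneg_right (sq_nonneg _)
  · exact le_add_of_nonneg_left (sq_nonneg _)

theorem isClosedForm_schrodingerForm {h : ℝ} (hh : 0 < h) {W : ℝ → ℝ} (hW : Measurable W)
    (hW1 : ∀ x, |W x| ≤ 1) : IsClosedForm testLine (schrodingerForm h W) where
  add_right w v v' := by
    have : ∀ᵐ x, (W x : ℂ) * inner ℂ (w.1 x) ((v.1 + v'.1) x) =
        (W x : ℂ) * inner ℂ (w.1 x) (v.1 x) + (W x : ℂ) * inner ℂ (w.1 x) (v'.1 x) := by
      filter_upwards [Lp.coeFn_add v.1 v'.1] with x hx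
      rw [hx, Pi.add_apply, inner_add_right]; ring
    simp only [schrodingerForm, Prod.fst_add, Prod.snd_add, inner_add_right]
    rw [integral_congr_ae this, integral_add (integrable_mul_inner hW hW1 _ _)
      (integrable_mul_inner hW hW1 _ _)]
    ring
  smul_right w v z := by
    have : ∀ᵐ x, (W x : ℂ) * inner ℂ (w.1 x) ((z • v.1) x) =
        z * ((W x : ℂ) * inner ℂ (w.1 x) (v.1 x)) := by
      filter_upwards [Lp.coeFn_smul z v.1] with x hx
      rw [hx, Pi.smul_apply, inner_smul_right]; ring
    simp only [schrodingerForm, Prod.smul_fst, Prod.smul_snd, inner_smul_right]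
    rw [integral_congr_ae this, integral_const_mul]
    ring
  conj_symm w v := by
    rw [schrodingerForm, schrodingerForm, map_add, ← integral_conj]
    simp only [map_mul, map_pow, Complex.conj_ofReal, inner_conj_symm]
  bound := by
    refine ⟨h ^ 2 + 1, fun w v => ?_⟩
    have h1 := norm_integral_mul_inner_le hW hW1 w.1 v.1
    have h2 := norm_inner_le_norm (𝕜 := ℂ) w.2 v.2
    have h3 := mul_le_mul (norm_fst_le w) (norm_fst_le v) (norm_nonneg _) (norm_nonneg _)
    have h4 := mul_le_mul (norm_snd_le w) (norm_snd_le v) (norm_nonneg _) (norm_nonneg _)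
    refine (norm_add_le _ _).trans ?_
    rw [norm_mul, norm_pow, Complex.norm_real, Real.norm_of_nonneg hh.le]
    have h5 := mul_le_mul_of_nonneg_left (h2.trans h4) (sq_nonneg h)
    linarith
  coercive := by
    refine ⟨2, min (h ^ 2) 1, by positivity, fun v _ => ?_⟩
    have h1 := norm_integral_mul_inner_le hW hW1 v.1 v.1
    have h2 := neg_le_of_abs_le ((Complex.abs_re_le_norm _).trans h1)
    have h3 : ((h : ℂ) ^ 2 * inner ℂ v.2 v.2).re = h ^ 2 * ‖v.2‖ ^ 2 := by
      rw [inner_self_eq_ofReal, ← Complex.ofReal_pow, ← Complex.ofReal_mul, Complex.ofReal_re]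
    rw [schrodingerForm, Complex.add_re, h3]
    have h4 := mul_le_mul_of_nonneg_left (norm_prod_sq_le v)
      (show (0 : ℝ) ≤ min (h ^ 2) 1 by positivity)
    have h5 := mul_le_mul_of_nonneg_right (min_le_left (h ^ 2) 1) (sq_nonneg ‖v.2‖)
    have h6 := mul_le_mul_of_nonneg_right (min_le_right (h ^ 2) 1) (sq_nonneg ‖v.1‖)
    linarith

/-- The trace inequality on the line, with a small constant for the derivative. -/
theorem norm_sq_le_of_isTest {φ : ℝ → ℂ} (hφ : IsTest φ) {ε : ℝ} (hε : 0 < ε) (a : ℝ) :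
    ‖φ a‖ ^ 2 ≤ ε * (∫ x, ‖deriv φ x‖ ^ 2) + ε⁻¹ * ∫ x, ‖φ x‖ ^ 2 := by
  have hd : Differentiable ℝ φ := hφ.1.differentiable (by simp)
  have hn : ContDiff ℝ 1 fun x => ‖φ x‖ ^ 2 := (hφ.1.of_le (by simp)).norm_sq ℝ
  have hc : HasCompactSupport fun x => ‖φ x‖ ^ 2 :=
    hφ.2.comp_left (g := fun z : ℂ => ‖z‖ ^ 2) (by simp)
  have h1 := (hφ.memLp (μ := volume)).norm.integrable_sq
  have h2 := (hφ.deriv.memLp (μ := volume)).norm.integrable_sq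
  rw [← hc.integral_Iic_deriv_eq hn a]
  have h3 : ∀ x, ‖deriv (fun x => ‖φ x‖ ^ 2) x‖ ≤
      ε * ‖deriv φ x‖ ^ 2 + ε⁻¹ * ‖φ x‖ ^ 2 := fun x => by
    have e1 := (hd x).hasDerivAt.norm_sq
    rw [e1.deriv, norm_mul, Real.norm_ofNat]
    have e2 := norm_inner_le_norm (𝕜 := ℝ) (φ x) (deriv φ x)
    have e3 : 2 * (‖φ x‖ * ‖deriv φ x‖) ≤ ε * ‖deriv φ x‖ ^ 2 + ε⁻¹ * ‖φ x‖ ^ 2 := by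
      have : ε * ‖deriv φ x‖ ^ 2 + ε⁻¹ * ‖φ x‖ ^ 2 - 2 * (‖φ x‖ * ‖deriv φ x‖) =
          ε⁻¹ * (ε * ‖deriv φ x‖ - ‖φ x‖) ^ 2 := by field_simp; ring
      have := mul_nonneg (inv_nonneg.2 hε.le) (sq_nonneg (ε * ‖deriv φ x‖ - ‖φ x‖))
      linarith
    linarith
  have h4 : Integrable fun x => ε * ‖deriv φ x‖ ^ 2 + ε⁻¹ * ‖φ x‖ ^ 2 :=
    (h2.const_mul ε).add (h1.const_mul _)
  calc _ ≤ ∫ x in Set.Iic a, (ε * ‖deriv φ x‖ ^ 2 + ε⁻¹ * ‖φ x‖ ^ 2) :=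
        (le_abs_self _).trans (norm_integral_le_of_norm_le (f := deriv fun x => ‖φ x‖ ^ 2)
          h4.integrableOn (Eventually.of_forall h3))
    _ ≤ ∫ x, (ε * ‖deriv φ x‖ ^ 2 + ε⁻¹ * ‖φ x‖ ^ 2) :=
        setIntegral_le_integral h4 (Eventually.of_forall fun x => by positivity)
    _ = _ := by rw [integral_add (h2.const_mul ε) (h1.const_mul _), integral_const_mul,
        integral_const_mul]

theorem isTest_slice_left {φ : ℝ × ℝ → ℂ} (hφ : IsTest φ) (y : ℝ) : IsTest fun x => φ (x, y) := by
  refine ⟨hφ.1.comp (contDiff_id.prodMk contDiff_const), ?_⟩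
  refine HasCompactSupport.of_support_subset_isCompact (hφ.2.isCompact.image continuous_fst)
    fun x hx => ⟨(x, y), subset_closure hx, rfl⟩

theorem isTest_slice_right {φ : ℝ × ℝ → ℂ} (hφ : IsTest φ) (x : ℝ) : IsTest fun y => φ (x, y) := by
  refine ⟨hφ.1.comp (contDiff_const.prodMk contDiff_id), ?_⟩
  refine HasCompactSupport.of_support_subset_isCompact (hφ.2.isCompact.image continuous_snd)
    fun y hy => ⟨(x, y), subset_closure hy, rfl⟩

theorem hasDerivAt_slice_left {φ : ℝ × ℝ → ℂ} (hφ : IsTest φ) (x y : ℝ) :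
    HasDerivAt (fun t => φ (t, y)) (fderiv ℝ φ (x, y) (1, 0)) x :=
  ((hφ.1.differentiable (by simp) (x, y)).hasFDerivAt.comp_hasDerivAt x
    ((hasDerivAt_id x).prodMk (hasDerivAt_const x y)))

theorem hasDerivAt_slice_right {φ : ℝ × ℝ → ℂ} (hφ : IsTest φ) (x y : ℝ) :
    HasDerivAt (fun t => φ (x, t)) (fderiv ℝ φ (x, y) (0, 1)) y :=
  ((hφ.1.differentiable (by simp) (x, y)).hasFDerivAt.comp_hasDerivAt y
    ((hasDerivAt_const y x).prodMk (hasDerivAt_id y)))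

theorem integrable_norm_sq {φ : ℝ × ℝ → ℂ} (hφ : IsTest φ) :
    Integrable (fun z : ℝ × ℝ => ‖φ z‖ ^ 2) (volume.prod volume) :=
  (hφ.memLp (μ := volume)).norm.integrable_sq

theorem integral_norm_sq_eq_symm {φ : ℝ × ℝ → ℂ} (hφ : IsTest φ) :
    ∫ z, ‖φ z‖ ^ 2 = ∫ y, ∫ x, ‖φ (x, y)‖ ^ 2 :=
  integral_prod_symm _ (integrable_norm_sq hφ)

/-- The trace inequality on the broken line. -/
theorem integral_trace_sq_le {φ : ℝ × ℝ → ℂ} (hφ : IsTest φ) {ε : ℝ} (hε : 0 < ε) :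
    ∫ s : ℝ, ‖φ (|s|, s)‖ ^ 2 ≤
      ε * (∫ z, ‖fderiv ℝ φ z (1, 0)‖ ^ 2) + ε⁻¹ * ∫ z, ‖φ z‖ ^ 2 := by
  have hφ' := hφ.fderiv_apply (1, 0)
  rw [integral_norm_sq_eq_symm hφ, integral_norm_sq_eq_symm hφ', ← integral_const_mul,
    ← integral_const_mul, ← integral_add ((integrable_norm_sq hφ').integral_prod_right.const_mul _)
      ((integrable_norm_sq hφ).integral_prod_right.const_mul _)]
  refine integral_mono (memLp_trace hφ.1.continuous hφ.2).norm.integrable_sq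
    (((integrable_norm_sq hφ').integral_prod_right.const_mul _).add
      ((integrable_norm_sq hφ).integral_prod_right.const_mul _)) fun s => ?_
  -- The broken line is a graph over the y-axis, so horizontal slices suffice and only ∂ₓφ enters.
  have := norm_sq_le_of_isTest (isTest_slice_left hφ s) hε |s|
  simp_rw [(hasDerivAt_slice_left hφ _ s).deriv] at this
  exact this

theorem brokenForm_self_re (h : ℝ) (v : L2R2 × (L2R2 × L2R2 × L2R)) :
    (brokenForm h v v).re = h ^ 2 * ‖v.2.1‖ ^ 2 + ‖v.2.2.1‖ ^ 2 - ‖v.2.2.2‖ ^ 2 := by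
  rw [brokenForm, inner_self_eq_ofReal, inner_self_eq_ofReal, inner_self_eq_ofReal, Complex.sub_re,
    Complex.add_re, ← Complex.ofReal_pow, ← Complex.ofReal_mul, Complex.ofReal_re,
    Complex.ofReal_re, Complex.ofReal_re]

theorem isClosedForm_brokenForm {h : ℝ} (hh : 0 < h) : IsClosedForm testPlane (brokenForm h) where
  add_right w v v' := by
    simp only [brokenForm, Prod.fst_add, Prod.snd_add, inner_add_right]; ring
  smul_right w v z := by
    simp only [brokenForm, Prod.smul_fst, Prod.smul_snd, inner_smul_right]; ring
  conj_symm w v := by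
    simp only [brokenForm, map_add, map_sub, map_mul, map_pow, Complex.conj_ofReal,
      inner_conj_symm]
  bound := by
    refine ⟨h ^ 2 + 1 + 1, fun w v => ?_⟩
    have e1 : ∀ w : L2R2 × (L2R2 × L2R2 × L2R), ‖w.2.1‖ ≤ ‖w‖ := fun w =>
      (norm_fst_le w.2).trans (norm_snd_le w)
    have e2 : ∀ w : L2R2 × (L2R2 × L2R2 × L2R), ‖w.2.2.1‖ ≤ ‖w‖ := fun w =>
      (norm_fst_le w.2.2).trans ((norm_snd_le w.2).trans (norm_snd_le w))
    have e3 : ∀ w : L2R2 × (L2R2 × L2R2 × L2R), ‖w.2.2.2‖ ≤ ‖w‖ := fun w =>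
      (norm_snd_le w.2.2).trans ((norm_snd_le w.2).trans (norm_snd_le w))
    have h1 := (norm_inner_le_norm (𝕜 := ℂ) w.2.1 v.2.1).trans
      (mul_le_mul (e1 w) (e1 v) (norm_nonneg _) (norm_nonneg _))
    have h2 := (norm_inner_le_norm (𝕜 := ℂ) w.2.2.1 v.2.2.1).trans
      (mul_le_mul (e2 w) (e2 v) (norm_nonneg _) (norm_nonneg _))
    have h3 := (norm_inner_le_norm (𝕜 := ℂ) w.2.2.2 v.2.2.2).trans
      (mul_le_mul (e3 w) (e3 v) (norm_nonneg _) (norm_nonneg _))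
    refine (norm_sub_le _ _).trans ((add_le_add_left (norm_add_le _ _) _).trans ?_)
    rw [norm_mul, norm_pow, Complex.norm_real, Real.norm_of_nonneg hh.le]
    have h5 := mul_le_mul_of_nonneg_left h1 (sq_nonneg h)
    linarith
  coercive := by
    -- The trace is needed twice, once in the form and once in the norm; with weight h²/4 this
    -- consumes half of h²‖∂ₓφ‖² and leaves h²/2 for the norm.
    refine ⟨2 * (h ^ 2 / 4)⁻¹ + 1, min (h ^ 2 / 2) 1, by positivity, ?_⟩
    rintro v ⟨φ, hφ, h1, h2, h3, h4⟩
    have t1 := integral_trace_sq_le hφ (show 0 < h ^ 2 / 4 by positivity)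
    rw [← norm_sq_eq_integral h1, ← norm_sq_eq_integral h2, ← norm_sq_eq_integral h4] at t1
    have hn : ‖v‖ ^ 2 ≤ ‖v.1‖ ^ 2 + (‖v.2.1‖ ^ 2 + (‖v.2.2.1‖ ^ 2 + ‖v.2.2.2‖ ^ 2)) :=
      (norm_prod_sq_le v).trans (add_le_add_right ((norm_prod_sq_le v.2).trans
        (add_le_add_right (norm_prod_sq_le v.2.2) _)) _)
    rw [brokenForm_self_re]
    have hδ : 0 < min (h ^ 2 / 2) 1 := by positivity
    have k0 := mul_le_mul_of_nonneg_left hn hδ.le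
    have k1 := mul_le_mul_of_nonneg_right (min_le_left (h ^ 2 / 2) 1) (sq_nonneg ‖v.2.1‖)
    have k2 := fun a : ℝ => mul_le_mul_of_nonneg_right (min_le_right (h ^ 2 / 2) 1) (sq_nonneg a)
    linarith [k2 ‖v.1‖, k2 ‖v.2.2.1‖, k2 ‖v.2.2.2‖]

theorem measurable_ite_mu1 (c : ℝ) : Measurable fun x => if 0 ≤ x then mu1 x else c := by
  have : (fun x => if 0 ≤ x then mu1 x else c) = fun x => if 0 ≤ x then -kappa x ^ 2 else c := by
    ext x
    split_ifs with hx
    · exact mu1_eq hx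
    · rfl
  rw [this]
  exact Measurable.ite measurableSet_Ici (kappa_antitone.measurable.pow_const 2).neg measurable_const

theorem abs_mu1_le_one {x : ℝ} (hx : 0 ≤ x) : |mu1 x| ≤ 1 := by
  rw [mu1_eq hx, abs_neg, abs_of_nonneg (sq_nonneg _)]
  exact pow_le_one₀ (kappa_pos x).le (kappa_le_one x)

theorem measurable_mu1hat : Measurable mu1hat := measurable_ite_mu1 1

theorem measurable_mu1tilde : Measurable mu1tilde := measurable_ite_mu1 0

theorem abs_mu1hat_le (x : ℝ) : |mu1hat x| ≤ 1 := by
  unfold mu1hat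
  split_ifs with hx
  · exact abs_mu1_le_one hx
  · simp

theorem abs_mu1tilde_le (x : ℝ) : |mu1tilde x| ≤ 1 := by
  unfold mu1tilde
  split_ifs with hx
  · exact abs_mu1_le_one hx
  · simp

theorem isClosedForm_mod1 {h : ℝ} (hh : 0 < h) : IsClosedForm testLine (schrodingerForm h mu1hat) :=
  isClosedForm_schrodingerForm hh measurable_mu1hat abs_mu1hat_le

theorem isClosedForm_mod2 {h : ℝ} (hh : 0 < h) :
    IsClosedForm testLine (schrodingerForm h mu1tilde) :=
  isClosedForm_schrodingerForm hh measurable_mu1tilde abs_mu1tilde_le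

theorem mod1_eq (h : ℝ) :
    mod1 h = formOperator (closure (testLine : Set (L2R × L2R))) (schrodingerForm h mu1hat) := rfl

theorem mod2_eq (h : ℝ) :
    mod2 h = formOperator (closure (testLine : Set (L2R × L2R))) (schrodingerForm h mu1tilde) := rfl

theorem brokenOperator_eq (h : ℝ) : brokenOperator h =
    formOperator (closure (testPlane : Set (L2R2 × (L2R2 × L2R2 × L2R)))) (brokenForm h) := rfl

end Forms

/-! ### Transfer of counting functions, and Fubini along the broken line -/

section Transfer

/-- Comparison of the counting functions of two forms that are related on test spaces. -/
theorem counting_le_counting {E₁ F₁ E₂ F₂ : Type*}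
    [NormedAddCommGroup E₁] [InnerProductSpace ℂ E₁] [CompleteSpace E₁]
    [NormedAddCommGroup F₁] [NormedSpace ℂ F₁] [CompleteSpace F₁]
    [NormedAddCommGroup E₂] [InnerProductSpace ℂ E₂] [CompleteSpace E₂]
    [NormedAddCommGroup F₂] [NormedSpace ℂ F₂] [CompleteSpace F₂]
    {D₁ : Submodule ℂ (E₁ × F₁)} {B₁ : E₁ × F₁ → E₁ × F₁ → ℂ}
    {D₂ : Submodule ℂ (E₂ × F₂)} {B₂ : E₂ × F₂ → E₂ × F₂ → ℂ}
    (hB₁ : IsClosedForm D₁ B₁) (hB₂ : IsClosedForm D₂ B₂)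
    (G : Submodule ℂ ((E₁ × F₁) × (E₂ × F₂)))
    (hG : ∀ v ∈ D₁, ∃ p ∈ closure (D₂ : Set (E₂ × F₂)), (v, p) ∈ G) {a b : ℝ}
    (h : ∀ ε > 0, ∃ δ > 0, ∀ g ∈ G, (B₁ g.1 g.1).re < (a + δ) * ‖g.1.1‖ ^ 2 →
      (B₂ g.2 g.2).re < (b + ε) * ‖g.2.1‖ ^ 2) :
    counting (formOperator (closure D₁) B₁) a ≤ counting (formOperator (closure D₂) B₂) b := by
  rw [← ENat.forall_natCast_le_iff_le]
  intro n hn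
  refine hB₂.le_counting fun ε hε => ?_
  obtain ⟨δ, hδ, hlt⟩ := h ε hε
  obtain ⟨v, hv, hvlt⟩ := hB₁.exists_of_le_counting hn hδ
  choose p hp hpG using fun i => hG (v i) (hv i)
  refine ⟨p, hp, fun x hx => ?_⟩
  -- G is a linear relation, so combinations of partners are partners. Independence of the p i comes
  -- for free, since the strict inequality fails at the zero vector.
  have hmem : (∑ i, x i • v i, ∑ i, x i • p i) ∈ G := by
    have : (∑ i, x i • v i, ∑ i, x i • p i) = ∑ i, x i • (v i, p i) := by
      simp only [Prod.smul_mk, Prod.ext_iff, Prod.fst_sum, Prod.snd_sum, and_self]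
    rw [this]
    exact G.sum_mem fun i _ => G.smul_mem _ (hpG i)
  exact hlt _ hmem (hvlt x hx)

theorem integrable_iterated_norm_sq {P : L2R2} {F : ℝ × ℝ → ℂ} (h : P =ᵐ[volume] F) :
    Integrable (fun z : ℝ × ℝ => ‖F z‖ ^ 2) (volume.prod volume) := by
  have h1 : MemLp F 2 (volume : Measure (ℝ × ℝ)) := (Lp.memLp P).ae_eq h
  exact h1.norm.integrable_sq

theorem norm_sq_eq_iterated {P : L2R2} {F : ℝ × ℝ → ℂ} (h : P =ᵐ[volume] F) :
    ‖P‖ ^ 2 = ∫ x, ∫ y, ‖F (x, y)‖ ^ 2 := by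
  rw [norm_sq_eq_integral h]
  exact integral_prod _ (integrable_iterated_norm_sq h)

/-- Parametrization of the broken line by its distance to the vertex. -/
theorem integral_brokenLine {g : ℝ → ℝ} (hg : Integrable g) :
    Integrable ((Set.Ioi 0).indicator fun x => g x + g (-x)) ∧
    ∫ s, g s = ∫ x, (Set.Ioi 0).indicator (fun x => g x + g (-x)) x := by
  have h1 : IntegrableOn (fun x => g (-x)) (Set.Ioi 0) := hg.comp_neg.integrableOn
  refine ⟨(hg.integrableOn.add h1).integrable_indicator measurableSet_Ioi, ?_⟩
  rw [integral_indicator measurableSet_Ioi, integral_add hg.integrableOn h1, add_comm,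
    integral_comp_neg_Ioi, neg_zero, ← setIntegral_union (Set.Iic_disjoint_Ioi le_rfl)
      measurableSet_Ioi hg.integrableOn hg.integrableOn, Set.Iic_union_Ioi, setIntegral_univ]

end Transfer

/-! ### Upper bound: the trial functions f(x) u_x(y) -/

section Trial

theorem continuous_state_prod : Continuous fun z : ℝ × ℝ => state z.1 z.2 :=
  state_lipschitz.continuous

theorem measurable_deriv_prod {f : ℝ → ℝ → ℝ} (hf : Continuous fun z : ℝ × ℝ => f z.1 z.2) :
    Measurable fun z : ℝ × ℝ => deriv (fun t => f t z.2) z.1 :=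
  (measurable_deriv_with_param (f := fun y t => f t y) (hf.comp continuous_swap)).comp
    measurable_swap

theorem measurable_dState_prod : Measurable fun z : ℝ × ℝ => dState z.1 z.2 :=
  measurable_deriv_prod continuous_state_prod

theorem measurable_deriv_state_prod :
    Measurable fun z : ℝ × ℝ => deriv (fun y => (state z.1 y : ℂ)) z.2 :=
  measurable_deriv_with_param (f := fun x y => (state x y : ℂ))
    (Complex.continuous_ofReal.comp continuous_state_prod)

theorem continuous_twoExp_prod (c : ℝ) : Continuous fun z : ℝ × ℝ => twoExp c z.1 z.2 := by
  unfold twoExp kernel; fun_prop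

/-- The common majorant for the trial functions and their derivatives: the L² norm of the envelope
in y is bounded uniformly in x. -/
theorem memLp_mul_twoExp {G : ℝ → ℝ} (hG : Continuous G) (hG2 : MemLp G 2) :
    MemLp (fun z : ℝ × ℝ => G z.1 * twoExp (1 / 4) z.1 z.2) 2 := by
  have hc : Continuous fun z : ℝ × ℝ => G z.1 * twoExp (1 / 4) z.1 z.2 :=
    (hG.comp continuous_fst).mul (continuous_twoExp_prod _)
  rw [memLp_two_iff_integrable_sq hc.aestronglyMeasurable]
  refine (integrable_prod_iff (μ := volume) (ν := volume)
    (hc.pow 2).aestronglyMeasurable).2 ⟨Eventually.of_forall fun x => ?_, ?_⟩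
  · exact ((memLp_twoExp (show (0 : ℝ) < 1 / 4 by norm_num) x).const_mul (G x)).integrable_sq
  · refine (hG2.integrable_sq.const_mul 16).mono'
      ((hc.pow 2).norm.aestronglyMeasurable.integral_prod_right') (Eventually.of_forall fun x => ?_)
    have e : ∀ y, ‖((fun z : ℝ × ℝ => G z.1 * twoExp (1 / 4) z.1 z.2) ^ 2) (x, y)‖ =
        G x ^ 2 * twoExp (1 / 4) x y ^ 2 := fun y => by
      rw [Pi.pow_apply, norm_pow, Real.norm_eq_abs, sq_abs, mul_pow]
    simp_rw [e]
    rw [integral_const_mul, Real.norm_of_nonneg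
      (mul_nonneg (sq_nonneg _) (integral_nonneg fun y => sq_nonneg _))]
    have := integral_twoExp_sq_le (show (0 : ℝ) < 1 / 4 by norm_num) x
    nlinarith [sq_nonneg (G x)]

/-- `p` represents the trial function `(x, y) ↦ f(x) u_x(y)`. -/
def IsTrial (f : ℝ → ℂ) (p : L2R2 × (L2R2 × L2R2 × L2R)) : Prop :=
  p.1 =ᵐ[volume] (fun z => f z.1 * state z.1 z.2) ∧
  p.2.1 =ᵐ[volume] (fun z => deriv f z.1 * state z.1 z.2 + f z.1 * dState z.1 z.2) ∧
  p.2.2.1 =ᵐ[volume] (fun z => f z.1 * deriv (fun y => (state z.1 y : ℂ)) z.2) ∧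
  p.2.2.2 =ᵐ[volume] fun s : ℝ => f |s| * state |s| s

/-- The map `f ↦ f(x) u_x(y)` on test functions. -/
noncomputable def trialGraph : Submodule ℂ ((L2R × L2R) × (L2R2 × (L2R2 × L2R2 × L2R))) where
  carrier := {g | ∃ f : ℝ → ℂ, IsTest f ∧ g.1.1 =ᵐ[volume] f ∧ g.1.2 =ᵐ[volume] deriv f ∧
    IsTrial f g.2}
  zero_mem' := by
    have : deriv (0 : ℝ → ℂ) = 0 := by ext; simp
    refine ⟨0, ⟨contDiff_const, HasCompactSupport.zero⟩, Lp.coeFn_zero _ _ _, ?_, ?_, ?_, ?_, ?_⟩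
    · rw [this]; exact Lp.coeFn_zero _ _ _
    · exact Eventually.of_forall fun z => by simp
    · exact Eventually.of_forall fun z => by simp
    · exact Eventually.of_forall fun z => by simp
    · exact Eventually.of_forall fun z => by simp
  add_mem' := by
    rintro p q ⟨φ, hφ, h1, h2, h3, h4, h5, h6⟩ ⟨χ, hχ, k1, k2, k3, k4, k5, k6⟩
    have hd : deriv (φ + χ) = deriv φ + deriv χ := by
      ext y
      exact deriv_add (hφ.1.differentiable (by simp) y) (hχ.1.differentiable (by simp) y)
    refine ⟨φ + χ, ⟨hφ.1.add hχ.1, hφ.2.add hχ.2⟩, (Lp.coeFn_add _ _).trans (h1.add k1),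
      ?_, ?_, ?_, ?_, ?_⟩
    · rw [hd]; exact (Lp.coeFn_add _ _).trans (h2.add k2)
    · filter_upwards [Lp.coeFn_add p.2.1 q.2.1, h3, k3] with z e1 e2 e3
      rw [Prod.snd_add, Prod.fst_add, e1, Pi.add_apply, Pi.add_apply, e2, e3]; ring
    · rw [hd]
      filter_upwards [Lp.coeFn_add p.2.2.1 q.2.2.1, h4, k4] with z e1 e2 e3
      rw [Prod.snd_add, Prod.snd_add, Prod.fst_add, e1, Pi.add_apply, Pi.add_apply, Pi.add_apply,
        e2, e3]; ring
    · filter_upwards [Lp.coeFn_add p.2.2.2.1 q.2.2.2.1, h5, k5] with z e1 e2 e3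
      rw [Prod.snd_add, Prod.snd_add, Prod.snd_add, Prod.fst_add, e1, Pi.add_apply, Pi.add_apply,
        e2, e3]; ring
    · filter_upwards [Lp.coeFn_add p.2.2.2.2 q.2.2.2.2, h6, k6] with z e1 e2 e3
      rw [Prod.snd_add, Prod.snd_add, Prod.snd_add, Prod.snd_add, e1, Pi.add_apply, Pi.add_apply,
        e2, e3]; ring
  smul_mem' := by
    rintro c p ⟨φ, hφ, h1, h2, h3, h4, h5, h6⟩
    have hd : deriv (c • φ) = c • deriv φ := by
      ext y
      exact deriv_const_smul c (hφ.1.differentiable (by simp) y)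
    refine ⟨c • φ, ⟨contDiff_const.smul hφ.1, hφ.2.smul_left (f := fun _ => c)⟩,
      (Lp.coeFn_smul _ _).trans (h1.const_smul c), ?_, ?_, ?_, ?_, ?_⟩
    · rw [hd]; exact (Lp.coeFn_smul _ _).trans (h2.const_smul c)
    · filter_upwards [Lp.coeFn_smul c p.2.1, h3] with z e1 e2
      rw [Prod.smul_snd, Prod.smul_fst, e1, Pi.smul_apply, Pi.smul_apply, e2, smul_eq_mul,
        smul_eq_mul]; ring
    · rw [hd]
      filter_upwards [Lp.coeFn_smul c p.2.2.1, h4] with z e1 e2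
      rw [Prod.smul_snd, Prod.smul_snd, Prod.smul_fst, e1, Pi.smul_apply, Pi.smul_apply,
        Pi.smul_apply, e2, smul_eq_mul, smul_eq_mul, smul_eq_mul]; ring
    · filter_upwards [Lp.coeFn_smul c p.2.2.2.1, h5] with z e1 e2
      rw [Prod.smul_snd, Prod.smul_snd, Prod.smul_snd, Prod.smul_fst, e1, Pi.smul_apply,
        Pi.smul_apply, e2, smul_eq_mul, smul_eq_mul]; ring
    · filter_upwards [Lp.coeFn_smul c p.2.2.2.2, h6] with z e1 e2
      rw [Prod.smul_snd, Prod.smul_snd, Prod.smul_snd, Prod.smul_snd, e1, Pi.smul_apply,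
        Pi.smul_apply, e2, smul_eq_mul, smul_eq_mul]; ring

/-- The product is bounded and Lipschitz, with square integrable derivatives and trace, hence
belongs to H¹. The product rule is used at the points of differentiability supplied by Rademacher's
theorem. -/
theorem exists_isTrial {f : ℝ → ℂ} (hf : IsTest f) : ∃ p ∈ H1R2WithTrace, IsTrial f p := by
  obtain ⟨K, hK⟩ := hf.1.lipschitzWith_of_hasCompactSupport hf.2 (by simp)
  obtain ⟨C, hC⟩ := hf.1.continuous.bounded_above_of_compact_support hf.2
  have hC0 : 0 ≤ C := (norm_nonneg _).trans (hC 0)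
  lift C to NNReal using hC0
  have hf2 := hf.memLp (μ := volume)
  have hf2' := hf.deriv.memLp (μ := volume)
  set ψ : ℝ × ℝ → ℂ := fun z => f z.1 * state z.1 z.2 with hψ
  have hs0 : ∀ z : ℝ × ℝ, ‖(state z.1 z.2 : ℂ)‖ ≤ twoExp (1 / 4) z.1 z.2 := fun z => by
    rw [Complex.norm_real, Real.norm_of_nonneg (state_pos _ _).le]; exact state_le _ _
  have hs2 : ∀ z : ℝ × ℝ, ‖(state z.1 z.2 : ℂ)‖ ≤ 2 := fun z => by
    rw [Complex.norm_real, Real.norm_of_nonneg (state_pos _ _).le]; exact state_le_two _ _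
  have hsc : Continuous fun z : ℝ × ℝ => (state z.1 z.2 : ℂ) :=
    Complex.continuous_ofReal.comp continuous_state_prod
  have hψc : Continuous ψ := (hf.1.continuous.comp continuous_fst).mul hsc
  have hd : ∀ᵐ z : ℝ × ℝ, fderiv ℝ ψ z (1, 0) = deriv f z.1 * state z.1 z.2 + f z.1 * dState z.1 z.2 ∧
      fderiv ℝ ψ z (0, 1) = f z.1 * deriv (fun y => (state z.1 y : ℂ)) z.2 := by
    filter_upwards [state_lipschitz.ae_differentiableAt (μ := (volume : Measure (ℝ × ℝ)))] with z hz
    have hzC : DifferentiableAt ℝ (fun z : ℝ × ℝ => (state z.1 z.2 : ℂ)) z :=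
      Complex.ofRealCLM.differentiableAt.comp z hz
    have hfz : DifferentiableAt ℝ (fun z : ℝ × ℝ => f z.1) z :=
      (hf.1.differentiable (by simp) z.1).comp z differentiableAt_fst
    have hψz := (hfz.mul hzC).hasFDerivAt
    constructor
    · have e1 := hψz.comp_hasDerivAt z.1 ((hasDerivAt_id z.1).prodMk (hasDerivAt_const z.1 z.2))
      have e2 := ((hf.1.differentiable (by simp) z.1).hasDerivAt).fun_mul
        (hasDerivAt_state_of_differentiableAt (x := z.1) (y := z.2) hz).ofReal_comp
      exact e1.unique e2
    · have e1 := hψz.comp_hasDerivAt z.2 ((hasDerivAt_const z.2 z.1).prodMk (hasDerivAt_id z.2))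
      have e3 : DifferentiableAt ℝ (fun y => (state z.1 y : ℂ)) z.2 :=
        DifferentiableAt.comp (g := fun z : ℝ × ℝ => (state z.1 z.2 : ℂ))
          (f := fun t => (z.1, t)) z.2 hzC (by fun_prop)
      have e2 := e3.hasDerivAt.const_mul (f z.1)
      exact e1.unique e2
  have hd1 := hd.mono fun z hz => hz.1
  have hd2 := hd.mono fun z hz => hz.2
  have m0 : MemLp ψ 2 := by
    refine (memLp_mul_twoExp hf.1.continuous.norm hf2.norm).mono' hψc.aestronglyMeasurable
      (Eventually.of_forall fun z => ?_)
    rw [hψ, norm_mul]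
    exact mul_le_mul_of_nonneg_left (hs0 z) (norm_nonneg _)
  have m1 : MemLp (fun z : ℝ × ℝ => deriv f z.1 * state z.1 z.2 + f z.1 * dState z.1 z.2) 2 := by
    have hG : Continuous fun x => ‖deriv f x‖ + 40 * ‖f x‖ :=
      hf.deriv.1.continuous.norm.add (hf.1.continuous.norm.const_mul 40)
    refine (memLp_mul_twoExp hG (hf2'.norm.add (hf2.norm.const_mul 40))).mono' ?_
      (Eventually.of_forall fun z => ?_)
    · exact (((hf.deriv.1.continuous.comp continuous_fst).mul hsc).measurable.add
        ((hf.1.continuous.comp continuous_fst).measurable.mul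
          (Complex.measurable_ofReal.comp measurable_dState_prod))).aestronglyMeasurable
    · refine (norm_add_le _ _).trans ?_
      rw [norm_mul, norm_mul, Complex.norm_real (dState _ _), Real.norm_eq_abs]
      have e1 := mul_le_mul_of_nonneg_left (hs0 z) (norm_nonneg (deriv f z.1))
      have e2 := mul_le_mul_of_nonneg_left (abs_dState_le z.1 z.2) (norm_nonneg (f z.1))
      linarith
  have m2 : MemLp (fun z : ℝ × ℝ => f z.1 * deriv (fun y => (state z.1 y : ℂ)) z.2) 2 := by
    have hm : Measurable fun z : ℝ × ℝ => f z.1 * deriv (fun y => (state z.1 y : ℂ)) z.2 :=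
      (hf.1.continuous.comp continuous_fst).measurable.mul measurable_deriv_state_prod
    refine (memLp_mul_twoExp hf.1.continuous.norm hf2.norm).mono' hm.aestronglyMeasurable ?_
    have : ∀ᵐ z : ℝ × ℝ ∂(volume.prod volume), ‖f z.1 * deriv (fun y => (state z.1 y : ℂ)) z.2‖ ≤
        ‖f z.1‖ * twoExp (1 / 4) z.1 z.2 := by
      have hm' : Measurable fun z : ℝ × ℝ => ‖f z.1‖ * twoExp (1 / 4) z.1 z.2 :=
        ((hf.1.continuous.comp continuous_fst).norm.mul (continuous_twoExp_prod _)).measurable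
      rw [Measure.ae_prod_iff_ae_ae (measurableSet_le hm.norm hm')]
      refine Eventually.of_forall fun x => ?_
      filter_upwards [ae_norm_deriv_state_le x] with y hy
      rw [norm_mul]
      exact mul_le_mul_of_nonneg_left hy (norm_nonneg _)
    exact this
  have m3 : MemLp (fun s : ℝ => ψ (|s|, s)) 2 := by
    refine (hψc.comp isClosedEmbedding_brokenLine.continuous).memLp_of_hasCompactSupport ?_
    obtain ⟨r, hr⟩ := hf.2.isCompact.isBounded.subset_closedBall 0
    refine HasCompactSupport.of_support_subset_isCompact (isCompact_closedBall 0 r) fun s hs => ?_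
    have : f |s| ≠ 0 := left_ne_zero_of_mul hs
    have := hr (subset_closure this)
    simpa using this
  have hL : LipschitzWith (C * 82 + K * 2) ψ := by
    refine LipschitzWith.of_dist_le_mul fun z w => ?_
    have e1 := hK.dist_le_mul z.1 w.1
    have e2 := state_lipschitz.dist_le_mul z w
    have e3 : dist z.1 w.1 ≤ dist z w := le_max_left _ _
    rw [dist_eq_norm] at e1 ⊢
    rw [Real.dist_eq] at e2
    have : ψ z - ψ w = f z.1 * ((state z.1 z.2 - state w.1 w.2 : ℝ) : ℂ) +
        (f z.1 - f w.1) * state w.1 w.2 := by rw [hψ]; push_cast; ring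
    rw [this]
    refine (norm_add_le _ _).trans ?_
    rw [norm_mul, norm_mul, Complex.norm_real (_ - _), Real.norm_eq_abs]
    have e4 := mul_le_mul (hC z.1) e2 (abs_nonneg _) C.2
    have e5 := mul_le_mul (e1.trans (mul_le_mul_of_nonneg_left e3 K.2)) (hs2 w) (norm_nonneg _)
      (mul_nonneg K.2 dist_nonneg)
    push_cast at e4 e5 ⊢
    linarith
  have hb : ∀ z, ‖ψ z‖ ≤ (C * 2 : NNReal) := fun z => by
    rw [hψ, norm_mul]
    push_cast
    exact mul_le_mul (hC z.1) (hs2 z) (norm_nonneg _) C.2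
  obtain ⟨p, hp, p1, p2, p3, p4⟩ := IsH1Trace.of_lipschitz hL hb m0 (m1.ae_eq (EventuallyEq.symm hd1))
    (m2.ae_eq (EventuallyEq.symm hd2)) m3
  exact ⟨p, hp, p1, p2.trans hd1, p3.trans hd2, p4⟩

end Trial

section TrialEnergy

theorem norm_add_mul_real_sq (α β : ℂ) (a b : ℝ) :
    ‖α * a + β * b‖ ^ 2 = ‖α‖ ^ 2 * a ^ 2 + ‖β‖ ^ 2 * b ^ 2 +
      2 * (α * (starRingEnd ℂ) β).re * (b * a) := by
  simp only [Complex.sq_norm, Complex.normSq_apply, Complex.add_re, Complex.add_im, Complex.mul_re,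
    Complex.mul_im, Complex.ofReal_re, Complex.ofReal_im, Complex.conj_re, Complex.conj_im]
  ring

/-- Since `u_x` is normalized, the derivatives of `f` and of `u_x` do not interfere. -/
theorem integral_norm_trial_sq_le {x : ℝ} (hx0 : x ≠ 0)
    (hx : ∀ᵐ y : ℝ, DifferentiableAt ℝ (fun z : ℝ × ℝ => state z.1 z.2) (x, y)) (α β : ℂ) :
    ∫ y, ‖α * state x y + β * dState x y‖ ^ 2 ≤ ‖α‖ ^ 2 + M.toReal * ‖β‖ ^ 2 := by
  have h1 := (memLp_state x).integrable_sq
  have h2 := (memLp_dState x).integrable_sq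
  have h3 : Integrable fun y => dState x y * state x y :=
    (memLp_dState x).integrable_mul (memLp_state x)
  simp_rw [norm_add_mul_real_sq]
  have h4 : Integrable fun y => ‖α‖ ^ 2 * state x y ^ 2 + ‖β‖ ^ 2 * dState x y ^ 2 :=
    (h1.const_mul _).add (h2.const_mul _)
  rw [integral_add h4 (h3.const_mul _), integral_add (h1.const_mul _) (h2.const_mul _), integral_const_mul, integral_const_mul,
    integral_const_mul, integral_state_sq, integral_dState_mul_state hx, mul_one, mul_zero, add_zero,
    mul_comm M.toReal]
  refine add_le_add_right (mul_le_mul_of_nonneg_left ?_ (sq_nonneg _)) _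
  -- For x < 0 the state is frozen at u₀ and its derivative is zero; M controls x > 0.
  rcases lt_or_gt_of_ne hx0 with h | h
  · simp_rw [dState_of_neg h]; simp
  · exact integral_dState_sq_le h

theorem norm_trial {g : (L2R × L2R) × (L2R2 × (L2R2 × L2R2 × L2R))} (hg : g ∈ trialGraph) :
    ‖g.2.1‖ = ‖g.1.1‖ := by
  obtain ⟨f, hf, h1, h2, h3, h4, h5, h6⟩ := hg
  refine (pow_left_inj₀ (norm_nonneg _) (norm_nonneg _) two_ne_zero).1 ?_
  rw [norm_sq_eq_iterated h3, norm_sq_eq_integral h1]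
  congr 1; ext x
  have : ∀ y, ‖f x * (state x y : ℂ)‖ ^ 2 = ‖f x‖ ^ 2 * state x y ^ 2 := fun y => by
    rw [norm_mul, mul_pow, Complex.norm_real, Real.norm_eq_abs, sq_abs]
  simp_rw [this]
  rw [integral_const_mul, integral_state_sq, mul_one]

/-- The upper bound on the energy of the trial functions. -/
theorem brokenForm_trial_le {h : ℝ} {g : (L2R × L2R) × (L2R2 × (L2R2 × L2R2 × L2R))}
    (hg : g ∈ trialGraph) : (brokenForm h g.2 g.2).re ≤
      (schrodingerForm h mu1hat g.1 g.1).re + h ^ 2 * M.toReal * ‖g.1.1‖ ^ 2 := by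
  obtain ⟨f, hf, h1, h2, h3, h4, h5, h6⟩ := hg
  have hf1 := (hf.memLp (μ := volume)).norm.integrable_sq
  have hf2 := (hf.deriv.memLp (μ := volume)).norm.integrable_sq
  have hne : ∀ᵐ x : ℝ, x ≠ 0 := by simp [ae_iff]
  have hx : ‖g.2.2.1‖ ^ 2 ≤ (∫ x, ‖deriv f x‖ ^ 2) + M.toReal * ∫ x, ‖f x‖ ^ 2 := by
    rw [norm_sq_eq_iterated h4, ← integral_const_mul, ← integral_add hf2 (hf1.const_mul _)]
    refine integral_mono_ae (integrable_iterated_norm_sq h4).integral_prod_left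
      (hf2.add (hf1.const_mul _)) ?_
    filter_upwards [hne, ae_differentiableAt_state] with x e1 e2
    exact integral_norm_trial_sq_le e1 e2 _ _
  -- The two arms of the broken line fold onto the slices x > 0, where vertical energy minus trace
  -- is μ₁(x)|f|²; slices x < 0 carry only the energy of u₀.
  have hy : ‖g.2.2.2.1‖ ^ 2 - ‖g.2.2.2.2‖ ^ 2 = ∫ x, mu1hat x * ‖f x‖ ^ 2 := by
    have h7 : Integrable fun s : ℝ => ‖f |s| * (state |s| s : ℂ)‖ ^ 2 :=
      ((Lp.memLp g.2.2.2.2).ae_eq h6).norm.integrable_sq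
    obtain ⟨h8, h9⟩ := integral_brokenLine h7
    rw [norm_sq_eq_iterated h5, norm_sq_eq_integral h6, h9,
      ← integral_sub (integrable_iterated_norm_sq h5).integral_prod_left h8]
    refine integral_congr_ae ?_
    filter_upwards [hne] with x hx
    have e1 : ∀ y, ‖f x * deriv (fun y => (state x y : ℂ)) y‖ ^ 2 =
        ‖f x‖ ^ 2 * ‖deriv (fun y => (state x y : ℂ)) y‖ ^ 2 := fun y => by
      rw [norm_mul, mul_pow]
    simp_rw [e1]
    rw [integral_const_mul]
    rcases lt_or_gt_of_ne hx with h | h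
    · rw [Set.indicator_of_notMem (by simpa using h.le), slice_state_of_neg h, mu1hat,
        if_neg h.not_ge]
      ring
    · rw [Set.indicator_of_mem (Set.mem_Ioi.2 h), mu1hat, if_pos h.le, ← slice_state h.le, abs_neg, abs_of_pos h]
      simp only [norm_mul, mul_pow, Complex.norm_real, Real.norm_eq_abs, sq_abs]
      ring
  rw [brokenForm_self_re, schrodingerForm_self_re h1 h2, norm_sq_eq_integral h1]
  have := mul_le_mul_of_nonneg_left hx (sq_nonneg h)
  linarith

theorem counting_mod1_le {h : ℝ} (hh : 0 < h) (a : ℝ) :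
    counting (mod1 h) a ≤ counting (brokenOperator h) (a + h ^ 2 * M.toReal) := by
  rw [mod1_eq, brokenOperator_eq]
  refine counting_le_counting (isClosedForm_mod1 hh) (isClosedForm_brokenForm hh) trialGraph ?_ ?_
  · rintro v ⟨f, hf, h1, h2⟩
    obtain ⟨p, hp, h3⟩ := exists_isTrial hf
    exact ⟨p, hp, f, hf, h1, h2, h3⟩
  · refine fun ε hε => ⟨ε, hε, fun g hg hlt => ?_⟩
    have h1 := brokenForm_trial_le (h := h) hg
    rw [norm_trial hg]
    linarith

end TrialEnergy

/-! ### Lower bound: the component along the ground state -/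

section SliceMap

/-- The component of `φ(x, ·)` along the ground state `u_x`. -/
noncomputable def component (φ : ℝ × ℝ → ℂ) (x : ℝ) : ℂ := ∫ y, (state x y : ℂ) * φ (x, y)

/-- The derivative of `component φ` almost everywhere. -/
noncomputable def componentDeriv (φ : ℝ × ℝ → ℂ) (x : ℝ) : ℂ :=
  ∫ y, ((dState x y : ℂ) * φ (x, y) + (state x y : ℂ) * fderiv ℝ φ (x, y) (1, 0))

variable {φ χ : ℝ × ℝ → ℂ}

theorem integrable_state_mul {ψ : ℝ → ℂ} (hψ : IsTest ψ) (x : ℝ) :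
    Integrable fun y => (state x y : ℂ) * ψ y :=
  (memLp_state x).ofReal.integrable_mul hψ.memLp

theorem integrable_dState_mul {ψ : ℝ → ℂ} (hψ : IsTest ψ) (x : ℝ) :
    Integrable fun y => (dState x y : ℂ) * ψ y :=
  (memLp_dState x).ofReal.integrable_mul hψ.memLp

theorem integrable_componentDeriv (hφ : IsTest φ) (x : ℝ) : Integrable fun y =>
    (dState x y : ℂ) * φ (x, y) + (state x y : ℂ) * fderiv ℝ φ (x, y) (1, 0) :=
  (integrable_dState_mul (isTest_slice_right hφ x) x).add
    (integrable_state_mul (isTest_slice_right (hφ.fderiv_apply (1, 0)) x) x)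

theorem component_add (hφ : IsTest φ) (hχ : IsTest χ) (x : ℝ) :
    component (φ + χ) x = component φ x + component χ x := by
  unfold component
  rw [← integral_add (integrable_state_mul (isTest_slice_right hφ x) x)
    (integrable_state_mul (isTest_slice_right hχ x) x)]
  congr 1; ext y
  rw [Pi.add_apply]; ring

theorem component_smul (c : ℂ) (φ : ℝ × ℝ → ℂ) (x : ℝ) :
    component (c • φ) x = c * component φ x := by
  unfold component
  rw [← integral_const_mul]
  congr 1; ext y
  rw [Pi.smul_apply, smul_eq_mul]; ring

theorem componentDeriv_add (hφ : IsTest φ) (hχ : IsTest χ) (x : ℝ) :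
    componentDeriv (φ + χ) x = componentDeriv φ x + componentDeriv χ x := by
  unfold componentDeriv
  rw [← integral_add (integrable_componentDeriv hφ x) (integrable_componentDeriv hχ x)]
  congr 1; ext y
  rw [Pi.add_apply, fderiv_add (hφ.1.differentiable (by simp) _)
    (hχ.1.differentiable (by simp) _), add_apply]
  ring

theorem componentDeriv_smul (c : ℂ) (hφ : IsTest φ) (x : ℝ) :
    componentDeriv (c • φ) x = c * componentDeriv φ x := by
  unfold componentDeriv
  rw [← integral_const_mul]
  congr 1; ext y
  rw [Pi.smul_apply, fderiv_const_smul (hφ.1.differentiable (by simp) _), smul_apply, smul_eq_mul,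
    smul_eq_mul]
  ring

theorem exists_bounds (hφ : IsTest φ) : ∃ (K C : NNReal) (r : ℝ), LipschitzWith K φ ∧
    (∀ z, ‖φ z‖ ≤ C) ∧ ∀ z : ℝ × ℝ, φ z ≠ 0 → |z.1| ≤ r ∧ |z.2| ≤ r := by
  obtain ⟨K, hK⟩ := hφ.1.lipschitzWith_of_hasCompactSupport hφ.2 (by simp)
  obtain ⟨C, hC⟩ := hφ.1.continuous.bounded_above_of_compact_support hφ.2
  have hC0 : 0 ≤ C := (norm_nonneg _).trans (hC 0)
  lift C to NNReal using hC0
  obtain ⟨r, hr⟩ := hφ.2.isCompact.isBounded.subset_closedBall 0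
  refine ⟨K, C, r, hK, hC, fun z hz => ?_⟩
  have := hr (subset_closure hz)
  rw [mem_closedBall_zero_iff] at this
  exact ⟨(norm_fst_le z).trans this, (norm_snd_le z).trans this⟩

theorem dist_slice_left_le {K : NNReal} (hK : LipschitzWith K φ) (t s y : ℝ) :
    ‖φ (t, y) - φ (s, y)‖ ≤ K * |t - s| := by
  have := hK.dist_le_mul (t, y) (s, y)
  rwa [dist_eq_norm, Prod.dist_eq, dist_self, max_eq_left dist_nonneg, Real.dist_eq] at this

theorem hasDerivAt_component (hφ : IsTest φ) {x : ℝ}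
    (hx : ∀ᵐ y : ℝ, DifferentiableAt ℝ (fun z : ℝ × ℝ => state z.1 z.2) (x, y)) :
    HasDerivAt (component φ) (componentDeriv φ x) x := by
  obtain ⟨K, C, r, hK, hC, hr⟩ := exists_bounds hφ
  set G : ℝ → ℝ := (Set.Icc (-r) r).indicator fun _ => (C + K : ℝ) with hG
  have hGm : MemLp G 2 := memLp_indicator_const 2 measurableSet_Icc _
    (Or.inr measure_Icc_lt_top.ne)
  have hmem : ∀ y, |y| ≤ r → G y = C + K := fun y hy =>
    Set.indicator_of_mem (show y ∈ Set.Icc (-r) r from abs_le.1 hy) _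
  have hG0 : ∀ y, 0 ≤ G y := fun y => Set.indicator_nonneg (fun _ _ => by positivity) y
  refine hasDerivAt_integral_state_mul (g := fun t y => φ (t, y)) (G := G) hx
    (fun t => (isTest_slice_right hφ t).1.continuous.aestronglyMeasurable)
    (isTest_slice_right (hφ.fderiv_apply (1, 0)) x).1.continuous.aestronglyMeasurable hGm
    (fun t _ y => ?_) (fun t _ s _ y => ?_)
    (Eventually.of_forall fun y => hasDerivAt_slice_left hφ x y)
  · by_cases h : φ (t, y) = 0
    · rw [h, norm_zero]; exact hG0 y
    · rw [hmem y (hr _ h).2]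
      exact (hC _).trans (le_add_of_nonneg_right K.2)
  · by_cases h : |y| ≤ r
    · rw [hmem y h, mul_comm]
      refine (dist_slice_left_le hK t s y).trans ?_
      exact mul_le_mul_of_nonneg_right (le_add_of_nonneg_left C.2) (abs_nonneg _)
    · have h0 : ∀ t, φ (t, y) = 0 := fun t => by
        by_contra h1
        exact h (hr _ h1).2
      rw [h0, h0, sub_zero, norm_zero]
      exact mul_nonneg (abs_nonneg _) (hG0 y)

/-- Together with compact support this puts the component in H¹, with its almost everywhere
derivative as weak derivative. -/
theorem component_lipschitz (hφ : IsTest φ) : ∃ L : NNReal, LipschitzWith L (component φ) := by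
  obtain ⟨K, C, r, hK, hC, hr⟩ := exists_bounds hφ
  set G : ℝ → ℝ := (Set.Icc (-r) r).indicator fun _ => (80 * C + 2 * K : ℝ) with hG
  have hGi : Integrable G := (integrableOn_const measure_Icc_lt_top.ne).integrable_indicator
    measurableSet_Icc
  have hG0 : ∀ y, 0 ≤ G y := fun y => Set.indicator_nonneg (fun _ _ => by positivity) y
  refine ⟨NNReal.mk (∫ y, G y) (integral_nonneg hG0), LipschitzWith.of_dist_le_mul fun t s => ?_⟩
  rw [dist_eq_norm, component, component, ← integral_sub
    (integrable_state_mul (isTest_slice_right hφ t) t)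
    (integrable_state_mul (isTest_slice_right hφ s) s), NNReal.coe_mk, Real.dist_eq,
    ← integral_mul_const]
  refine norm_integral_le_of_norm_le (hGi.mul_const _) (Eventually.of_forall fun y => ?_)
  by_cases h : |y| ≤ r
  · rw [hG, Set.indicator_of_mem (show y ∈ Set.Icc (-r) r from abs_le.1 h)]
    have e : (state t y : ℂ) * φ (t, y) - state s y * φ (s, y) =
        ((state t y - state s y : ℝ) : ℂ) * φ (t, y) + state s y * (φ (t, y) - φ (s, y)) := by
      push_cast; ring
    rw [e]
    refine (norm_add_le _ _).trans ?_
    rw [norm_mul, norm_mul, Complex.norm_real, Complex.norm_real, Real.norm_eq_abs,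
      Real.norm_of_nonneg (state_pos _ _).le]
    have e1 := mul_le_mul (abs_state_sub_le_global t s y) (hC (t, y)) (norm_nonneg _)
      (by positivity)
    have e2 := mul_le_mul (state_le_two s y) (dist_slice_left_le hK t s y) (norm_nonneg _)
      zero_le_two
    linarith
  · have h0 : ∀ t, φ (t, y) = 0 := fun t => by
      by_contra h1
      exact h (hr _ h1).2
    rw [h0, h0, mul_zero, mul_zero, sub_zero, norm_zero]
    exact mul_nonneg (hG0 y) (abs_nonneg _)

theorem component_hasCompactSupport (hφ : IsTest φ) : HasCompactSupport (component φ) := by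
  obtain ⟨K, C, r, hK, hC, hr⟩ := exists_bounds hφ
  refine HasCompactSupport.of_support_subset_isCompact (isCompact_Icc (a := -r) (b := r))
    fun x hx => ?_
  by_contra h
  refine hx ?_
  have h0 : ∀ y, φ (x, y) = 0 := fun y => by
    by_contra h1
    exact h (abs_le.1 (hr _ h1).1)
  simp [component, h0]

theorem exists_component (hφ : IsTest φ) : ∃ q ∈ H1R, q.1 =ᵐ[volume] component φ ∧
    q.2 =ᵐ[volume] componentDeriv φ := by
  obtain ⟨L, hL⟩ := component_lipschitz hφ
  obtain ⟨q, hq, h1, h2⟩ := (IsH1Values.of_lipschitz_of_hasCompactSupport hL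
    (component_hasCompactSupport hφ) 0).isH1
  refine ⟨q, hq, h1, h2.trans ?_⟩
  filter_upwards [ae_differentiableAt_state] with x hx
  exact (hasDerivAt_component hφ hx).deriv

/-- The map `φ ↦ component φ` on test functions. -/
noncomputable def componentGraph : Submodule ℂ ((L2R2 × (L2R2 × L2R2 × L2R)) × (L2R × L2R)) where
  carrier := {g | ∃ φ : ℝ × ℝ → ℂ, (IsTest φ ∧ g.1.1 =ᵐ[volume] φ ∧
    g.1.2.1 =ᵐ[volume] (fun z => fderiv ℝ φ z (1, 0)) ∧
    g.1.2.2.1 =ᵐ[volume] (fun z => fderiv ℝ φ z (0, 1)) ∧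
    g.1.2.2.2 =ᵐ[volume] (fun s : ℝ => φ (|s|, s))) ∧
    g.2.1 =ᵐ[volume] component φ ∧ g.2.2 =ᵐ[volume] componentDeriv φ}
  zero_mem' := by
    have h0 : IsTest (0 : ℝ × ℝ → ℂ) := ⟨contDiff_const, HasCompactSupport.zero⟩
    have e1 : component 0 = 0 := by ext x; simp [component]
    have e2 : componentDeriv 0 = 0 := by ext x; simp [componentDeriv]
    have : ∀ v : ℝ × ℝ, (fun z => fderiv ℝ (0 : ℝ × ℝ → ℂ) z v) = 0 := fun v => by ext; simp
    refine ⟨0, ⟨h0, Lp.coeFn_zero _ _ _, ?_, ?_, Lp.coeFn_zero _ _ _⟩, ?_, ?_⟩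
    · rw [this]; exact Lp.coeFn_zero _ _ _
    · rw [this]; exact Lp.coeFn_zero _ _ _
    · rw [e1]; exact Lp.coeFn_zero _ _ _
    · rw [e2]; exact Lp.coeFn_zero _ _ _
  add_mem' := by
    rintro p q ⟨φ, ⟨hφ, h1, h2, h3, h4⟩, h5, h6⟩ ⟨χ, ⟨hχ, k1, k2, k3, k4⟩, k5, k6⟩
    have : ∀ v : ℝ × ℝ, (fun z => fderiv ℝ (φ + χ) z v) =
        (fun z => fderiv ℝ φ z v) + fun z => fderiv ℝ χ z v := fun v => by
      ext z
      rw [fderiv_add (hφ.1.differentiable (by simp) z) (hχ.1.differentiable (by simp) z)]; rfl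
    have e1 : component (φ + χ) = component φ + component χ := funext (component_add hφ hχ)
    have e2 : componentDeriv (φ + χ) = componentDeriv φ + componentDeriv χ :=
      funext (componentDeriv_add hφ hχ)
    refine ⟨φ + χ, ⟨⟨hφ.1.add hχ.1, hφ.2.add hχ.2⟩, (Lp.coeFn_add _ _).trans (h1.add k1), ?_, ?_,
      (Lp.coeFn_add _ _).trans (h4.add k4)⟩, ?_, ?_⟩
    · rw [this]; exact (Lp.coeFn_add _ _).trans (h2.add k2)
    · rw [this]; exact (Lp.coeFn_add _ _).trans (h3.add k3)
    · rw [e1]; exact (Lp.coeFn_add _ _).trans (h5.add k5)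
    · rw [e2]; exact (Lp.coeFn_add _ _).trans (h6.add k6)
  smul_mem' := by
    rintro c p ⟨φ, ⟨hφ, h1, h2, h3, h4⟩, h5, h6⟩
    have : ∀ v : ℝ × ℝ, (fun z => fderiv ℝ (c • φ) z v) = c • (fun z => fderiv ℝ φ z v) :=
      fun v => by
        ext z
        rw [fderiv_const_smul (hφ.1.differentiable (by simp) z)]; rfl
    have e1 : component (c • φ) = c • component φ := funext (component_smul c φ)
    have e2 : componentDeriv (c • φ) = c • componentDeriv φ := funext (componentDeriv_smul c hφ)
    refine ⟨c • φ, ⟨⟨contDiff_const.smul hφ.1, hφ.2.smul_left (f := fun _ => c)⟩,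
      (Lp.coeFn_smul _ _).trans (h1.const_smul c), ?_, ?_,
      (Lp.coeFn_smul _ _).trans (h4.const_smul c)⟩, ?_, ?_⟩
    · rw [this]; exact (Lp.coeFn_smul _ _).trans (h2.const_smul c)
    · rw [this]; exact (Lp.coeFn_smul _ _).trans (h3.const_smul c)
    · rw [e1]; exact (Lp.coeFn_smul _ _).trans (h5.const_smul c)
    · rw [e2]; exact (Lp.coeFn_smul _ _).trans (h6.const_smul c)

/-- D only sees V - ⟨U, V⟩U, to which Cauchy–Schwarz is applied. -/
theorem norm_inner_sq_le_of_orthogonal {E : Type*} [NormedAddCommGroup E] [InnerProductSpace ℂ E]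
    {U V D : E} (hU : ‖U‖ = 1) (hDU : (inner ℂ D U : ℂ) = 0) :
    ‖(inner ℂ D V : ℂ)‖ ^ 2 ≤ ‖D‖ ^ 2 * (‖V‖ ^ 2 - ‖(inner ℂ U V : ℂ)‖ ^ 2) := by
  set c : ℂ := inner ℂ U V with hc
  have h1 : (inner ℂ D (V - c • U) : ℂ) = inner ℂ D V := by
    rw [inner_sub_right, inner_smul_right, hDU, mul_zero, sub_zero]
  have h2 : ‖V - c • U‖ ^ 2 = ‖V‖ ^ 2 - ‖c‖ ^ 2 := by
    have h3 : (inner ℂ V (c • U) : ℂ).re = ‖c‖ ^ 2 := by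
      rw [inner_smul_right, ← inner_conj_symm, ← hc, Complex.mul_conj, Complex.normSq_eq_norm_sq,
        Complex.ofReal_re]
    have h4 := @norm_sub_sq ℂ _ _ _ _ V (c • U)
    rw [norm_smul, hU, mul_one] at h4
    rw [h4]
    change ‖V‖ ^ 2 - 2 * (inner ℂ V (c • U) : ℂ).re + ‖c‖ ^ 2 = _
    rw [h3]; ring
  rw [← h1, ← h2, ← mul_pow]
  exact pow_le_pow_left₀ (norm_nonneg _) (norm_inner_le_norm _ _) 2

/-- Because ∂ₓu_x is orthogonal to u_x, the coupling is controlled by the part of ψ orthogonal to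
u_x alone. The resulting error can therefore be absorbed at energies below -1/4 - hM. -/
theorem norm_dState_mul_sq_le {ψ : ℝ → ℂ} (hψ : IsTest ψ) {x : ℝ} (hx0 : x ≠ 0)
    (hx : ∀ᵐ y : ℝ, DifferentiableAt ℝ (fun z : ℝ × ℝ => state z.1 z.2) (x, y)) :
    ‖∫ y, (dState x y : ℂ) * ψ y‖ ^ 2 ≤
      M.toReal * ((∫ y, ‖ψ y‖ ^ 2) - ‖∫ y, (state x y : ℂ) * ψ y‖ ^ 2) := by
  have h1 : MemLp (fun y => (state x y : ℂ)) 2 := (memLp_state x).ofReal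
  have h2 : MemLp (fun y => (dState x y : ℂ)) 2 := (memLp_dState x).ofReal
  have h3 := hψ.memLp (μ := volume)
  have hn1 : ‖h1.toLp _‖ = 1 := by
    have := norm_sq_eq_integral h1.coeFn_toLp
    simp_rw [Complex.norm_real, Real.norm_eq_abs, sq_abs, integral_state_sq] at this
    exact (pow_eq_one_iff_of_nonneg (norm_nonneg _) two_ne_zero).1 this
  have hn2 : ‖h2.toLp _‖ ^ 2 ≤ M.toReal := by
    rw [norm_sq_eq_integral h2.coeFn_toLp]
    simp_rw [Complex.norm_real, Real.norm_eq_abs, sq_abs]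
    rcases lt_or_gt_of_ne hx0 with h | h
    · simp_rw [dState_of_neg h]; simp
    · exact integral_dState_sq_le h
  have ho : (inner ℂ (h2.toLp _) (h1.toLp _) : ℂ) = 0 := by
    rw [inner_eq_integral_ofReal h2.coeFn_toLp h1.coeFn_toLp]
    simp_rw [← Complex.ofReal_mul]
    rw [integral_complex_ofReal, integral_dState_mul_state hx, Complex.ofReal_zero]
  have h4 := norm_inner_sq_le_of_orthogonal (V := h3.toLp ψ) hn1 ho
  rw [inner_eq_integral_ofReal h2.coeFn_toLp h3.coeFn_toLp,
    inner_eq_integral_ofReal h1.coeFn_toLp h3.coeFn_toLp] at h4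
  rw [← norm_sq_eq_integral h3.coeFn_toLp]
  refine h4.trans (mul_le_mul_of_nonneg_right hn2 ?_)
  rw [norm_sq_eq_integral h3.coeFn_toLp]
  exact sub_nonneg.2 (norm_integral_state_mul_le hψ x)

/-- Cauchy–Schwarz with weights 1 - h and h, which sum to 1. After multiplication by (1 - h)h², the
first term is the exact kinetic energy and the second is of order h. -/
theorem add_sq_le_div_add_div {a b h : ℝ} (h0 : 0 < h) (h1 : h < 1) :
    (a + b) ^ 2 ≤ (1 - h)⁻¹ * a ^ 2 + h⁻¹ * b ^ 2 := by
  have h2 : 0 < 1 - h := by linarith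
  have : (1 - h)⁻¹ * a ^ 2 + h⁻¹ * b ^ 2 - (a + b) ^ 2 =
      (1 - h)⁻¹ * h⁻¹ * (h * a - (1 - h) * b) ^ 2 := by
    field_simp; ring
  have : 0 ≤ (1 - h)⁻¹ * h⁻¹ * (h * a - (1 - h) * b) ^ 2 := by positivity
  linarith

theorem norm_componentDeriv_sq_le (hφ : IsTest φ) {h : ℝ} (h0 : 0 < h) (h1 : h < 1) {x : ℝ}
    (hx0 : x ≠ 0)
    (hx : ∀ᵐ y : ℝ, DifferentiableAt ℝ (fun z : ℝ × ℝ => state z.1 z.2) (x, y)) :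
    ‖componentDeriv φ x‖ ^ 2 ≤ (1 - h)⁻¹ * (∫ y, ‖fderiv ℝ φ (x, y) (1, 0)‖ ^ 2) +
      h⁻¹ * (M.toReal * ((∫ y, ‖φ (x, y)‖ ^ 2) - ‖component φ x‖ ^ 2)) := by
  have t1 := isTest_slice_right hφ x
  have t2 := isTest_slice_right (hφ.fderiv_apply (1, 0)) x
  rw [componentDeriv, integral_add (integrable_dState_mul t1 x) (integrable_state_mul t2 x), add_comm]
  refine (pow_le_pow_left₀ (norm_nonneg _) (norm_add_le _ _) 2).trans
    ((add_sq_le_div_add_div h0 h1).trans ?_)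
  have h2 : 0 < 1 - h := by linarith
  exact add_le_add
    (mul_le_mul_of_nonneg_left (norm_integral_state_mul_le t2 x) (inv_nonneg.2 h2.le))
    (mul_le_mul_of_nonneg_left (norm_dState_mul_sq_le t1 hx0 hx) (inv_nonneg.2 h0.le))

end SliceMap

/-! ### Comparison with the second model -/

section ComponentEnergy

/-- For x < 0 there is no interaction and `mu1tilde` is 0, so Bessel's inequality makes the left
side nonpositive; for x > 0 this is `slice_lower_bound`. -/
theorem slice_vertical_lower_bound {φ : ℝ × ℝ → ℂ} (hφ : IsTest φ) {x : ℝ} (hx : x ≠ 0) :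
    mu1tilde x * ‖component φ x‖ ^ 2 -
      1 / 4 * ((∫ y, ‖φ (x, y)‖ ^ 2) - ‖component φ x‖ ^ 2) ≤
    (∫ y, ‖fderiv ℝ φ (x, y) (0, 1)‖ ^ 2) -
      (Set.Ioi 0).indicator (fun x => ‖φ (|x|, x)‖ ^ 2 + ‖φ (|(-x)|, -x)‖ ^ 2) x := by
  have t := isTest_slice_right hφ x
  rcases lt_or_gt_of_ne hx with h | h
  · rw [Set.indicator_of_notMem (by simpa using h.le), mu1tilde, if_neg h.not_ge, zero_mul,
      sub_zero]
    have h1 : ‖component φ x‖ ^ 2 ≤ ∫ y, ‖φ (x, y)‖ ^ 2 := norm_integral_state_mul_le t x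
    have h2 : 0 ≤ ∫ y, ‖fderiv ℝ φ (x, y) (0, 1)‖ ^ 2 := integral_nonneg fun y => by positivity
    linarith
  · have h1 := slice_lower_bound h.le t
    simp_rw [(hasDerivAt_slice_right hφ x _).deriv] at h1
    rw [Set.indicator_of_mem (Set.mem_Ioi.2 h), mu1tilde, if_pos h.le, abs_neg, abs_of_pos h]
    unfold component
    linarith

theorem norm_component_le {g : (L2R2 × (L2R2 × L2R2 × L2R)) × (L2R × L2R)}
    (hg : g ∈ componentGraph) : ‖g.2.1‖ ^ 2 ≤ ‖g.1.1‖ ^ 2 := by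
  obtain ⟨φ, ⟨hφ, h1, -⟩, h5, -⟩ := hg
  rw [norm_sq_eq_iterated h1, norm_sq_eq_integral h5]
  exact integral_mono ((Lp.memLp g.2.1).ae_eq h5).norm.integrable_sq
    (integrable_iterated_norm_sq h1).integral_prod_left
    fun x => norm_integral_state_mul_le (isTest_slice_right hφ x) x

/-- The lower bound on the energy by the energy of the component along the ground state. -/
theorem le_brokenForm {h : ℝ} (hh : 0 < h) (hh1 : h < 1)
    {g : (L2R2 × (L2R2 × L2R2 × L2R)) × (L2R × L2R)} (hg : g ∈ componentGraph) :
    (1 - h) * (schrodingerForm h mu1tilde g.2 g.2).re - h * ‖g.2.1‖ ^ 2 -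
      (1 / 4 + h * M.toReal) * (‖g.1.1‖ ^ 2 - ‖g.2.1‖ ^ 2) ≤ (brokenForm h g.1 g.1).re := by
  obtain ⟨φ, ⟨hφ, h1, h2, h3, h4⟩, h5, h6⟩ := hg
  have hne : ∀ᵐ x : ℝ, x ≠ 0 := by simp [ae_iff]
  have hh2 : 0 < 1 - h := by linarith
  have iA := (integrable_iterated_norm_sq h1).integral_prod_left
  have iX := (integrable_iterated_norm_sq h2).integral_prod_left
  have iY := (integrable_iterated_norm_sq h3).integral_prod_left
  have iF : Integrable fun x => ‖component φ x‖ ^ 2 :=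
    ((Lp.memLp g.2.1).ae_eq h5).norm.integrable_sq
  have iD : Integrable fun x => ‖componentDeriv φ x‖ ^ 2 :=
    ((Lp.memLp g.2.2).ae_eq h6).norm.integrable_sq
  have iT : Integrable fun s : ℝ => ‖φ (|s|, s)‖ ^ 2 :=
    ((Lp.memLp g.1.2.2.2).ae_eq h4).norm.integrable_sq
  obtain ⟨iT', eT⟩ := integral_brokenLine iT
  have iM : Integrable fun x => mu1tilde x * ‖component φ x‖ ^ 2 :=
    iF.bdd_mul (c := 1) measurable_mu1tilde.aestronglyMeasurable
      (Eventually.of_forall abs_mu1tilde_le)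
  have iG : Integrable fun x => (∫ y, ‖φ (x, y)‖ ^ 2) - ‖component φ x‖ ^ 2 := iA.sub iF
  have hD : (1 - h) * (h ^ 2 * ‖g.2.2‖ ^ 2) ≤
      h ^ 2 * ‖g.1.2.1‖ ^ 2 + h * M.toReal * (‖g.1.1‖ ^ 2 - ‖g.2.1‖ ^ 2) := by
    have e1 : ‖g.2.2‖ ^ 2 ≤ (1 - h)⁻¹ * ‖g.1.2.1‖ ^ 2 +
        h⁻¹ * (M.toReal * (‖g.1.1‖ ^ 2 - ‖g.2.1‖ ^ 2)) := by
      rw [norm_sq_eq_iterated h1, norm_sq_eq_iterated h2, norm_sq_eq_integral h5,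
        norm_sq_eq_integral h6, ← integral_sub iA iF, ← integral_const_mul, ← integral_const_mul,
        ← integral_const_mul, ← integral_add (iX.const_mul _) ((iG.const_mul _).const_mul _)]
      refine integral_mono_ae iD ((iX.const_mul _).add ((iG.const_mul _).const_mul _)) ?_
      filter_upwards [hne, ae_differentiableAt_state] with x e1 e2
      exact norm_componentDeriv_sq_le hφ hh hh1 e1 e2
    have e2 := mul_le_mul_of_nonneg_left e1 (show 0 ≤ (1 - h) * h ^ 2 by positivity)
    have e3 : (1 - h) * h ^ 2 * ((1 - h)⁻¹ * ‖g.1.2.1‖ ^ 2 +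
        h⁻¹ * (M.toReal * (‖g.1.1‖ ^ 2 - ‖g.2.1‖ ^ 2))) = h ^ 2 * ‖g.1.2.1‖ ^ 2 +
          (1 - h) * (h * M.toReal * (‖g.1.1‖ ^ 2 - ‖g.2.1‖ ^ 2)) := by
      field_simp
    -- This remainder is nonnegative, so the factor 1 - h in front of it can be dropped.
    have e4 : 0 ≤ h * M.toReal * (‖g.1.1‖ ^ 2 - ‖g.2.1‖ ^ 2) :=
      mul_nonneg (mul_nonneg hh.le ENNReal.toReal_nonneg)
        (sub_nonneg.2 (norm_component_le ⟨φ, ⟨hφ, h1, h2, h3, h4⟩, h5, h6⟩))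
    nlinarith
  have hV : (∫ x, mu1tilde x * ‖component φ x‖ ^ 2) - 1 / 4 * (‖g.1.1‖ ^ 2 - ‖g.2.1‖ ^ 2) ≤
      ‖g.1.2.2.1‖ ^ 2 - ‖g.1.2.2.2‖ ^ 2 := by
    rw [norm_sq_eq_iterated h1, norm_sq_eq_iterated h3, norm_sq_eq_integral h5,
      norm_sq_eq_integral h4, eT, ← integral_sub iA iF, ← integral_const_mul,
      ← integral_sub iM (iG.const_mul _), ← integral_sub iY iT']
    refine integral_mono_ae (iM.sub (iG.const_mul _)) (iY.sub iT') ?_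
    filter_upwards [hne] with x hx
    exact slice_vertical_lower_bound hφ hx
  -- The potential is at least -1, so multiplying it by 1 - h costs at most h‖f‖².
  have hM : -‖g.2.1‖ ^ 2 ≤ ∫ x, mu1tilde x * ‖component φ x‖ ^ 2 := by
    rw [norm_sq_eq_integral h5, ← integral_neg]
    refine integral_mono iF.neg iM fun x => ?_
    have := neg_le_of_abs_le (abs_mu1tilde_le x)
    nlinarith [sq_nonneg ‖component φ x‖]
  rw [brokenForm_self_re, schrodingerForm_self_re h5 h6, ← norm_sq_eq_integral h6]
  nlinarith

theorem counting_brokenOperator_le {h : ℝ} (hh : 0 < h) (hh1 : h < 1) {a : ℝ}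
    (ha : a < -(1 / 4) - h * M.toReal) :
    counting (brokenOperator h) a ≤ counting (mod2 h) ((a + h) / (1 - h)) := by
  rw [mod2_eq, brokenOperator_eq]
  have hh2 : 0 < 1 - h := by linarith
  refine counting_le_counting (isClosedForm_brokenForm hh) (isClosedForm_mod2 hh) componentGraph
    ?_ fun ε hε => ?_
  · rintro v ⟨φ, hφ, h1, h2, h3, h4⟩
    obtain ⟨q, hq, h5, h6⟩ := exists_component hφ
    exact ⟨q, hq, φ, ⟨hφ, h1, h2, h3, h4⟩, h5, h6⟩
  -- The second entry keeps a + δ ≤ -1/4 - hM, so that the terms in ‖φ‖² - ‖f‖² can be discarded;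
  -- the first becomes ε after division by 1 - h.
  · refine ⟨min (ε * (1 - h)) (-(1 / 4) - h * M.toReal - a), lt_min (by positivity) (by linarith),
      fun g hg hlt => ?_⟩
    have e1 := le_brokenForm hh hh1 hg
    have e2 := sub_nonneg.2 (norm_component_le hg)
    have e3 := min_le_left (ε * (1 - h)) (-(1 / 4) - h * M.toReal - a)
    have e4 := min_le_right (ε * (1 - h)) (-(1 / 4) - h * M.toReal - a)
    set δ := min (ε * (1 - h)) (-(1 / 4) - h * M.toReal - a)
    have e5 : (1 - h) * (schrodingerForm h mu1tilde g.2 g.2).re < (a + h + δ) * ‖g.2.1‖ ^ 2 := by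
      nlinarith
    have e6 : (a + h + δ) * ‖g.2.1‖ ^ 2 ≤ (1 - h) * (((a + h) / (1 - h) + ε) * ‖g.2.1‖ ^ 2) := by
      have : (1 - h) * (((a + h) / (1 - h) + ε) * ‖g.2.1‖ ^ 2) =
          (a + h + ε * (1 - h)) * ‖g.2.1‖ ^ 2 := by field_simp
      rw [this]
      exact mul_le_mul_of_nonneg_right (by linarith) (sq_nonneg _)
    exact lt_of_mul_lt_mul_left (e5.trans_le e6) hh2.le

end ComponentEnergy

/-! ### Monotonicity of the count and boundedness from below -/

section Abstract
variable {E F : Type*} [NormedAddCommGroup E] [InnerProductSpace ℂ E] [CompleteSpace E]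
  [NormedAddCommGroup F] [NormedSpace ℂ F] [CompleteSpace F]
  {D : Submodule ℂ (E × F)} {B : E × F → E × F → ℂ}

theorem IsClosedForm.counting_mono (hB : IsClosedForm D B) {a b : ℝ} (hab : a ≤ b) :
    counting (formOperator (closure D) B) a ≤ counting (formOperator (closure D) B) b := by
  refine counting_le_counting hB hB (LinearMap.id (R := ℂ) (M := E × F)).graph
    (fun v hv => ⟨v, subset_closure hv, rfl⟩) fun ε hε => ⟨ε, hε, ?_⟩
  rintro ⟨g, g'⟩ hg hlt
  obtain rfl : g' = g := hg
  exact hlt.trans_le (mul_le_mul_of_nonneg_right (by linarith) (sq_nonneg _))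

/-- A single vector of energy below -c contradicts coercivity. For n = 0 the set would be all of ℝ.
-/
theorem IsClosedForm.bddBelow (hB : IsClosedForm D B) {n : ℕ} (hn : 1 ≤ n) :
    BddBelow {a : ℝ | (n : ℕ∞) ≤ counting (formOperator (closure D) B) a} := by
  obtain ⟨c, δ, hδ, hc⟩ := hB.coercive
  refine ⟨-c, fun a ha => ?_⟩
  by_contra! h
  obtain ⟨v, hv, hlt⟩ := hB.exists_of_le_counting (n := 1)
    (le_trans (by exact_mod_cast hn) ha) (show 0 < -c - a by linarith)
  have h1 := hlt (fun _ => 1) (fun h => one_ne_zero (congrFun h 0))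
  rw [Fin.sum_univ_one, one_smul] at h1
  have h2 := hc _ (hv 0)
  have h3 : 0 ≤ δ * ‖v 0‖ ^ 2 := by positivity
  linarith

end Abstract

/-! ### Finiteness of the second model below -1/4 -/

section Combination

theorem coeFn_sum_smul {X ι : Type*} [MeasurableSpace X] {μ : Measure X} (s : Finset ι)
    {u : ι → Lp ℂ 2 μ} {φ : ι → X → ℂ} (x : ι → ℂ) (h : ∀ i, u i =ᵐ[μ] φ i) :
    (∑ i ∈ s, x i • u i : Lp ℂ 2 μ) =ᵐ[μ] fun y => ∑ i ∈ s, x i * φ i y := by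
  classical
  induction s using Finset.induction_on with
  | empty =>
    simp only [Finset.sum_empty]
    exact Lp.coeFn_zero ℂ 2 μ
  | insert i s hi ih =>
    rw [Finset.sum_insert hi]
    filter_upwards [Lp.coeFn_add (x i • u i) (∑ i ∈ s, x i • u i), Lp.coeFn_smul (x i) (u i), h i,
      ih] with y h1 h2 h3 h4
    rw [h1, Pi.add_apply, h2, Pi.smul_apply, h3, h4, Finset.sum_insert hi, smul_eq_mul]

theorem IsTest.sum {ι : Type*} {s : Finset ι} {φ : ι → ℝ → ℂ} (hφ : ∀ i, IsTest (φ i))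
    (x : ι → ℂ) : IsTest fun y => ∑ i ∈ s, x i * φ i y := by
  classical
  induction s using Finset.induction_on with
  | empty =>
    simp only [Finset.sum_empty]
    exact ⟨contDiff_const, HasCompactSupport.zero⟩
  | insert i s hi ih =>
    simp_rw [Finset.sum_insert hi]
    exact ⟨(contDiff_const.mul (hφ i).1).add ih.1,
      ((hφ i).2.mul_left (f := fun _ => x i)).add ih.2⟩

theorem deriv_sum_mul {ι : Type*} {s : Finset ι} {φ : ι → ℝ → ℂ} (hφ : ∀ i, IsTest (φ i))
    (x : ι → ℂ) (y : ℝ) :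
    deriv (fun y => ∑ i ∈ s, x i * φ i y) y = ∑ i ∈ s, x i * deriv (φ i) y := by
  rw [deriv_fun_sum fun i _ => ((hφ i).1.differentiable (by simp) y).const_mul (x i)]
  exact Finset.sum_congr rfl fun i _ => deriv_const_mul_field _

end Combination

section Poincare
open intervalIntegral

/-- A function that vanishes at the left end point of a short interval is bounded in `L²` by its
derivative. -/
theorem integral_norm_sq_le_of_eq_zero {f : ℝ → ℂ} (hf : IsTest f) {a ℓ : ℝ} (hℓ : 0 < ℓ)
    (ha : f a = 0) :
    ∫ x in a..(a + ℓ), ‖f x‖ ^ 2 ≤ 4 * ℓ ^ 2 * ∫ x in a..(a + ℓ), ‖deriv f x‖ ^ 2 := by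
  have hd : Differentiable ℝ f := hf.1.differentiable (by simp)
  have hc0 : Continuous fun x => ‖f x‖ ^ 2 := hf.1.continuous.norm.pow 2
  have hc1 : Continuous fun x => ‖deriv f x‖ ^ 2 := hf.deriv.1.continuous.norm.pow 2
  have hn : ContDiff ℝ 1 fun x => ‖f x‖ ^ 2 := (hf.1.of_le (by simp)).norm_sq ℝ
  -- The weight is such that integrating |f(t)|² ≤ ∫ G over an interval of length ℓ leaves half of
  -- ∫|f|² on the right, to be absorbed.
  set G : ℝ → ℝ := fun x => (2 * ℓ)⁻¹ * ‖f x‖ ^ 2 + 2 * ℓ * ‖deriv f x‖ ^ 2 with hG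
  have hGc : Continuous G := (hc0.const_mul _).add (hc1.const_mul _)
  have hG0 : ∀ x, 0 ≤ G x := fun x => by positivity
  have h3 : ∀ x, deriv (fun x => ‖f x‖ ^ 2) x ≤ G x := fun x => by
    have e1 := (hd x).hasDerivAt.norm_sq
    rw [e1.deriv]
    have e2 := (le_abs_self _).trans (abs_real_inner_le_norm (f x) (deriv f x))
    have e3 : G x - 2 * (‖f x‖ * ‖deriv f x‖) =
        (2 * ℓ)⁻¹ * (‖f x‖ - 2 * ℓ * ‖deriv f x‖) ^ 2 := by
      rw [hG]; field_simp; ring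
    have e4 : 0 ≤ (2 * ℓ)⁻¹ * (‖f x‖ - 2 * ℓ * ‖deriv f x‖) ^ 2 := by positivity
    linarith
  have h4 : ∀ t ∈ Set.Icc a (a + ℓ), ‖f t‖ ^ 2 ≤ ∫ x in a..(a + ℓ), G x := fun t ht => by
    have e1 := integral_deriv_eq_sub (a := a) (b := t) (f := fun x => ‖f x‖ ^ 2)
      (fun x _ => (hn.differentiable (by simp) x))
      ((hn.continuous_deriv (by simp)).intervalIntegrable _ _)
    simp only [ha, norm_zero, ne_eq, OfNat.ofNat_ne_zero, not_false_eq_true, zero_pow, sub_zero] at e1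
    rw [← e1]
    refine (integral_mono ht.1 ((hn.continuous_deriv (by simp)).intervalIntegrable _ _)
      (hGc.intervalIntegrable _ _) h3).trans ?_
    exact integral_mono_interval le_rfl ht.1 ht.2 (Eventually.of_forall hG0)
      (hGc.intervalIntegrable _ _)
  have h5 : ∫ x in a..(a + ℓ), ‖f x‖ ^ 2 ≤ ∫ _ in a..(a + ℓ), ∫ x in a..(a + ℓ), G x :=
    integral_mono_on (by linarith) (hc0.intervalIntegrable _ _) (by simp) h4
  rw [intervalIntegral.integral_const, add_sub_cancel_left, smul_eq_mul, hG,
    integral_add ((hc0.const_mul _).intervalIntegrable _ _) ((hc1.const_mul _).intervalIntegrable _ _),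
    intervalIntegral.integral_const_mul, intervalIntegral.integral_const_mul] at h5
  have h6 : ℓ * ((2 * ℓ)⁻¹ * ∫ x in a..(a + ℓ), ‖f x‖ ^ 2) =
      (∫ x in a..(a + ℓ), ‖f x‖ ^ 2) / 2 := by field_simp
  rw [mul_add, h6] at h5
  linarith

theorem integral_norm_sq_le_of_nodes {f : ℝ → ℂ} (hf : IsTest f) {ℓ : ℝ} (hℓ : 0 < ℓ) {N : ℕ}
    (h0 : ∀ j < N, f (j * ℓ) = 0) :
    ∫ x in (0 : ℝ)..(N * ℓ), ‖f x‖ ^ 2 ≤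
      4 * ℓ ^ 2 * ∫ x in (0 : ℝ)..(N * ℓ), ‖deriv f x‖ ^ 2 := by
  have hc0 : Continuous fun x => ‖f x‖ ^ 2 := hf.1.continuous.norm.pow 2
  have hc1 : Continuous fun x => ‖deriv f x‖ ^ 2 := hf.deriv.1.continuous.norm.pow 2
  induction N with
  | zero => simp
  | succ N ih =>
    have e : ((N + 1 : ℕ) : ℝ) * ℓ = N * ℓ + ℓ := by push_cast; ring
    have h1 := ih fun j hj => h0 j (hj.trans N.lt_succ_self)
    have h2 := integral_norm_sq_le_of_eq_zero hf hℓ (h0 N N.lt_succ_self)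
    rw [e, ← integral_add_adjacent_intervals (hc0.intervalIntegrable _ (N * ℓ))
      (hc0.intervalIntegrable _ _), ← integral_add_adjacent_intervals
      (hc1.intervalIntegrable _ (N * ℓ)) (hc1.intervalIntegrable _ _), mul_add]
    exact add_le_add h1 h2

end Poincare

section Finite

/-- Since κ ≥ 1/2, the implicit equation gives κ ≤ (1 + e^{-x})/2. -/
theorem tendsto_kappa_sq {c : ℝ} (hc : 1 / 4 < c) : ∃ X : ℝ, 0 < X ∧ ∀ x, X ≤ x → kappa x ^ 2 ≤ c := by
  have h : Tendsto (fun x : ℝ => ((1 + Real.exp (-x)) / 2) ^ 2) atTop (𝓝 (((1 + 0) / 2) ^ 2)) :=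
    ((((Real.tendsto_exp_neg_atTop_nhds_zero)).const_add 1).div_const 2).pow 2
  have h1 : ∀ᶠ x : ℝ in atTop, ((1 + Real.exp (-x)) / 2) ^ 2 < c :=
    h.eventually (gt_mem_nhds (by norm_num; linarith))
  obtain ⟨X, hX⟩ := eventually_atTop.1 h1
  refine ⟨max X 1, by positivity, fun x hx => ?_⟩
  have hx0 : 0 ≤ x := zero_le_one.trans ((le_max_right _ _).trans hx)
  refine le_trans ?_ (hX x ((le_max_left _ _).trans hx)).le
  refine pow_le_pow_left₀ (kappa_pos x).le ?_ 2
  have h2 := kappa_eq_of_nonneg hx0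
  have h3 : Real.exp (-(2 * kappa x * x)) ≤ Real.exp (-x) := by
    refine Real.exp_le_exp.2 (neg_le_neg ?_)
    have := half_lt_kappa x
    nlinarith
  linarith

/-- With nodes at distance h/2 the Poincaré constant 4ℓ² is h², so on [0, Nh/2] the kinetic energy
compensates a potential of at least -1. Elsewhere the potential itself is at least b: it is 0 on the
left, and on the right x lies beyond X. -/
theorem le_schrodingerForm_of_nodes {h : ℝ} (hh : 0 < h) {b X : ℝ} (hb : b ≤ 0)
    (hX : ∀ x, X ≤ x → b ≤ mu1tilde x) {N : ℕ} (hN : X ≤ N * (h / 2)) {f : ℝ → ℂ} (hf : IsTest f)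
    (h0 : ∀ j < N, f (j * (h / 2)) = 0) {p : L2R × L2R} (h1 : p.1 =ᵐ[volume] f)
    (h2 : p.2 =ᵐ[volume] deriv f) :
    b * ‖p.1‖ ^ 2 ≤ (schrodingerForm h mu1tilde p p).re := by
  have hf1 := (hf.memLp (μ := volume)).norm.integrable_sq
  have hf2 := (hf.deriv.memLp (μ := volume)).norm.integrable_sq
  have hY : 0 ≤ (N : ℝ) * (h / 2) := by positivity
  have h3 := integral_norm_sq_le_of_nodes hf (half_pos hh) h0
  rw [intervalIntegral.integral_of_le hY, intervalIntegral.integral_of_le hY] at h3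
  have h4 : ∫ x in Set.Ioc 0 (N * (h / 2)), ‖deriv f x‖ ^ 2 ≤ ∫ x, ‖deriv f x‖ ^ 2 :=
    setIntegral_le_integral hf2 (Eventually.of_forall fun x => by positivity)
  have hm : Integrable fun x => mu1tilde x * ‖f x‖ ^ 2 :=
    hf1.bdd_mul (c := 1) measurable_mu1tilde.aestronglyMeasurable
      (Eventually.of_forall abs_mu1tilde_le)
  have hi : Integrable ((Set.Ioc 0 (N * (h / 2))).indicator fun x => ‖f x‖ ^ 2) :=
    hf1.indicator measurableSet_Ioc
  have h5 : b * (∫ x, ‖f x‖ ^ 2) - ∫ x in Set.Ioc 0 (N * (h / 2)), ‖f x‖ ^ 2 ≤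
      ∫ x, mu1tilde x * ‖f x‖ ^ 2 := by
    rw [← integral_indicator measurableSet_Ioc, ← integral_const_mul,
      ← integral_sub (hf1.const_mul b) hi]
    refine integral_mono_ae ((hf1.const_mul b).sub hi) hm ?_
    have hne : ∀ᵐ x : ℝ, x ≠ 0 := by simp [ae_iff]
    filter_upwards [hne] with x hx
    have hs := sq_nonneg ‖f x‖
    by_cases hx1 : x ∈ Set.Ioc 0 (N * (h / 2))
    · rw [Set.indicator_of_mem hx1]
      have := neg_le_of_abs_le (abs_mu1tilde_le x)
      nlinarith
    · rw [Set.indicator_of_notMem hx1, sub_zero]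
      refine mul_le_mul_of_nonneg_right ?_ hs
      rcases lt_or_gt_of_ne hx with h6 | h6
      · rwa [mu1tilde, if_neg h6.not_ge]
      · refine hX x (hN.trans ?_)
        by_contra! h7
        exact hx1 ⟨h6, h7.le⟩
  rw [schrodingerForm_self_re h1 h2, norm_sq_eq_integral h1]
  have h6 := mul_le_mul_of_nonneg_left h4 (sq_nonneg h)
  linarith

theorem exists_ne_zero_sum_eq_zero {N : ℕ} (A : Fin N → Fin (N + 1) → ℂ) :
    ∃ x : Fin (N + 1) → ℂ, x ≠ 0 ∧ ∀ j, ∑ i, x i * A j i = 0 := by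
  let T : (Fin (N + 1) → ℂ) →ₗ[ℂ] (Fin N → ℂ) := Matrix.mulVecLin (Matrix.of A)
  obtain ⟨x, hx, hx0⟩ := Submodule.exists_mem_ne_zero_of_ne_bot
    (T.ker_ne_bot_of_finrank_lt (by simp))
  refine ⟨x, hx0, fun j => ?_⟩
  have := congrFun (LinearMap.mem_ker.1 hx) j
  simpa [T, Matrix.mulVec, dotProduct, mul_comm] using this

/-- Vanishing at N nodes is N linear conditions, so among N + 1 test functions a nonzero combination
satisfies them. Its energy is at least the midpoint c of b and -1/4, which rules out a count of N +
1 at b. -/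
theorem counting_mod2_lt_top {h : ℝ} (hh : 0 < h) {b : ℝ} (hb : b < -(1 / 4)) :
    counting (mod2 h) b < ⊤ := by
  set c := (b - 1 / 4) / 2 with hc
  obtain ⟨X, hX0, hX⟩ := tendsto_kappa_sq (c := -c) (by linarith)
  obtain ⟨N, hN⟩ := exists_nat_ge (X / (h / 2))
  rw [div_le_iff₀ (half_pos hh)] at hN
  by_contra! htop
  rw [top_le_iff, mod2_eq] at htop
  obtain ⟨v, hv, hlt⟩ := (isClosedForm_mod2 hh).exists_of_le_counting (n := N + 1) (a := b)
    (by rw [htop]; exact le_top) (show 0 < c - b by linarith)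
  choose φ hφ h1 h2 using hv
  obtain ⟨x, hx, hx0⟩ := exists_ne_zero_sum_eq_zero fun (j : Fin N) i => φ i (j * (h / 2))
  have h3 := hlt x hx
  have h4 := le_schrodingerForm_of_nodes hh (b := c) (by linarith) (X := X) (fun t ht => ?_) hN
    (f := fun y => ∑ i, x i * φ i y) (IsTest.sum hφ x) (fun j hj => hx0 ⟨j, hj⟩)
    (p := ∑ i, x i • v i) ?_ ?_
  · rw [add_sub_cancel] at h3
    linarith
  · rw [mu1tilde, if_pos (hX0.le.trans ht), mu1_eq (hX0.le.trans ht)]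
    linarith [hX t ht]
  · rw [Prod.fst_sum]
    exact coeFn_sum_smul _ x h1
  · rw [Prod.snd_sum, funext (deriv_sum_mul hφ x)]
    exact coeFn_sum_smul _ x h2

end Finite

/-! ### The count at -1/4 is infinite for both models -/

section Bumps

/-- A fixed bump function on the line. -/
noncomputable def bump (x : ℝ) : ℂ :=
  ((⟨1 / 4, 1 / 3, by norm_num, by norm_num⟩ : ContDiffBump (0 : ℝ)) x : ℝ)

theorem isTest_bump : IsTest bump :=
  ⟨Complex.ofRealCLM.contDiff.comp (ContDiffBump.contDiff _),
    (ContDiffBump.hasCompactSupport _).comp_left (g := fun t : ℝ => (t : ℂ)) Complex.ofReal_zero⟩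

theorem tsupport_bump : tsupport bump ⊆ Metric.closedBall 0 (1 / 3) := by
  set η : ContDiffBump (0 : ℝ) := ⟨1 / 4, 1 / 3, by norm_num, by norm_num⟩
  have : tsupport bump ⊆ tsupport η := closure_mono fun x hx h => hx (by
    change ((η x : ℝ) : ℂ) = 0
    rw [h, Complex.ofReal_zero])
  rwa [η.tsupport_eq] at this

theorem bump_zero : bump 0 = 1 := by
  rw [bump, ContDiffBump.one_of_mem_closedBall, Complex.ofReal_one]
  exact Metric.mem_closedBall_self (by norm_num)

theorem integral_bump_sq_pos : 0 < ∫ x, ‖bump x‖ ^ 2 := by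
  refine Continuous.integral_pos_of_hasCompactSupport_nonneg_nonzero (x := 0)
    (isTest_bump.1.continuous.norm.pow 2)
    (isTest_bump.2.comp_left (g := fun z : ℂ => ‖z‖ ^ 2) (by simp)) (fun x => by positivity) ?_
  rw [bump_zero]; simp

/-- The bump functions, dilated by `L`. -/
noncomputable def bumps (L : ℝ) (i : ℕ) (x : ℝ) : ℂ := bump (x / L - (i + 1))

variable {L : ℝ}

theorem hasDerivAt_bumps (i : ℕ) (x : ℝ) :
    HasDerivAt (bumps L i) ((L⁻¹ : ℝ) * deriv bump (x / L - (i + 1))) x := by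
  have h1 := (isTest_bump.1.differentiable (by simp) (x / L - (i + 1))).hasDerivAt
  have h2 : HasDerivAt (fun x : ℝ => x / L - (i + 1)) (1 / L) x :=
    ((hasDerivAt_id x).div_const L).sub_const _
  have := h1.scomp x h2
  rw [one_div, Complex.real_smul] at this
  exact this

theorem isTest_bumps (hL : 0 < L) (i : ℕ) : IsTest (bumps L i) := by
  refine ⟨isTest_bump.1.comp ((contDiff_id.div_const L).sub contDiff_const), ?_⟩
  have h1 : HasCompactSupport fun z : ℝ => bump (z - (i + 1)) :=
    isTest_bump.2.comp_homeomorph (Homeomorph.subRight ((i : ℝ) + 1))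
  refine HasCompactSupport.of_support_subset_isCompact
    (isCompact_closedBall ((i + 1) * L) L) fun x hx => ?_
  have h2 := tsupport_bump (subset_closure hx)
  rw [mem_closedBall_zero_iff, Real.norm_eq_abs] at h2
  rw [Metric.mem_closedBall, Real.dist_eq]
  have h3 : x - (i + 1) * L = (x / L - (i + 1)) * L := by field_simp
  rw [h3, abs_mul, abs_of_pos hL]
  nlinarith

theorem abs_sub_le_of_bumps_ne_zero {i : ℕ} {x : ℝ} (h : bumps L i x ≠ 0) :
    |x / L - (i + 1)| ≤ 1 / 3 := by
  have := tsupport_bump (subset_closure h)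
  rwa [mem_closedBall_zero_iff, Real.norm_eq_abs] at this

theorem abs_sub_le_of_deriv_bumps_ne_zero {i : ℕ} {x : ℝ} (h : deriv (bumps L i) x ≠ 0) :
    |x / L - (i + 1)| ≤ 1 / 3 := by
  rw [(hasDerivAt_bumps i x).deriv] at h
  have := tsupport_bump (support_deriv_subset (right_ne_zero_of_mul h))
  rwa [mem_closedBall_zero_iff, Real.norm_eq_abs] at this

theorem integral_comp_div_sub (hL : 0 < L) (G : ℝ → ℝ) (c : ℝ) :
    ∫ x, G (x / L - c) = L * ∫ x, G x := by
  have h1 := Measure.integral_comp_div (fun z => G (z - c)) L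
  rw [abs_of_pos hL, smul_eq_mul, integral_sub_right_eq_self] at h1
  exact h1

theorem integral_bumps_sq (hL : 0 < L) (i : ℕ) :
    ∫ x, ‖bumps L i x‖ ^ 2 = L * ∫ x, ‖bump x‖ ^ 2 :=
  integral_comp_div_sub hL (fun x => ‖bump x‖ ^ 2) _

theorem integral_deriv_bumps_sq (hL : 0 < L) (i : ℕ) :
    ∫ x, ‖deriv (bumps L i) x‖ ^ 2 = L⁻¹ * ∫ x, ‖deriv bump x‖ ^ 2 := by
  simp_rw [(hasDerivAt_bumps i _).deriv, norm_mul, mul_pow]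
  rw [integral_const_mul, integral_comp_div_sub hL (fun x => ‖deriv bump x‖ ^ 2), ← mul_assoc,
    Complex.norm_real, Real.norm_of_nonneg (inv_nonneg.2 hL.le)]
  congr 1
  field_simp

theorem norm_sum_sq_of_disjoint {ι : Type*} [Fintype ι] {a : ι → ℂ}
    (h : ∀ i j, a i ≠ 0 → a j ≠ 0 → i = j) : ‖∑ i, a i‖ ^ 2 = ∑ i, ‖a i‖ ^ 2 := by
  by_cases h0 : ∃ k, a k ≠ 0
  · obtain ⟨k, hk⟩ := h0
    have h1 : ∀ j, j ≠ k → a j = 0 := fun j hj => by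
      by_contra h2
      exact hj (h j k h2 hk)
    rw [Finset.sum_eq_single k (fun j _ hj => h1 j hj) (fun hk => absurd (Finset.mem_univ _) hk),
      Finset.sum_eq_single k (fun j _ hj => by rw [h1 j hj]; simp)
        (fun hk => absurd (Finset.mem_univ _) hk)]
  · push Not at h0
    simp [h0]

/-- Intervals of radius 1/3 about distinct integers are disjoint, so sums of bumps have no cross
terms. -/
theorem eq_of_abs_sub_le {t : ℝ} {i j : ℕ} (hi : |t - (i + 1)| ≤ 1 / 3) (hj : |t - (j + 1)| ≤ 1 / 3) :
    i = j := by
  rw [abs_le] at hi hj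
  have h1 : (i : ℝ) < j + 1 := by linarith [hi.1, hj.2]
  have h2 : (j : ℝ) < i + 1 := by linarith [hi.2, hj.1]
  have h3 : i < j + 1 := by exact_mod_cast h1
  have h4 : j < i + 1 := by exact_mod_cast h2
  omega

theorem norm_sum_bumps_sq {n : ℕ} (x : Fin n → ℂ) (y : ℝ) :
    ‖∑ i, x i * bumps L i y‖ ^ 2 = ∑ i, ‖x i‖ ^ 2 * ‖bumps L i y‖ ^ 2 := by
  rw [norm_sum_sq_of_disjoint]
  · simp_rw [norm_mul, mul_pow]
  · intro i j hi hj
    exact Fin.ext (eq_of_abs_sub_le (abs_sub_le_of_bumps_ne_zero (right_ne_zero_of_mul hi))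
      (abs_sub_le_of_bumps_ne_zero (right_ne_zero_of_mul hj)))

theorem norm_sum_deriv_bumps_sq {n : ℕ} (x : Fin n → ℂ) (y : ℝ) :
    ‖∑ i, x i * deriv (bumps L i) y‖ ^ 2 = ∑ i, ‖x i‖ ^ 2 * ‖deriv (bumps L i) y‖ ^ 2 := by
  rw [norm_sum_sq_of_disjoint]
  · simp_rw [norm_mul, mul_pow]
  · intro i j hi hj
    exact Fin.ext (eq_of_abs_sub_le (abs_sub_le_of_deriv_bumps_ne_zero (right_ne_zero_of_mul hi))
      (abs_sub_le_of_deriv_bumps_ne_zero (right_ne_zero_of_mul hj)))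

/-- If `W ≤ a` on the half line, then the essential spectrum reaches down to `a`. -/
theorem le_counting_schrodinger {h : ℝ} (hh : 0 < h) {W : ℝ → ℝ} (hW : Measurable W)
    (hW1 : ∀ x, |W x| ≤ 1) {a : ℝ} (ha : ∀ x, 0 < x → W x ≤ a) (n : ℕ) :
    (n : ℕ∞) ≤ counting (schrodingerOperator h W) a := by
  refine (isClosedForm_schrodingerForm hh hW hW1).le_counting fun ε hε => ?_
  set A := ∫ x, ‖bump x‖ ^ 2 with hA
  set B := ∫ x, ‖deriv bump x‖ ^ 2 with hB
  have hA0 : 0 < A := integral_bump_sq_pos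
  have hB0 : 0 ≤ B := integral_nonneg fun x => by positivity
  -- A bump dilated by L has ratio h²B/(L²A) of kinetic energy to mass; L is large enough to push it
  -- below ε.
  obtain ⟨L, hL1, hL⟩ : ∃ L : ℝ, 0 < L ∧ h ^ 2 * B < ε * A * L ^ 2 := by
    refine ⟨1 + h ^ 2 * B / (ε * A), by positivity, ?_⟩
    set t := h ^ 2 * B / (ε * A) with ht
    have h1 : h ^ 2 * B = ε * A * t := by rw [ht]; field_simp
    have ht0 : 0 ≤ t := by positivity
    rw [h1]
    refine mul_lt_mul_of_pos_left ?_ (by positivity)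
    nlinarith
  have hφ : ∀ i : Fin n, IsTest (bumps L i) := fun i => isTest_bumps hL1 i
  choose v hv h1 h2 using fun i : Fin n => ((hφ i).isH1Values 0).isH1
  refine ⟨v, hv, fun x hx => ?_⟩
  have e1 : (∑ i, x i • v i).1 =ᵐ[volume] fun y => ∑ i, x i * bumps L i y := by
    rw [Prod.fst_sum]; exact coeFn_sum_smul _ x h1
  have e2 : (∑ i, x i • v i).2 =ᵐ[volume] fun y => ∑ i, x i * deriv (bumps L i) y := by
    rw [Prod.snd_sum]; exact coeFn_sum_smul _ x h2
  have i1 : ∀ i : Fin n, Integrable fun y => ‖x i‖ ^ 2 * ‖bumps L i y‖ ^ 2 := fun i =>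
    (hφ i).memLp.norm.integrable_sq.const_mul _
  have i2 : ∀ i : Fin n, Integrable fun y => ‖x i‖ ^ 2 * ‖deriv (bumps L i) y‖ ^ 2 := fun i =>
    (hφ i).deriv.memLp.norm.integrable_sq.const_mul _
  have i3 : Integrable fun y => ∑ i : Fin n, ‖x i‖ ^ 2 * ‖bumps L i y‖ ^ 2 :=
    integrable_finsetSum _ fun i _ => i1 i
  set S := ∑ i, ‖x i‖ ^ 2 with hS
  have hS0 : 0 < S := by
    obtain ⟨k, hk⟩ := Function.ne_iff.1 hx
    have hk' : 0 < ‖x k‖ ^ 2 := by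
      have := norm_pos_iff.2 hk
      positivity
    exact hk'.trans_le (Finset.single_le_sum (f := fun i => ‖x i‖ ^ 2)
      (fun i _ => sq_nonneg ‖x i‖) (Finset.mem_univ k))
  have f1 : ∫ y, ‖∑ i, x i * bumps L i y‖ ^ 2 = S * (L * A) := by
    simp_rw [norm_sum_bumps_sq]
    rw [integral_finsetSum _ fun i _ => i1 i, hS, Finset.sum_mul]
    refine Finset.sum_congr rfl fun i _ => ?_
    rw [integral_const_mul, integral_bumps_sq hL1]
  have f2 : ∫ y, ‖∑ i, x i * deriv (bumps L i) y‖ ^ 2 = S * (L⁻¹ * B) := by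
    simp_rw [norm_sum_deriv_bumps_sq]
    rw [integral_finsetSum _ fun i _ => i2 i, hS, Finset.sum_mul]
    refine Finset.sum_congr rfl fun i _ => ?_
    rw [integral_const_mul, integral_deriv_bumps_sq hL1]
  have f3 : ∫ y, W y * ‖∑ i, x i * bumps L i y‖ ^ 2 ≤ a * (S * (L * A)) := by
    rw [← f1, ← integral_const_mul]
    simp_rw [norm_sum_bumps_sq]
    refine integral_mono (i3.bdd_mul (c := 1) hW.aestronglyMeasurable (Eventually.of_forall hW1))
      (i3.const_mul a) fun y => ?_
    by_cases hy : 0 < y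
    · exact mul_le_mul_of_nonneg_right (ha y hy)
        (Finset.sum_nonneg fun i _ => by positivity)
    · have : ∑ i : Fin n, ‖x i‖ ^ 2 * ‖bumps L i y‖ ^ 2 = 0 := by
        refine Finset.sum_eq_zero fun i _ => ?_
        have : bumps L i y = 0 := by
          by_contra h0
          have h3 := (abs_le.1 (abs_sub_le_of_bumps_ne_zero h0)).1
          have h4 : y / L ≤ 0 := div_nonpos_of_nonpos_of_nonneg (not_lt.1 hy) hL1.le
          have h5 : (0 : ℝ) ≤ (i : ℕ) := Nat.cast_nonneg _
          linarith
        rw [this]; simp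
      simp only [this, mul_zero, le_refl]
  rw [schrodingerForm_self_re e1 e2, norm_sq_eq_integral e1, f1, f2]
  have f4 : h ^ 2 * (S * (L⁻¹ * B)) < ε * (S * (L * A)) := by
    have : ε * (S * (L * A)) - h ^ 2 * (S * (L⁻¹ * B)) = S * L⁻¹ * (ε * A * L ^ 2 - h ^ 2 * B) := by
      field_simp
    have : 0 < S * L⁻¹ * (ε * A * L ^ 2 - h ^ 2 * B) :=
      mul_pos (by positivity) (by linarith)
    linarith
  linarith

theorem mu1_le {x : ℝ} (hx : 0 ≤ x) : mu1 x ≤ -(1 / 4) := by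
  rw [mu1_eq hx]
  nlinarith [half_lt_kappa x]

/-- It makes the set of thresholds in `nthEigenvalue` nonempty, so that its infimum is not a default
value. -/
theorem le_counting_mod1 {h : ℝ} (hh : 0 < h) (n : ℕ) :
    (n : ℕ∞) ≤ counting (mod1 h) (-(1 / 4)) :=
  le_counting_schrodinger hh measurable_mu1hat abs_mu1hat_le
    (fun x hx => by rw [mu1hat, if_pos hx.le]; exact mu1_le hx.le) n

theorem le_counting_mod2 {h : ℝ} (hh : 0 < h) (n : ℕ) :
    (n : ℕ∞) ≤ counting (mod2 h) (-(1 / 4)) :=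
  le_counting_schrodinger hh measurable_mu1tilde abs_mu1tilde_le
    (fun x hx => by rw [mu1tilde, if_pos hx.le]; exact mu1_le hx.le) n

end Bumps

/-! ### From counting functions to eigenvalues -/

section Eigenvalues

theorem nthEigenvalue_brokenOperator_le {h : ℝ} (hh : 0 < h) {n : ℕ} (hn : 1 ≤ n) :
    nthEigenvalue (brokenOperator h) n ≤ nthEigenvalue (mod1 h) n + h ^ 2 * M.toReal := by
  rw [← sub_le_iff_le_add]
  refine le_csInf ⟨_, le_counting_mod1 hh n⟩ fun a ha => ?_
  rw [sub_le_iff_le_add]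
  exact csInf_le ((isClosedForm_brokenForm hh).bddBelow hn) (le_trans ha (counting_mod1_le hh a))

theorem le_nthEigenvalue_brokenOperator {h c : ℝ} (hh : 0 < h) (hh1 : h < 1)
    (hc : 1 ≤ (1 - h) * c) (hc' : 1 / 4 + M.toReal ≤ (1 - h) * c) {n : ℕ} (hn : 1 ≤ n) :
    (1 - h) * (nthEigenvalue (mod2 h) n - c * h) ≤ nthEigenvalue (brokenOperator h) n := by
  have hbdd := (isClosedForm_mod2 hh).bddBelow hn
  have hh2 : 0 < 1 - h := by linarith
  refine le_csInf ⟨_, le_trans (le_counting_mod1 hh n) (counting_mod1_le hh _)⟩ fun a ha => ?_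
  have h1 := mul_le_mul_of_nonneg_right hc hh.le
  have h2 := mul_le_mul_of_nonneg_right hc' hh.le
  -- Counts are compared only below -1/4 - hM. For larger a, the infinite count of the second model
  -- at -1/4 suffices: by hc', (1 - h)(-1/4 - ch) ≤ -1/4 - hM.
  rcases lt_or_ge a (-(1 / 4) - h * M.toReal) with h3 | h3
  · have h4 : nthEigenvalue (mod2 h) n ≤ (a + h) / (1 - h) :=
      csInf_le hbdd (le_trans ha (counting_brokenOperator_le hh hh1 h3))
    rw [le_div_iff₀ hh2] at h4
    linarith
  · have h4 : nthEigenvalue (mod2 h) n ≤ -(1 / 4) := csInf_le hbdd (le_counting_mod2 hh n)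
    have h5 := mul_le_mul_of_nonneg_left h4 hh2.le
    linarith

end Eigenvalues

end BrokenDelta

theorem proposition3p5 :
    BrokenDelta.M ≠ ⊤ ∧
    ∀ M' : ℝ, BrokenDelta.M.toReal < M' →
      ∃ M₀ > (0 : ℝ), ∃ h₀ > (0 : ℝ), ∀ h : ℝ, 0 < h → h < h₀ →
        (∀ C : ℝ, M₀ * h ≤ C →
          BrokenDelta.counting (BrokenDelta.mod1 h)
              (-1 / 4 - C - h ^ 2 * BrokenDelta.M.toReal) ≤
            BrokenDelta.counting (BrokenDelta.brokenOperator h) (-1 / 4 - C) ∧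
          BrokenDelta.counting (BrokenDelta.brokenOperator h) (-1 / 4 - C) ≤
            BrokenDelta.counting (BrokenDelta.mod2 h)
              ((-1 / 4 - C) / (1 - h) + (4 * M' + 1) * h) ∧
          BrokenDelta.counting (BrokenDelta.mod2 h)
              ((-1 / 4 - C) / (1 - h) + (4 * M' + 1) * h) < ⊤) ∧
        ∀ n : ℕ, 1 ≤ n →
          (1 - h) * (BrokenDelta.nthEigenvalue (BrokenDelta.mod2 h) n - (4 * M' + 1) * h) ≤
            BrokenDelta.nthEigenvalue (BrokenDelta.brokenOperator h) n ∧
          BrokenDelta.nthEigenvalue (BrokenDelta.brokenOperator h) n ≤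
            BrokenDelta.nthEigenvalue (BrokenDelta.mod1 h) n +
              h ^ 2 * BrokenDelta.M.toReal := by
  refine ⟨BrokenDelta.M_ne_top, fun M' hM' => ?_⟩
  have hM0 : 0 ≤ BrokenDelta.M.toReal := ENNReal.toReal_nonneg
  have hM'0 : 0 < M' := hM0.trans_lt hM'
  have hc : 0 < 4 * M' + 1 := by linarith
  -- M₀ exceeds the shift coefficient 4M' + 1 by one, so the threshold in the second model stays
  -- strictly below -1/4. The second entry of h₀ gives h/(1 - h) ≤ (4M' + 1)h, and h < 1/2 gives 1/4
  -- + M ≤ (1 - h)(4M' + 1).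
  refine ⟨4 * M' + 2, by linarith, min (1 / 2) (1 - (4 * M' + 1)⁻¹), lt_min (by norm_num)
    (sub_pos.2 (inv_lt_one_of_one_lt₀ (by linarith))), fun h hh hlt => ?_⟩
  have hh1 : h < 1 / 2 := hlt.trans_le (min_le_left _ _)
  have hh2 : (4 * M' + 1)⁻¹ ≤ 1 - h := by
    have := hlt.trans_le (min_le_right (1 / 2) (1 - (4 * M' + 1)⁻¹))
    linarith
  have hh3 : 1 ≤ (1 - h) * (4 * M' + 1) := by
    rwa [inv_le_iff_one_le_mul₀ hc] at hh2
  have hh4 : 0 < 1 - h := by linarith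
  refine ⟨fun C hC => ⟨?_, ?_, ?_⟩, fun n hn => ⟨?_, ?_⟩⟩
  · have := BrokenDelta.counting_mod1_le hh (-1 / 4 - C - h ^ 2 * BrokenDelta.M.toReal)
    rwa [sub_add_cancel] at this
  · have h1 : -1 / 4 - C < -(1 / 4) - h * BrokenDelta.M.toReal := by nlinarith
    refine (BrokenDelta.counting_brokenOperator_le hh (by linarith) h1).trans
      ((BrokenDelta.isClosedForm_mod2 hh).counting_mono ?_)
    rw [add_div]
    refine add_le_add_right ?_ _
    rw [div_le_iff₀ hh4]
    nlinarith
  · refine BrokenDelta.counting_mod2_lt_top hh ?_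
    have hC0 : 0 ≤ C := le_trans (by positivity) hC
    have h1 : (-1 / 4 - C) / (1 - h) ≤ -1 / 4 - C := by
      rw [div_le_iff₀ hh4]
      nlinarith [mul_nonneg hh.le hC0]
    nlinarith
  · exact BrokenDelta.le_nthEigenvalue_brokenOperator hh (by linarith) hh3 (by nlinarith) hn
  · exact BrokenDelta.nthEigenvalue_brokenOperator_le hh hn
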